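/- Work over $\mathbb{C}$. Let $K=\bigoplus_{i\in\mathbb{Z}}K^i$ be a differential graded Lie algebra (DGLA) with differential $d$ of degree $+1$ and bracket $[\cdot,\cdot]$, and let $M=\bigoplus_{i\in\mathbb{Z}}M^i$ be a graded vector space, regarded as a DGLA with zero differential and zero bracket. For a DGLA $V$ let $V[1]^i=V^{i+1}$, and let $C(V)=\bigoplus_{m\ge1}\bigodot^m(V[1])$ be the reduced graded symmetric coalgebra on $V[1]$, with the coproduct $\Delta(a_1\odot\dots\odot a_m)=\sum_{r=1}^{m-1}\sum_{\sigma\in S(r,m-r)}\epsilon(\sigma)\,(a_{\sigma_1}\odot\dots\odot a_{\sigma_r})\otimes(a_{\sigma_{r+1}}\odot\dots\odot a_{\sigma_m})$ and the codifferential $$\delta(a_1\odot\dots\odot a_m)=\sum_{\sigma\in S(1,m-1)}\epsilon(\sigma)\,da_{\sigma_1}\odot a_{\sigma_2}\odot\dots\odot a_{\sigma_m}+\sum_{\sigma\in S(2,m-2)}\epsilon(\sigma)\,Q(a_{\sigma_1}\odot a_{\sigma_2})\odot a_{\sigma_3}\odot\dots\odot a_{\sigma_m},$$ where $S(p,q)$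 is the set of $(p,q)$-unshuffles, $\epsilon(\sigma)$ is the Koszul sign in $V[1]$, and $Q(a\odot b)=(-1)^{\deg(a,V[1])}[a,b]$. An $L_\infty$-morphism $V\to V'$ is a degree-preserving morphism of differential graded coalgebras $\mu\colon C(V)\to C(V')$; its linear component $\mu_1^1\colon V[1]\to V'[1]$ is the restriction of $\mu$ to $V[1]$ followed by the projection onto $V'[1]$. Let $\mathbf{Art}$ be the category of local Artinian $\mathbb{C}$-algebras $(A,\mathfrak m_A)$ with residue field $\mathbb{C}$. Put $\mathrm{MC}_K(A)=\{a\in K^1\otimes\mathfrak m_A : da+\tfrac12[a,a]=0\}$ and $\mathrm{Def}_K(A)=\mathrm{MC}_K(A)/\exp(K^0\otimes\mathfrak m_A)$, where $\exp(K^0\otimes\mathfrak m_A)$ acts by the gauge action $e^{a}*x=x+\sum_{n\ge0}\frac{(\mathrm{ad}\,a)^n}{(n+1)!}([a,x]-da)$. A functor $\mathbf{Art}\to\mathbf{Set}$ is prorepresentable if it is isomorphic to $\mathrm{Hom}(R,-)$ for some complete local Noetherian $\mathbb{C}$-algebra $R$ with residue field $\mathbb{C}$. A small extension in $\mathbf{Art}$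 is an exact sequence $e\colon 0\to J\to A\to B\to0$, where $A\to B$ is a surjective morphism of $\mathbf{Art}$ with kernel $J$ such that $\mathfrak m_AJ=0$. For $b\in\mathrm{MC}_K(B)$ and any lifting $a\in K^1\otimes\mathfrak m_A$ of $b$, the element $da+\frac12[a,a]$ is a cocycle in $K^2\otimes J$, and its class $ob_e(b)\in H^2(K)\otimes J$ depends only on the class of $b$ in $\mathrm{Def}_K(B)$. The obstruction space $O_K\subset H^2(K)$ is the linear span of all elements $(\mathrm{Id}\otimes f)(ob_e(b))$, where $e$ ranges over all small extensions in $\mathbf{Art}$, $b\in\mathrm{Def}_K(B)$ and $f\in\mathrm{Hom}_{\mathbb{C}}(J,\mathbb{C})$. **Proposition 3.3.** Let $\mu\colon C(K)\to C(M)$ be an $L_\infty$-morphism, and let $H^i(\mu_1^1)\colon H^i(K)\to H^i(M)=M^i$ be the maps induced by $\mu_1^1$ in cohomology. Then: 1. If $M^1$ is finite-dimensional and $H^1(\mu_1^1)\colon H^1(K)\to M^1$ is injective, then $\mathrm{Def}_K$ is prorepresentable. 2. The obstruction space $O_K$ is contained in the kernel of $H^2(\mu_1^1)\colon H^2(K)\to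 M^2$. -/

import Mathlib

open scoped TensorProduct

noncomputable section

/-! ### Graded vector spaces -/

section Graded

variable {W : Type*} [AddCommGroup W] [Module ℂ W] (𝒲 : ℤ → Submodule ℂ W)

/-- The shifted graded vector space `W[n]`, with `W[n]^i = W^(n+i)`. -/
def gradedShift (n : ℤ) : ℤ → Submodule ℂ W := fun i => 𝒲 (n + i)

instance gradedShift.decomposition [DirectSum.Decomposition 𝒲] (n : ℤ) :
    DirectSum.Decomposition (gradedShift 𝒲 n) :=
  DirectSum.IsInternal.chooseDecomposition _ <| by
    have h := (DirectSum.isInternal_submodule_iff_iSupIndep_and_iSup_eq_top 𝒲).1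
      (DirectSum.Decomposition.isInternal 𝒲)
    rw [DirectSum.isInternal_submodule_iff_iSupIndep_and_iSup_eq_top]
    refine ⟨h.1.comp (add_right_injective n), ?_⟩
    rw [← h.2]
    exact (Equiv.addLeft n).iSup_comp (g := 𝒲)

/-! ### The graded symmetric algebra -/

/-- The relations `a ⊙ b = (-1)^(deg a * deg b) b ⊙ a` for homogeneous `a`, `b`. -/
inductive GSymRel : TensorAlgebra ℂ W → TensorAlgebra ℂ W → Prop
  | comm {i j : ℤ} {a b : W} (ha : a ∈ 𝒲 i) (hb : b ∈ 𝒲 j) :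
      GSymRel (TensorAlgebra.ι ℂ a * TensorAlgebra.ι ℂ b)
        (((-1 : ℂ) ^ (i * j)) • (TensorAlgebra.ι ℂ b * TensorAlgebra.ι ℂ a))

/-- The graded symmetric algebra `S(W) = ⨁_{m ≥ 0} ⊙^m W` of a graded vector space, with
product `⊙`. -/
def GSym : Type _ := RingQuot (GSymRel 𝒲)

namespace GSym

instance : Ring (GSym 𝒲) := inferInstanceAs (Ring (RingQuot (GSymRel 𝒲)))

instance : Algebra ℂ (GSym 𝒲) := inferInstanceAs (Algebra ℂ (RingQuot (GSymRel 𝒲)))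

/-- The quotient map `T(W) → S(W)`. -/
def mk : TensorAlgebra ℂ W →ₐ[ℂ] GSym 𝒲 := RingQuot.mkAlgHom ℂ (GSymRel 𝒲)

/-- The inclusion `W = ⊙^1 W ⊆ S(W)`. -/
def ι : W →ₗ[ℂ] GSym 𝒲 :=
  (mk 𝒲).toLinearMap ∘ₗ TensorAlgebra.ι ℂ

theorem ι_mul_ι {i j : ℤ} {a b : W} (ha : a ∈ 𝒲 i) (hb : b ∈ 𝒲 j) :
    ι 𝒲 a * ι 𝒲 b = ((-1 : ℂ) ^ (i * j)) • (ι 𝒲 b * ι 𝒲 a) := by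
  have h : mk 𝒲 _ = mk 𝒲 _ := RingQuot.mkAlgHom_rel ℂ (GSymRel.comm (𝒲 := 𝒲) ha hb)
  rw [map_mul, map_smul, map_mul] at h
  exact h

/-- The universal property of `S(W)`. -/
def lift {R : Type*} [Semiring R] [Algebra ℂ R] (f : W →ₗ[ℂ] R)
    (hf : ∀ (i j : ℤ) (a b : W), a ∈ 𝒲 i → b ∈ 𝒲 j →
      f a * f b = ((-1 : ℂ) ^ (i * j)) • (f b * f a)) : GSym 𝒲 →ₐ[ℂ] R :=
  RingQuot.liftAlgHom ℂ ⟨TensorAlgebra.lift ℂ f, by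
    rintro _ _ ⟨ha, hb⟩
    simpa using hf _ _ _ _ ha hb⟩

theorem lift_ι {R : Type*} [Semiring R] [Algebra ℂ R] (f : W →ₗ[ℂ] R)
    (hf : ∀ (i j : ℤ) (a b : W), a ∈ 𝒲 i → b ∈ 𝒲 j →
      f a * f b = ((-1 : ℂ) ^ (i * j)) • (f b * f a)) (a : W) :
    lift 𝒲 f hf (ι 𝒲 a) = f a :=
  (RingQuot.liftAlgHom_mkAlgHom_apply ℂ _ _ _).trans (TensorAlgebra.lift_ι_apply f a)

/-- Induction on the number of factors. -/
theorem left_induction (p : Submodule ℂ (GSym 𝒲)) (h1 : 1 ∈ p)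
    (hι : ∀ (a : W) (x : GSym 𝒲), x ∈ p → ι 𝒲 a * x ∈ p) (x : GSym 𝒲) : x ∈ p := by
  obtain ⟨y, rfl⟩ : ∃ y, mk 𝒲 y = x := RingQuot.mkAlgHom_surjective ℂ (GSymRel 𝒲) x
  suffices h : ∀ x ∈ p, mk 𝒲 y * x ∈ p by
    simpa using h 1 h1
  induction y using TensorAlgebra.induction with
  | algebraMap r =>
    intro x hx
    rw [AlgHom.commutes, ← Algebra.smul_def]
    exact p.smul_mem r hx
  | ι a => exact fun x hx => hι a x hx
  | mul a b ha hb =>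
    intro x hx
    rw [map_mul, mul_assoc]
    exact ha _ (hb _ hx)
  | add a b ha hb =>
    intro x hx
    rw [map_add, add_mul]
    exact p.add_mem (ha _ hx) (hb _ hx)

/-- The component of degree `n` of `S(W)`: it is spanned by the products `a₁ ⊙ ⋯ ⊙ a_m` of
homogeneous elements with `deg a₁ + ⋯ + deg a_m = n`. -/
def degreePart (n : ℤ) : Submodule ℂ (GSym 𝒲) :=
  Submodule.span ℂ {x | ∃ l : List (Σ i : ℤ, 𝒲 i), (l.map fun a => a.1).sum = n ∧
    x = (l.map fun a => ι 𝒲 (a.2 : W)).prod}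

/-- Left multiplication by `a ∈ W` on `S(W)/⊙^{≥2} W = ℂ ⊕ W`. -/
def truncOp : W →ₗ[ℂ] Module.End ℂ (ℂ × W) where
  toFun a := (LinearMap.inr ℂ ℂ W) ∘ₗ (LinearMap.toSpanSingleton ℂ W a) ∘ₗ (LinearMap.fst ℂ ℂ W)
  map_add' a b := by ext <;> simp
  map_smul' c a := by ext <;> simp

/-- The projection `S(W) → ⊙^0 W ⊕ ⊙^1 W = ℂ ⊕ W`. -/
def trunc : GSym 𝒲 →ₗ[ℂ] ℂ × W :=
  LinearMap.applyₗ ((1, 0) : ℂ × W) ∘ₗ (lift 𝒲 truncOp (by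
    intro i j a b _ _
    ext <;> simp [truncOp])).toLinearMap

/-- The augmentation `S(W) → ⊙^0 W = ℂ`. -/
def counit : GSym 𝒲 →ₗ[ℂ] ℂ := LinearMap.fst ℂ ℂ W ∘ₗ trunc 𝒲

/-- The projection `S(W) → ⊙^1 W = W`. -/
def proj₁ : GSym 𝒲 →ₗ[ℂ] W := LinearMap.snd ℂ ℂ W ∘ₗ trunc 𝒲

theorem trunc_one : trunc 𝒲 1 = (1, 0) := by
  simp [trunc]

theorem trunc_ι_mul (a : W) (x : GSym 𝒲) :
    trunc 𝒲 (ι 𝒲 a * x) = (0, counit 𝒲 x • a) := by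
  simp [trunc, counit, lift_ι, truncOp]

end GSym

variable [DirectSum.Decomposition 𝒲]

/-- The parity operator of a graded vector space: `a ↦ (-1)^(deg a) a` on homogeneous `a`. -/
def parityMap : W →ₗ[ℂ] W :=
  DirectSum.toModule ℂ ℤ W (fun i => ((-1 : ℂ) ^ i) • (𝒲 i).subtype) ∘ₗ
    (DirectSum.decomposeLinearEquiv 𝒲).toLinearMap

theorem parityMap_of_mem {i : ℤ} {a : W} (ha : a ∈ 𝒲 i) :
    parityMap 𝒲 a = ((-1 : ℂ) ^ i) • a := by
  have h : DirectSum.decomposeLinearEquiv 𝒲 a = DirectSum.lof ℂ ℤ (fun i => 𝒲 i) i ⟨a, ha⟩ := by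
    rw [DirectSum.decomposeLinearEquiv_apply, DirectSum.decompose_of_mem 𝒲 ha, DirectSum.lof_eq_of]
  simp [parityMap, h, DirectSum.toModule_lof]

/-- The projection onto the sum of the components of even degree. -/
def evenPart : W →ₗ[ℂ] W := (1 / 2 : ℂ) • (LinearMap.id + parityMap 𝒲)

/-- The projection onto the sum of the components of odd degree. -/
def oddPart : W →ₗ[ℂ] W := (1 / 2 : ℂ) • (LinearMap.id - parityMap 𝒲)

theorem gr_parity_cases {i : ℤ} {a : W} (ha : a ∈ 𝒲 i) :
    (Even i ∧ parityMap 𝒲 a = a ∧ evenPart 𝒲 a = a ∧ oddPart 𝒲 a = 0) ∨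
    (Odd i ∧ parityMap 𝒲 a = -a ∧ evenPart 𝒲 a = 0 ∧ oddPart 𝒲 a = a) := by
  have h := parityMap_of_mem 𝒲 ha
  rcases Int.even_or_odd i with hi | hi
  · rw [hi.neg_one_zpow, one_smul] at h
    refine Or.inl ⟨hi, h, ?_, ?_⟩
    · simp only [evenPart, LinearMap.smul_apply, LinearMap.add_apply, LinearMap.id_apply, h]
      module
    · simp [oddPart, h]
  · rw [hi.neg_one_zpow, neg_one_smul] at h
    refine Or.inr ⟨hi, h, ?_, ?_⟩
    · simp [evenPart, h]
    · simp only [oddPart, LinearMap.smul_apply, LinearMap.sub_apply, LinearMap.id_apply, h]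
      module

namespace GSym

/-- The parity automorphism of `S(W)`, `x ↦ (-1)^(deg x) x`. -/
def parity : GSym 𝒲 →ₐ[ℂ] GSym 𝒲 :=
  lift 𝒲 (ι 𝒲 ∘ₗ parityMap 𝒲) (by
    intro i j a b ha hb
    simp only [LinearMap.comp_apply, parityMap_of_mem 𝒲 ha, parityMap_of_mem 𝒲 hb, map_smul,
      smul_mul_smul_comm, ι_mul_ι 𝒲 ha hb, mul_comm ((-1 : ℂ) ^ i)]
    rw [smul_comm])

/-- Left multiplication by `a ⊗ 1 + 1 ⊗ a` on `S(W) ⊗ S(W)`, with the Koszul sign rule: on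
homogeneous elements,
`(a ⊗ 1 + 1 ⊗ a) (x ⊗ y) = (a ⊙ x) ⊗ y + (-1)^(deg a * deg x) x ⊗ (a ⊙ y)`. -/
def comulOp : W →ₗ[ℂ] Module.End ℂ (GSym 𝒲 ⊗[ℂ] GSym 𝒲) where
  toFun a :=
    TensorProduct.map (LinearMap.mulLeft ℂ (ι 𝒲 a)) LinearMap.id +
    TensorProduct.map LinearMap.id (LinearMap.mulLeft ℂ (ι 𝒲 (evenPart 𝒲 a))) +
    TensorProduct.map (parity 𝒲).toLinearMap (LinearMap.mulLeft ℂ (ι 𝒲 (oddPart 𝒲 a)))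
  map_add' a b := by
    ext x y
    simp [add_mul, TensorProduct.add_tmul, TensorProduct.tmul_add]
    abel
  map_smul' c a := by
    ext x y
    simp [TensorProduct.smul_tmul', smul_add]

theorem comulOp_comm (i j : ℤ) (a b : W) (ha : a ∈ 𝒲 i) (hb : b ∈ 𝒲 j) :
    comulOp 𝒲 a * comulOp 𝒲 b = ((-1 : ℂ) ^ (i * j)) • (comulOp 𝒲 b * comulOp 𝒲 a) := by
  have hab := ι_mul_ι 𝒲 ha hb
  refine TensorProduct.ext' fun x y => ?_
  have h1 : ι 𝒲 a * (ι 𝒲 b * x) = ((-1 : ℂ) ^ (i * j)) • (ι 𝒲 b * (ι 𝒲 a * x)) := by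
    rw [← mul_assoc, hab, smul_mul_assoc, mul_assoc]
  have h2 : ι 𝒲 a * (ι 𝒲 b * y) = ((-1 : ℂ) ^ (i * j)) • (ι 𝒲 b * (ι 𝒲 a * y)) := by
    rw [← mul_assoc, hab, smul_mul_assoc, mul_assoc]
  rcases gr_parity_cases 𝒲 ha with ⟨hi, a1, a2, a3⟩ | ⟨hi, a1, a2, a3⟩ <;>
  rcases gr_parity_cases 𝒲 hb with ⟨hj, b1, b2, b3⟩ | ⟨hj, b1, b2, b3⟩ <;>
  [have hij : Even (i * j) := hi.mul_right j; have hij : Even (i * j) := hi.mul_right j;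
   have hij : Even (i * j) := hj.mul_left i; have hij : Odd (i * j) := hi.mul hj] <;>
  simp only [hij.neg_one_zpow, one_smul, neg_smul] at h1 h2 ⊢ <;>
  simp [comulOp, a2, a3, b2, b3, h1, h2, parity, lift_ι, a1, b1, TensorProduct.neg_tmul, TensorProduct.tmul_neg] <;>
  abel

/-- The coproduct of `S(W)`: the map with `1 ↦ 1 ⊗ 1` that is multiplicative for the Koszul
product of `S(W) ⊗ S(W)` and makes the elements of `W` primitive, that is,
`a₁ ⊙ ⋯ ⊙ a_m ↦ ∑_r ∑_σ ε(σ) (a_{σ₁} ⊙ ⋯ ⊙ a_{σ_r}) ⊗ (a_{σ_{r+1}} ⊙ ⋯ ⊙ a_{σ_m})`, where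
`0 ≤ r ≤ m` and `σ` runs over the unshuffles of type `(r, m - r)`. -/
def comul : GSym 𝒲 →ₗ[ℂ] GSym 𝒲 ⊗[ℂ] GSym 𝒲 :=
  LinearMap.applyₗ ((1 : GSym 𝒲) ⊗ₜ[ℂ] (1 : GSym 𝒲)) ∘ₗ (lift 𝒲 (comulOp 𝒲) (comulOp_comm 𝒲)).toLinearMap

theorem comul_one : comul 𝒲 1 = 1 ⊗ₜ[ℂ] 1 := by
  simp [comul]

theorem comul_ι_mul (a : W) (x : GSym 𝒲) :
    comul 𝒲 (ι 𝒲 a * x) = comulOp 𝒲 a (comul 𝒲 x) := by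
  simp [comul, lift_ι]

end GSym

/-! ### The reduced graded symmetric coalgebra -/

/-- The space `⨁_{m ≥ 1} ⊙^m W` underlying the reduced symmetric coalgebra, as the augmentation
ideal of `S(W)`. -/
def RSym : Submodule ℂ (GSym 𝒲) := LinearMap.ker (GSym.counit 𝒲)

namespace RSym

/-- The projection `S(W) → ⨁_{m ≥ 1} ⊙^m W`. -/
def proj : GSym 𝒲 →ₗ[ℂ] RSym 𝒲 :=
  (LinearMap.id - Algebra.linearMap ℂ (GSym 𝒲) ∘ₗ GSym.counit 𝒲).codRestrict (RSym 𝒲) (by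
    intro x
    simp [RSym, Algebra.algebraMap_eq_smul_one, GSym.counit, GSym.trunc_one])

/-- The reduced coproduct, `a₁ ⊙ ⋯ ⊙ a_m ↦
∑_{r=1}^{m-1} ∑_σ ε(σ) (a_{σ₁} ⊙ ⋯ ⊙ a_{σ_r}) ⊗ (a_{σ_{r+1}} ⊙ ⋯ ⊙ a_{σ_m})`. -/
def comul : RSym 𝒲 →ₗ[ℂ] RSym 𝒲 ⊗[ℂ] RSym 𝒲 :=
  TensorProduct.map (proj 𝒲) (proj 𝒲) ∘ₗ GSym.comul 𝒲 ∘ₗ (RSym 𝒲).subtype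

/-- The inclusion of `W = ⊙^1 W`. -/
def ι : W →ₗ[ℂ] RSym 𝒲 :=
  (GSym.ι 𝒲).codRestrict (RSym 𝒲) (by
    intro a
    have := GSym.trunc_ι_mul 𝒲 a 1
    rw [mul_one] at this
    simp [RSym, GSym.counit, this])

/-- The projection onto `⊙^1 W = W`. -/
def proj₁ : RSym 𝒲 →ₗ[ℂ] W := GSym.proj₁ 𝒲 ∘ₗ (RSym 𝒲).subtype

/-- The component of degree `n`. -/
def degreePart (n : ℤ) : Submodule ℂ (RSym 𝒲) := (GSym.degreePart 𝒲 n).comap (RSym 𝒲).subtype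

end RSym

end Graded

/-! ### Differential graded Lie algebras -/

section DGLAs

/-- A structure of differential graded Lie algebra on the graded vector space `V = ⨁ V^i`. -/
structure DGLA {V : Type*} [AddCommGroup V] [Module ℂ V] (𝒱 : ℤ → Submodule ℂ V) where
  d : V →ₗ[ℂ] V
  bracket : V →ₗ[ℂ] V →ₗ[ℂ] V
  d_mem : ∀ {i : ℤ} {x : V}, x ∈ 𝒱 i → d x ∈ 𝒱 (i + 1)
  bracket_mem : ∀ {i j : ℤ} {x y : V}, x ∈ 𝒱 i → y ∈ 𝒱 j → bracket x y ∈ 𝒱 (i + j)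
  d_d : ∀ x : V, d (d x) = 0
  bracket_skew : ∀ {i j : ℤ} {x y : V}, x ∈ 𝒱 i → y ∈ 𝒱 j →
    bracket x y = -(((-1 : ℂ) ^ (i * j)) • bracket y x)
  leibniz : ∀ {i : ℤ} {x : V} (y : V), x ∈ 𝒱 i →
    d (bracket x y) = bracket (d x) y + ((-1 : ℂ) ^ i) • bracket x (d y)
  jacobi : ∀ {i j : ℤ} {x y : V} (z : V), x ∈ 𝒱 i → y ∈ 𝒱 j →
    bracket x (bracket y z) =
      bracket (bracket x y) z + ((-1 : ℂ) ^ (i * j)) • bracket y (bracket x z)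

namespace DGLA

variable {V : Type*} [AddCommGroup V] [Module ℂ V] {𝒱 : ℤ → Submodule ℂ V}

/-- A graded vector space with trivial differential and trivial bracket. -/
def trivial (𝒱 : ℤ → Submodule ℂ V) : DGLA 𝒱 where
  d := 0
  bracket := 0
  d_mem _ := Submodule.zero_mem _
  bracket_mem _ _ := Submodule.zero_mem _
  d_d _ := rfl
  bracket_skew _ _ := by simp
  leibniz _ _ := by simp
  jacobi _ _ _ := by simp

/-- The space of cocycles `Z^i`. -/
def cocycles (L : DGLA 𝒱) (i : ℤ) : Submodule ℂ V := 𝒱 i ⊓ LinearMap.ker L.d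

/-- The space of coboundaries `B^i`. -/
def coboundaries (L : DGLA 𝒱) (i : ℤ) : Submodule ℂ V := (𝒱 (i - 1)).map L.d

/-- The cohomology `H^i = Z^i / B^i`. -/
abbrev Cohomology (L : DGLA 𝒱) (i : ℤ) : Type _ :=
  L.cocycles i ⧸ (L.coboundaries i).submoduleOf (L.cocycles i)

theorem d_mem_shift (L : DGLA 𝒱) {i : ℤ} {a : V} (ha : a ∈ gradedShift 𝒱 1 i) :
    L.d a ∈ gradedShift 𝒱 1 (i + 1) := by
  have := L.d_mem ha
  rwa [add_assoc] at this

variable [DirectSum.Decomposition 𝒱] (L : DGLA 𝒱)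

/-- The bilinear map `Q(a ⊙ b) = (-1)^(deg(a, V[1])) [a, b]` on `V[1]`. -/
def Q : V →ₗ[ℂ] V →ₗ[ℂ] V := L.bracket ∘ₗ parityMap (gradedShift 𝒱 1)

theorem Q_mem {i j : ℤ} {a b : V} (ha : a ∈ gradedShift 𝒱 1 i) (hb : b ∈ gradedShift 𝒱 1 j) :
    L.Q a b ∈ gradedShift 𝒱 1 (i + j + 1) := by
  simp only [Q, LinearMap.comp_apply, parityMap_of_mem _ ha, map_smul, LinearMap.smul_apply]
  refine Submodule.smul_mem _ _ ?_
  have := L.bracket_mem ha hb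
  rwa [show (1 + i + (1 + j) : ℤ) = 1 + (i + j + 1) by ring] at this

theorem Q_symm {i j : ℤ} {a b : V} (ha : a ∈ gradedShift 𝒱 1 i) (hb : b ∈ gradedShift 𝒱 1 j) :
    L.Q a b = ((-1 : ℂ) ^ (i * j)) • L.Q b a := by
  simp only [Q, LinearMap.comp_apply, parityMap_of_mem _ ha, parityMap_of_mem _ hb, map_smul,
    LinearMap.smul_apply]
  rw [L.bracket_skew ha hb, ← neg_smul, smul_smul, smul_smul]
  congr 1
  have h : (-1 : ℂ) ≠ 0 := by norm_num
  have e : (1 + i) * (1 + j) = i * j + j + i + 1 := by ring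
  rw [e, zpow_add₀ h, zpow_add₀ h, zpow_add₀ h]
  have hi : (-1 : ℂ) ^ i * (-1 : ℂ) ^ i = 1 := by
    rw [← mul_zpow]; simp
  linear_combination ((-1 : ℂ) ^ (i * j) * (-1 : ℂ) ^ j) * hi

/-- The space `S(V[1]) × Hom(V, S(V[1])) × S(V[1])`. -/
abbrev CodiffState {V : Type*} [AddCommGroup V] [Module ℂ V] (𝒱 : ℤ → Submodule ℂ V) : Type _ :=
  GSym (gradedShift 𝒱 1) × (V →ₗ[ℂ] GSym (gradedShift 𝒱 1)) × GSym (gradedShift 𝒱 1)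

open GSym in
/-- Operators on `S(V[1]) × Hom(V, S(V[1])) × S(V[1])` which describe how the triple
`(x, (a ↦ Q_a x), δ x)` changes when `x` is multiplied on the left by `b ∈ V[1]`. Here `Q_a` is the
derivation of `S(V[1])`, of degree `deg a + 1`, that extends `c ↦ Q(a ⊙ c)`:
for homogeneous elements,
`Q_a (b ⊙ x) = Q(a ⊙ b) ⊙ x + (-1)^((deg a + 1) * deg b) b ⊙ Q_a x` and
`δ (b ⊙ x) = d b ⊙ x + (-1)^(deg b) b ⊙ δ x + Q_b x`. -/
def codiffOp : V →ₗ[ℂ] Module.End ℂ (CodiffState 𝒱) where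
  toFun b :=
    { toFun := fun t =>
        (ι _ b * t.1,
          LinearMap.mulRight ℂ t.1 ∘ₗ ι _ ∘ₗ L.Q.flip b +
            LinearMap.mulLeft ℂ (ι _ (evenPart (gradedShift 𝒱 1) b)) ∘ₗ t.2.1 -
            LinearMap.mulLeft ℂ (ι _ (oddPart (gradedShift 𝒱 1) b)) ∘ₗ t.2.1 ∘ₗ
              parityMap (gradedShift 𝒱 1),
          ι _ (L.d b) * t.1 + ι _ (parityMap (gradedShift 𝒱 1) b) * t.2.2 + t.2.1 b)
      map_add' := fun t u => by
        refine Prod.ext ?_ (Prod.ext (LinearMap.ext fun a => ?_) ?_)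
        · simp [mul_add]
        · simp [mul_add]; abel
        · simp [mul_add]; abel
      map_smul' := fun r t => by
        refine Prod.ext ?_ (Prod.ext (LinearMap.ext fun a => ?_) ?_)
        · simp
        · simp [smul_add, smul_sub]
        · simp [smul_add] }
  map_add' b c := by
    refine LinearMap.ext fun t => Prod.ext ?_ (Prod.ext (LinearMap.ext fun a => ?_) ?_)
    · simp [add_mul]
    · simp [add_mul]; abel
    · simp [add_mul]; abel
  map_smul' r b := by
    refine LinearMap.ext fun t => Prod.ext ?_ (Prod.ext (LinearMap.ext fun a => ?_) ?_)
    · simp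
    · simp [smul_add, smul_sub]
    · simp [smul_add]

theorem gr_ext {X : Type*} [AddCommGroup X] [Module ℂ X] {W : Type*} [AddCommGroup W]
    [Module ℂ W] (𝒲 : ℤ → Submodule ℂ W) [DirectSum.Decomposition 𝒲] {f g : W →ₗ[ℂ] X}
    (h : ∀ (k : ℤ) (a : W), a ∈ 𝒲 k → f a = g a) : f = g := by
  refine LinearMap.ext fun a => ?_
  induction a using DirectSum.Decomposition.inductionOn 𝒲 with
  | zero => simp
  | homogeneous a => exact h _ _ a.2
  | add a b ha hb => rw [map_add, map_add, ha, hb]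

open GSym in
theorem codiffOp_comm (i j : ℤ) (b c : V) (hb : b ∈ gradedShift 𝒱 1 i)
    (hc : c ∈ gradedShift 𝒱 1 j) :
    L.codiffOp b * L.codiffOp c = ((-1 : ℂ) ^ (i * j)) • (L.codiffOp c * L.codiffOp b) := by
  have key : ∀ {k l : ℤ} {u v : V}, u ∈ gradedShift 𝒱 1 k → v ∈ gradedShift 𝒱 1 l →
      ∀ x, ι (gradedShift 𝒱 1) u * (ι (gradedShift 𝒱 1) v * x) =
        ((-1 : ℂ) ^ (k * l)) • (ι (gradedShift 𝒱 1) v * (ι (gradedShift 𝒱 1) u * x)) := by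
    intro k l u v hu hv x
    rw [← mul_assoc, ι_mul_ι _ hu hv, smul_mul_assoc, mul_assoc]
  refine LinearMap.ext fun t => Prod.ext ?_ (Prod.ext (gr_ext (gradedShift 𝒱 1) ?_) ?_)
  · simpa [codiffOp] using key hb hc t.1
  · intro k a ha
    have e1 := key (L.Q_mem ha hb) hc t.1
    have e2 := key (L.Q_mem ha hc) hb t.1
    have e3 := key hb hc (t.2.1 a)
    have pa := parityMap_of_mem _ ha
    rcases gr_parity_cases _ hb with ⟨hi, b1, b2, b3⟩ | ⟨hi, b1, b2, b3⟩ <;>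
    rcases gr_parity_cases _ hc with ⟨hj, c1, c2, c3⟩ | ⟨hj, c1, c2, c3⟩ <;>
    rcases Int.even_or_odd k with hk | hk <;>
    simp only [mul_comm (k + _ + 1), zpow_mul, zpow_add₀ (show (-1 : ℂ) ≠ 0 by norm_num), hi.neg_one_zpow, hj.neg_one_zpow, hk.neg_one_zpow, one_zpow, one_smul, mul_one, zpow_one, neg_smul, mul_neg, neg_neg] at e1 e2 e3 pa ⊢ <;>
    simp [codiffOp, b2, b3, c2, c3, pa, e1, e2, e3, mul_add, mul_sub, mul_assoc] <;>
    abel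
  · have e1 := key (L.d_mem_shift hb) hc t.1
    have e2 := key (L.d_mem_shift hc) hb t.1
    have e3 := key hb hc t.2.2
    have e4 := L.Q_symm hb hc
    rcases gr_parity_cases _ hb with ⟨hi, b1, b2, b3⟩ | ⟨hi, b1, b2, b3⟩ <;>
    rcases gr_parity_cases _ hc with ⟨hj, c1, c2, c3⟩ | ⟨hj, c1, c2, c3⟩ <;>
    simp only [mul_comm (_ + 1 : ℤ), zpow_mul, zpow_add₀ (show (-1 : ℂ) ≠ 0 by norm_num), hi.neg_one_zpow, hj.neg_one_zpow, one_zpow, one_smul, mul_one, zpow_one, neg_smul, mul_neg, neg_neg] at e1 e2 e3 e4 ⊢ <;>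
    simp [codiffOp, b1, b2, b3, c1, c2, c3, e1, e2, e3, e4, mul_add] <;>
    abel

/-- The lift of `codiffOp` to `S(V[1])`. -/
def codiffHom : GSym (gradedShift 𝒱 1) →ₐ[ℂ] Module.End ℂ (CodiffState 𝒱) :=
  GSym.lift _ L.codiffOp L.codiffOp_comm

/-- The map `x ↦ (a ↦ Q_a x)`, where `Q_a` is the derivation of `S(V[1])` with
`Q_a c = Q(a ⊙ c)` for `c ∈ V[1]`. -/
def contract : GSym (gradedShift 𝒱 1) →ₗ[ℂ] V →ₗ[ℂ] GSym (gradedShift 𝒱 1) :=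
  LinearMap.fst ℂ _ _ ∘ₗ LinearMap.snd ℂ _ _ ∘ₗ LinearMap.applyₗ ((1, 0, 0) : CodiffState 𝒱) ∘ₗ
    L.codiffHom.toLinearMap

/-- The codifferential on `S(V[1])`,
`δ(a₁ ⊙ ⋯ ⊙ a_m) = ∑_{σ ∈ S(1,m-1)} ε(σ) d a_{σ₁} ⊙ a_{σ₂} ⊙ ⋯ ⊙ a_{σ_m}
  + ∑_{σ ∈ S(2,m-2)} ε(σ) Q(a_{σ₁} ⊙ a_{σ₂}) ⊙ a_{σ₃} ⊙ ⋯ ⊙ a_{σ_m}`,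
defined by induction on the number of factors: see `codiffFull_ι_mul` and `contract_ι_mul`. -/
def codiffFull : GSym (gradedShift 𝒱 1) →ₗ[ℂ] GSym (gradedShift 𝒱 1) :=
  LinearMap.snd ℂ _ _ ∘ₗ LinearMap.snd ℂ _ _ ∘ₗ LinearMap.applyₗ ((1, 0, 0) : CodiffState 𝒱) ∘ₗ
    L.codiffHom.toLinearMap

theorem codiffHom_fst (x : GSym (gradedShift 𝒱 1)) : (L.codiffHom x ((1, 0, 0) : CodiffState 𝒱)).1 = x := by
  refine GSym.left_induction _ (LinearMap.eqLocus (LinearMap.fst ℂ _ _ ∘ₗ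
    LinearMap.applyₗ ((1, 0, 0) : CodiffState 𝒱) ∘ₗ L.codiffHom.toLinearMap) LinearMap.id) ?_ ?_ x
  · simp
  · intro a x hx
    simp only [LinearMap.mem_eqLocus, LinearMap.comp_apply, AlgHom.toLinearMap_apply,
      LinearMap.applyₗ_apply_apply, LinearMap.fst_apply, LinearMap.id_apply] at hx ⊢
    rw [map_mul, codiffHom, GSym.lift_ι, Module.End.mul_apply, ← codiffHom]
    simp [codiffOp, hx]

theorem contract_one : L.contract 1 = 0 := by simp [contract]

theorem codiffFull_one : L.codiffFull 1 = 0 := by simp [codiffFull]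

theorem contract_ι_mul {i j : ℤ} {a b : V} (ha : a ∈ gradedShift 𝒱 1 i)
    (hb : b ∈ gradedShift 𝒱 1 j) (x : GSym (gradedShift 𝒱 1)) :
    L.contract (GSym.ι _ b * x) a = GSym.ι _ (L.Q a b) * x +
      ((-1 : ℂ) ^ ((i + 1) * j)) • (GSym.ι _ b * L.contract x a) := by
  have hx := L.codiffHom_fst x
  have pa := parityMap_of_mem _ ha
  have h : L.contract (GSym.ι _ b * x) =
      (L.codiffOp b (L.codiffHom x ((1, 0, 0) : CodiffState 𝒱))).2.1 := by
    simp only [contract, LinearMap.comp_apply, AlgHom.toLinearMap_apply, map_mul,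
      LinearMap.applyₗ_apply_apply, LinearMap.fst_apply, LinearMap.snd_apply]
    rw [Module.End.mul_apply]
    simp only [codiffHom, GSym.lift_ι]
  rw [h, mul_comm (i + 1), zpow_mul]
  rcases gr_parity_cases _ hb with ⟨hj, b1, b2, b3⟩ | ⟨hj, b1, b2, b3⟩
  · simp [codiffOp, b2, b3, hx, hj.neg_one_zpow, contract]
  · simp [codiffOp, b2, b3, hx, hj.neg_one_zpow, contract, pa,
      zpow_add₀ (show (-1 : ℂ) ≠ 0 by norm_num), sub_eq_add_neg]

theorem codiffFull_ι_mul (b : V) (x : GSym (gradedShift 𝒱 1)) :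
    L.codiffFull (GSym.ι _ b * x) = GSym.ι _ (L.d b) * x +
      GSym.ι _ (parityMap (gradedShift 𝒱 1) b) * L.codiffFull x + L.contract x b := by
  have hx := L.codiffHom_fst x
  have h : L.codiffFull (GSym.ι _ b * x) =
      (L.codiffOp b (L.codiffHom x ((1, 0, 0) : CodiffState 𝒱))).2.2 := by
    simp only [codiffFull, LinearMap.comp_apply, AlgHom.toLinearMap_apply, map_mul,
      LinearMap.applyₗ_apply_apply, LinearMap.snd_apply]
    rw [Module.End.mul_apply]
    simp only [codiffHom, GSym.lift_ι]
  rw [h]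
  simp [codiffOp, hx, contract, codiffFull]

theorem counit_ι_mul {W : Type*} [AddCommGroup W] [Module ℂ W] (𝒲 : ℤ → Submodule ℂ W) (b : W)
    (x : GSym 𝒲) : GSym.counit 𝒲 (GSym.ι 𝒲 b * x) = 0 := by
  simp [GSym.counit, GSym.trunc_ι_mul]

theorem contract_mem (x : GSym (gradedShift 𝒱 1)) (a : V) :
    L.contract x a ∈ RSym (gradedShift 𝒱 1) := by
  suffices h : L.contract x ∈ LinearMap.ker (LinearMap.llcomp ℂ V _ ℂ
      (GSym.counit (gradedShift 𝒱 1))) by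
    exact LinearMap.congr_fun (LinearMap.mem_ker.1 h) a
  refine GSym.left_induction _ ((LinearMap.ker (LinearMap.llcomp ℂ V _ ℂ
      (GSym.counit (gradedShift 𝒱 1)))).comap L.contract) ?_ ?_ x
  · simp [contract_one]
  · intro b x _
    rw [Submodule.mem_comap, LinearMap.mem_ker]
    refine gr_ext (gradedShift 𝒱 1) fun k c hc => ?_
    induction b using DirectSum.Decomposition.inductionOn (gradedShift 𝒱 1) with
    | zero => simp
    | homogeneous b => simp [L.contract_ι_mul hc b.2, counit_ι_mul]
    | add b b' h h' =>
      simp only [map_add, add_mul, LinearMap.add_apply] at h h' ⊢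
      rw [h, h']
      simp

theorem codiffFull_mem (x : GSym (gradedShift 𝒱 1)) :
    L.codiffFull x ∈ RSym (gradedShift 𝒱 1) := by
  refine GSym.left_induction _ ((RSym (gradedShift 𝒱 1)).comap L.codiffFull) ?_ ?_ x
  · simp [codiffFull_one]
  · intro b x _
    rw [Submodule.mem_comap, codiffFull_ι_mul]
    exact add_mem (add_mem (counit_ι_mul _ _ _) (counit_ι_mul _ _ _)) (L.contract_mem x b)

/-- The codifferential `δ` of the coalgebra `C(V)`. -/
def codiff : RSym (gradedShift 𝒱 1) →ₗ[ℂ] RSym (gradedShift 𝒱 1) :=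
  (L.codiffFull ∘ₗ (RSym (gradedShift 𝒱 1)).subtype).codRestrict _
    fun x => L.codiffFull_mem x

theorem codiff_trivial : (trivial 𝒱).codiff = 0 := by
  have hc : (trivial 𝒱).contract = 0 := by
    refine LinearMap.ext fun x => ?_
    refine GSym.left_induction _ (LinearMap.ker (trivial 𝒱).contract) ?_ ?_ x
    · simp [contract_one]
    · intro b x hx
      rw [LinearMap.mem_ker] at hx ⊢
      refine gr_ext (gradedShift 𝒱 1) fun k c hc => ?_
      induction b using DirectSum.Decomposition.inductionOn (gradedShift 𝒱 1) with
      | zero => simp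
      | homogeneous b => rw [contract_ι_mul _ hc b.2, hx]; simp [Q, trivial]
      | add b b' h h' =>
        simp only [map_add, add_mul, LinearMap.add_apply] at h h' ⊢
        rw [h, h']; simp
  have hd : (trivial 𝒱).codiffFull = 0 := by
    refine LinearMap.ext fun x => ?_
    refine GSym.left_induction _ (LinearMap.ker (trivial 𝒱).codiffFull) ?_ ?_ x
    · simp [codiffFull_one]
    · intro b x hx
      rw [LinearMap.mem_ker] at hx ⊢
      rw [codiffFull_ι_mul, hx, hc]
      simp [trivial]
  refine LinearMap.ext fun x => Subtype.ext ?_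
  simp [codiff, hd]

end DGLA

/-- An `L_∞`-morphism between differential graded Lie algebras `V` and `V'`: a morphism of
differential graded coalgebras `C(V) → C(V')`, where `C(V)` is the reduced symmetric coalgebra
generated by `V[1]`. -/
structure LInftyHom {V : Type*} [AddCommGroup V] [Module ℂ V] {𝒱 : ℤ → Submodule ℂ V}
    [DirectSum.Decomposition 𝒱] {V' : Type*} [AddCommGroup V'] [Module ℂ V']
    {𝒱' : ℤ → Submodule ℂ V'} [DirectSum.Decomposition 𝒱'] (L : DGLA 𝒱) (L' : DGLA 𝒱') where
  toLinearMap : RSym (gradedShift 𝒱 1) →ₗ[ℂ] RSym (gradedShift 𝒱' 1)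
  map_degree : ∀ (n : ℤ) (x : RSym (gradedShift 𝒱 1)),
    x ∈ RSym.degreePart (gradedShift 𝒱 1) n →
      toLinearMap x ∈ RSym.degreePart (gradedShift 𝒱' 1) n
  map_comul : ∀ x : RSym (gradedShift 𝒱 1),
    RSym.comul (gradedShift 𝒱' 1) (toLinearMap x) =
      TensorProduct.map toLinearMap toLinearMap (RSym.comul (gradedShift 𝒱 1) x)
  map_codiff : ∀ x : RSym (gradedShift 𝒱 1), toLinearMap (L.codiff x) = L'.codiff (toLinearMap x)

theorem RSym.proj₁_mem {W : Type*} [AddCommGroup W] [Module ℂ W] (𝒲 : ℤ → Submodule ℂ W) (n : ℤ)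
    (x : RSym 𝒲) (hx : x ∈ RSym.degreePart 𝒲 n) : RSym.proj₁ 𝒲 x ∈ 𝒲 n := by
  suffices h : GSym.degreePart 𝒲 n ≤ (𝒲 n).comap (GSym.proj₁ 𝒲) from h hx
  refine Submodule.span_le.2 ?_
  rintro _ ⟨l, hl, rfl⟩
  simp only [SetLike.mem_coe, Submodule.mem_comap, GSym.proj₁, LinearMap.comp_apply]
  rcases l with _ | ⟨a, _ | ⟨b, l⟩⟩
  · simp [GSym.trunc_one]
  · obtain ⟨i, a⟩ := a
    obtain rfl : i = n := by simpa using hl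
    simp only [List.map_cons, List.map_nil, List.prod_cons, List.prod_nil]
    rw [GSym.trunc_ι_mul]
    simp [GSym.counit, GSym.trunc_one]
  · simp [GSym.trunc_ι_mul, DGLA.counit_ι_mul]

namespace LInftyHom

variable {V : Type*} [AddCommGroup V] [Module ℂ V] {𝒱 : ℤ → Submodule ℂ V}
  [DirectSum.Decomposition 𝒱] {M : Type*} [AddCommGroup M] [Module ℂ M]
  {ℳ : ℤ → Submodule ℂ M} [DirectSum.Decomposition ℳ] {L : DGLA 𝒱}

/-- The linear component `μ₁¹ : V[1] → V'[1]` of an `L_∞`-morphism `μ`. -/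
def linearPart {L' : DGLA ℳ} (μ : LInftyHom L L') : V →ₗ[ℂ] M :=
  RSym.proj₁ (gradedShift ℳ 1) ∘ₗ μ.toLinearMap ∘ₗ RSym.ι (gradedShift 𝒱 1)

theorem linearPart_mem {L' : DGLA ℳ} (μ : LInftyHom L L') {i : ℤ} {a : V} (ha : a ∈ 𝒱 i) :
    μ.linearPart a ∈ ℳ i := by
  have h : μ.linearPart a ∈ gradedShift ℳ 1 (i - 1) := by
    refine RSym.proj₁_mem _ _ _ (μ.map_degree _ _ (Submodule.subset_span ?_))
    refine ⟨[⟨i - 1, ⟨a, ?_⟩⟩], by simp, ?_⟩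
    · rw [gradedShift, add_sub_cancel]
      exact ha
    · rw [List.map_singleton, List.prod_singleton]
      rfl
  rwa [gradedShift, add_sub_cancel] at h

theorem linearPart_d (μ : LInftyHom L (DGLA.trivial ℳ)) (a : V) : μ.linearPart (L.d a) = 0 := by
  have h : RSym.ι (gradedShift 𝒱 1) (L.d a) = L.codiff (RSym.ι (gradedShift 𝒱 1) a) := by
    have := L.codiffFull_ι_mul a 1
    rw [L.codiffFull_one, L.contract_one] at this
    refine Subtype.ext ?_
    simp only [mul_one, mul_zero, add_zero, LinearMap.zero_apply] at this
    exact this.symm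
  rw [linearPart, LinearMap.comp_apply, LinearMap.comp_apply, h, μ.map_codiff, DGLA.codiff_trivial]
  simp

/-- The map `H^i(μ₁¹) : H^i(V) → H^i(M) = M^i` for an `L_∞`-morphism `μ` to a graded vector space
`M` with trivial differential and bracket. -/
def cohomologyMap (μ : LInftyHom L (DGLA.trivial ℳ)) (i : ℤ) : L.Cohomology i →ₗ[ℂ] ℳ i :=
  Submodule.liftQ _ ((μ.linearPart ∘ₗ (L.cocycles i).subtype).codRestrict (ℳ i)
    fun x => μ.linearPart_mem x.2.1) (by
      rintro x ⟨y, _, hy⟩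
      rw [LinearMap.mem_ker]
      refine Subtype.ext ?_
      have := μ.linearPart_d y
      rw [hy] at this
      exact this)

end LInftyHom

end DGLAs

/-! ### Functors of Artin rings -/

section Artin

open CategoryTheory IsLocalRing

/-- A local Artinian `ℂ`-algebra with residue field `ℂ`. (Such an algebra is finite-dimensional,
so that nothing is lost by taking the underlying set in the lowest universe.) -/
structure ArtAlg where
  carrier : Type
  [commRing : CommRing carrier]
  [algebra : Algebra ℂ carrier]
  [isLocalRing : IsLocalRing carrier]
  [isArtinianRing : IsArtinianRing carrier]
  residue_bijective : Function.Bijective (algebraMap ℂ (ResidueField carrier))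

namespace ArtAlg

attribute [instance] commRing algebra isLocalRing isArtinianRing

/-- The category **Art**. Homomorphisms of `ℂ`-algebras between such rings are automatically
local, see `ArtAlg.map_mem`. -/
instance : Category ArtAlg where
  Hom A B := A.carrier →ₐ[ℂ] B.carrier
  id A := AlgHom.id ℂ A.carrier
  comp f g := AlgHom.comp g f

/-- The homomorphism of algebras underlying a morphism. -/
abbrev toAlgHom {A B : ArtAlg} (f : A ⟶ B) : A.carrier →ₐ[ℂ] B.carrier := f

/-- The maximal ideal `m_A`, as a complex vector space. -/
def maxIdeal (A : ArtAlg) : Submodule ℂ A.carrier :=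
  (maximalIdeal A.carrier).restrictScalars ℂ

theorem maximalIdeal_nilpotent (A : ArtAlg) : ∃ n : ℕ, maximalIdeal A.carrier ^ n = ⊥ := by
  have := IsArtinianRing.isNilpotent_jacobson_bot (R := A.carrier)
  rwa [IsLocalRing.jacobson_eq_maximalIdeal ⊥ bot_ne_top] at this

theorem map_mem {A B : ArtAlg} (f : A.carrier →ₐ[ℂ] B.carrier) {x : A.carrier}
    (hx : x ∈ A.maxIdeal) : f x ∈ B.maxIdeal := by
  obtain ⟨n, hn⟩ := A.maximalIdeal_nilpotent
  have h : x ^ n = 0 := by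
    have := Ideal.pow_mem_pow (show x ∈ maximalIdeal A.carrier from hx) n
    rwa [hn] at this
  refine (mem_maximalIdeal _).2 fun hu => ?_
  have h2 := hu.pow n
  rw [← map_pow, h, map_zero] at h2
  exact not_isUnit_zero h2

end ArtAlg

/-- A functor `F : Art → Set` is prorepresentable if it is isomorphic to `Hom(R, -)` for some
complete local Noetherian `ℂ`-algebra `R` with residue field `ℂ`. (Homomorphisms of `ℂ`-algebras
from `R` to the objects of **Art** are automatically local.) -/
def IsProrepresentable.{u} (F : ArtAlg ⥤ Type u) : Prop :=
  ∃ (R : Type) (_ : CommRing R) (_ : Algebra ℂ R) (_ : IsLocalRing R),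
    IsNoetherianRing R ∧ IsAdicComplete (maximalIdeal R) R ∧
    Function.Bijective (algebraMap ℂ (ResidueField R)) ∧
    ∃ e : ∀ A : ArtAlg, F.obj A ≃ (R →ₐ[ℂ] A.carrier),
      ∀ (A B : ArtAlg) (f : A ⟶ B) (x : F.obj A),
        e B (F.map f x) = (ArtAlg.toAlgHom f).comp (e A x)

/-- A small extension `0 → J → A → B → 0` in **Art**: a surjective homomorphism `p : A → B` whose
kernel `J` satisfies `m_A J = 0`. -/
structure SmallExtension (A B : ArtAlg) where
  p : A.carrier →ₐ[ℂ] B.carrier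
  surjective : Function.Surjective p
  mul_eq_zero : ∀ x ∈ A.maxIdeal, ∀ y : A.carrier, p y = 0 → x * y = 0

/-- The kernel `J` of a small extension. -/
abbrev SmallExtension.J {A B : ArtAlg} (e : SmallExtension A B) : Submodule ℂ A.carrier :=
  LinearMap.ker e.p.toLinearMap

/-! ### Maurer-Cartan elements, gauge equivalence, obstructions -/

namespace DGLA

universe u

variable {V : Type u} [AddCommGroup V] [Module ℂ V] {𝒱 : ℤ → Submodule ℂ V} (L : DGLA 𝒱)
  (A : ArtAlg)

/-- The subspace `V^i ⊗ m_A` of `V ⊗ A`. -/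
def tensorMax (𝒱 : ℤ → Submodule ℂ V) (i : ℤ) (A : ArtAlg) : Submodule ℂ (V ⊗[ℂ] A.carrier) :=
  LinearMap.range (TensorProduct.map (𝒱 i).subtype A.maxIdeal.subtype)

/-- The differential `d ⊗ id` of `V ⊗ A`. -/
def dT : V ⊗[ℂ] A.carrier →ₗ[ℂ] V ⊗[ℂ] A.carrier := TensorProduct.map L.d LinearMap.id

/-- The bracket `[x ⊗ a, y ⊗ b] = [x, y] ⊗ a b` of `V ⊗ A`. -/
def bracketT : V ⊗[ℂ] A.carrier →ₗ[ℂ] V ⊗[ℂ] A.carrier →ₗ[ℂ] V ⊗[ℂ] A.carrier :=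
  TensorProduct.map₂ L.bracket (LinearMap.mul ℂ A.carrier)

/-- The expression `d x + [x, x] / 2`. -/
def curvature (x : V ⊗[ℂ] A.carrier) : V ⊗[ℂ] A.carrier :=
  L.dT A x + (1 / 2 : ℂ) • L.bracketT A x x

/-- The set of Maurer-Cartan elements, `x ∈ V^1 ⊗ m_A` with `d x + [x, x] / 2 = 0`. -/
abbrev MC : Type u := {x : V ⊗[ℂ] A.carrier // x ∈ tensorMax 𝒱 1 A ∧ L.curvature A x = 0}

/-- The gauge action
`e^a * x = x + ∑_{n ≥ 0} (ad a)^n ([a, x] - d a) / (n + 1)!`, for `a ∈ V^0 ⊗ m_A`; the sum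
is finite because `m_A` is nilpotent. -/
def gauge (a x : V ⊗[ℂ] A.carrier) : V ⊗[ℂ] A.carrier :=
  x + ∑ᶠ n : ℕ, (((n + 1).factorial : ℂ)⁻¹) • ((L.bracketT A a) ^ n) (L.bracketT A a x - L.dT A a)

/-- The relation of lying in the same orbit of the gauge group `exp(V^0 ⊗ m_A)`. -/
def GaugeRel (x y : L.MC A) : Prop := ∃ a ∈ tensorMax 𝒱 0 A, y.1 = L.gauge A a x.1

theorem pow_ad_eq_zero (A : ArtAlg) : ∃ N : ℕ, ∀ n ≥ N, ∀ a ∈ tensorMax 𝒱 0 A,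
    ∀ y : V ⊗[ℂ] A.carrier, ((L.bracketT A a) ^ n) y = 0 := by
  obtain ⟨N, hN⟩ := A.maximalIdeal_nilpotent
  let T : ℕ → Submodule ℂ (V ⊗[ℂ] A.carrier) := fun k =>
    LinearMap.range (TensorProduct.map (LinearMap.id : V →ₗ[ℂ] V)
      ((maximalIdeal A.carrier ^ k).restrictScalars ℂ).subtype)
  have step : ∀ k, ∀ a ∈ tensorMax 𝒱 0 A, ∀ y ∈ T k, L.bracketT A a y ∈ T (k + 1) := by
    rintro k _ ⟨a, rfl⟩ _ ⟨y, rfl⟩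
    induction a with
    | zero => simp
    | add a b ha hb =>
      rw [map_add, map_add, LinearMap.add_apply]
      exact add_mem ha hb
    | tmul v m =>
      induction y with
      | zero => simp
      | add a b ha hb =>
        rw [map_add, map_add]
        exact add_mem ha hb
      | tmul w z =>
        refine ⟨L.bracket v w ⊗ₜ ⟨(m : A.carrier) * z, ?_⟩, ?_⟩
        · rw [Submodule.restrictScalars_mem, pow_succ']
          exact Ideal.mul_mem_mul m.2 z.2
        · simp [bracketT]
  have h0 : ∀ y, y ∈ T 0 := by
    intro y
    induction y with
    | zero => exact zero_mem _
    | add a b ha hb => exact add_mem ha hb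
    | tmul v z => exact ⟨v ⊗ₜ ⟨z, by simp⟩, by simp⟩
  have hT : ∀ n, ∀ a ∈ tensorMax 𝒱 0 A, ∀ y, ((L.bracketT A a) ^ n) y ∈ T n := by
    intro n a ha y
    induction n with
    | zero => exact h0 _
    | succ n ih =>
      rw [pow_succ', Module.End.mul_apply]
      exact step n a ha _ ih
  refine ⟨N, fun n hn a ha y => ?_⟩
  have hb : maximalIdeal A.carrier ^ n = ⊥ := le_bot_iff.1 (hN ▸ Ideal.pow_le_pow_right hn)
  have hs : ((maximalIdeal A.carrier ^ n).restrictScalars ℂ).subtype = 0 := by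
    refine LinearMap.ext fun z => ?_
    have hz : (z : A.carrier) ∈ (⊥ : Ideal A.carrier) := hb.le z.2
    exact hz
  obtain ⟨z, hz⟩ := hT n a ha y
  rw [← hz, hs, TensorProduct.map_zero_right, LinearMap.zero_apply]

variable {A} {B : ArtAlg}

/-- The map `V ⊗ A → V ⊗ B` induced by `f : A → B`. -/
def baseChange (V : Type u) [AddCommGroup V] [Module ℂ V] (f : A.carrier →ₐ[ℂ] B.carrier) :
    V ⊗[ℂ] A.carrier →ₗ[ℂ] V ⊗[ℂ] B.carrier :=
  TensorProduct.map LinearMap.id f.toLinearMap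

theorem baseChange_mem (f : A.carrier →ₐ[ℂ] B.carrier) {i : ℤ} {x : V ⊗[ℂ] A.carrier}
    (hx : x ∈ tensorMax 𝒱 i A) : baseChange V f x ∈ tensorMax 𝒱 i B := by
  obtain ⟨x, rfl⟩ := hx
  induction x with
  | zero => simp
  | add x y hx hy => rw [map_add, map_add]; exact add_mem hx hy
  | tmul v m => exact ⟨v ⊗ₜ ⟨f m, ArtAlg.map_mem f m.2⟩, by simp [baseChange]⟩

theorem baseChange_dT (f : A.carrier →ₐ[ℂ] B.carrier) (x : V ⊗[ℂ] A.carrier) :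
    baseChange V f (L.dT A x) = L.dT B (baseChange V f x) := by
  induction x with
  | zero => simp
  | add x y hx hy => simp only [map_add, hx, hy]
  | tmul v m => simp [baseChange, dT]

theorem baseChange_bracketT (f : A.carrier →ₐ[ℂ] B.carrier) (x y : V ⊗[ℂ] A.carrier) :
    baseChange V f (L.bracketT A x y) =
      L.bracketT B (baseChange V f x) (baseChange V f y) := by
  induction x with
  | zero => simp
  | add x x' hx hx' => simp only [map_add, LinearMap.add_apply, hx, hx']
  | tmul v m =>
    induction y with
    | zero => simp
    | add y y' hy hy' => simp only [map_add, hy, hy']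
    | tmul w n => simp [baseChange, bracketT]

theorem baseChange_curvature (f : A.carrier →ₐ[ℂ] B.carrier) (x : V ⊗[ℂ] A.carrier) :
    baseChange V f (L.curvature A x) = L.curvature B (baseChange V f x) := by
  simp only [curvature, map_add, map_smul, baseChange_dT, baseChange_bracketT]

theorem baseChange_gauge (f : A.carrier →ₐ[ℂ] B.carrier) {a : V ⊗[ℂ] A.carrier}
    (ha : a ∈ tensorMax 𝒱 0 A) (x : V ⊗[ℂ] A.carrier) :
    baseChange V f (L.gauge A a x) = L.gauge B (baseChange V f a) (baseChange V f x) := by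
  have hpow : ∀ (n : ℕ) (y : V ⊗[ℂ] A.carrier), baseChange V f (((L.bracketT A a) ^ n) y) =
      ((L.bracketT B (baseChange V f a)) ^ n) (baseChange V f y) := by
    intro n y
    induction n with
    | zero => simp
    | succ n ih =>
      rw [pow_succ', pow_succ', Module.End.mul_apply, Module.End.mul_apply, baseChange_bracketT, ih]
  obtain ⟨N, hN⟩ := L.pow_ad_eq_zero A
  rw [gauge, gauge, map_add]
  congr 1
  rw [map_finsum]
  · refine finsum_congr fun n => ?_
    rw [map_smul, hpow, map_sub, baseChange_dT, baseChange_bracketT]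
  · refine (Set.finite_lt_nat N).subset fun n hn => ?_
    by_contra h
    exact hn (by simp only [hN n (not_lt.1 h) a ha, smul_zero])

/-- The map `MC(A) → MC(B)` induced by `f : A → B`. -/
def MC.map (f : A.carrier →ₐ[ℂ] B.carrier) (x : L.MC A) : L.MC B :=
  ⟨baseChange V f x.1, baseChange_mem f x.2.1, by
    rw [← baseChange_curvature, x.2.2, map_zero]⟩

/-- The deformation functor `Def(A) = MC(A) / exp(V^0 ⊗ m_A)`, where `exp(V^0 ⊗ m_A)` is the group
`V^0 ⊗ m_A` with the Baker-Campbell-Hausdorff product. Since this group acts, `GaugeRel` is already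
an equivalence relation and the quotient is the set of its orbits. -/
def Def : ArtAlg ⥤ Type u where
  obj A := Quot (L.GaugeRel A)
  map {A B} f := ↾(Quot.map (MC.map L (ArtAlg.toAlgHom f)) (by
    rintro x y ⟨a, ha, h⟩
    exact ⟨baseChange V (ArtAlg.toAlgHom f) a, baseChange_mem _ ha, 
      (congrArg (baseChange V (ArtAlg.toAlgHom f)) h).trans (L.baseChange_gauge _ ha x.1)⟩))
  map_id A := by
    ext x
    induction x using Quot.inductionOn with
    | h x =>
      refine congrArg (Quot.mk _) (Subtype.ext ?_)
      exact LinearMap.congr_fun TensorProduct.map_id x.1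
  map_comp {A B C} f g := by
    ext x
    induction x using Quot.inductionOn with
    | h x =>
      refine congrArg (Quot.mk _) (Subtype.ext ?_)
      exact LinearMap.congr_fun (TensorProduct.map_comp LinearMap.id
        (ArtAlg.toAlgHom g).toLinearMap LinearMap.id (ArtAlg.toAlgHom f).toLinearMap) x.1

/-- `L.IsObstruction e β ω` means that `ω = ob_e(β)` is the obstruction in `H^2 ⊗ J` to lifting
`β ∈ Def(B)` along the small extension `e`: for some Maurer-Cartan element `b` representing `β`
and some lifting `a ∈ V^1 ⊗ m_A` of `b`, the element `d a + [a, a] / 2` of `V ⊗ A` is the image of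
some `z ∈ Z^2 ⊗ J`, and `ω` is the class of `z`. (The class does not depend on the choices.) -/
def IsObstruction (e : SmallExtension A B) (β : L.Def.obj B) (ω : L.Cohomology 2 ⊗[ℂ] e.J) :
    Prop :=
  ∃ b : L.MC B, Quot.mk (L.GaugeRel B) b = β ∧
    ∃ a ∈ tensorMax 𝒱 1 A, baseChange V e.p a = b.1 ∧
      ∃ z : L.cocycles 2 ⊗[ℂ] e.J,
        TensorProduct.map (L.cocycles 2).subtype e.J.subtype z = L.curvature A a ∧
        TensorProduct.map (Submodule.mkQ _) LinearMap.id z = ω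

/-- The obstruction space `O ⊆ H^2`: the subspace generated by the elements `(id ⊗ f)(ob_e(β))`
where `e : 0 → J → A → B → 0` is a small extension, `β ∈ Def(B)` and `f` is a linear functional
on `J`. -/
def obstructionSpace : Submodule ℂ (L.Cohomology 2) :=
  Submodule.span ℂ {v | ∃ (A B : ArtAlg) (e : SmallExtension A B) (β : L.Def.obj B)
    (ω : L.Cohomology 2 ⊗[ℂ] e.J) (f : e.J →ₗ[ℂ] ℂ), L.IsObstruction e β ω ∧
      v = TensorProduct.rid ℂ _ (TensorProduct.map LinearMap.id f ω)}

end DGLA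

end Artin
end

open scoped TensorProduct

noncomputable section

/-! Let ψ be the corestriction of μ, the part of μ with values in M. The codifferential of C(M) is
zero, so ψ ∘ δ = 0 (`corestriction_codiffFull`). For x in K^1 ⊗ m_A the exponential e^x in S(K[1]) ⊗
A is a finite sum, and δ(e^x) = (dx + [x,x]/2) e^x (`codiffC_nilExp`). Everything follows from
applying ψ to such identities.

Obstructions: let a lift a Maurer-Cartan element along a small extension with kernel J. Its
curvature has coefficients in J, so m_A kills it and δ(e^a) is the curvature itself. Applying ψ
shows that μ₁¹ annihilates the obstruction cocycle (`LInftyHom.obstructionSpace_le_ker`).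

Prorepresentability: after a retraction of M onto U = M^1, put Φ(x) = ψ(e^x) in U ⊗ m_A
(`potential`). Along the gauge path p(t) = e^{ta} * x, the derivative of e^p is ([a,p] - da) e^p =
-δ(a e^p), so Φ is constant on gauge orbits (`potential_gaugePath`). If H^1(μ₁¹) is injective, then
Φ separates orbits. This is an induction over small extensions: two solutions that agree modulo J
differ by a cocycle k, Φ changes by ψ(k), and so k is exact when Φ does not change
(`gaugeRel_of_map_eq`, `reflTransGen_of_potential_eq`).

Hence Def_K is a subfunctor of A ↦ U ⊗ m_A, which is Hom(P, -) for a power series ring P in dim U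
variables. Because gauge equivalences lift along surjections, solutions with prescribed Φ can be
glued over fibre products and descended to subalgebras (`isPotential_of_fibreProduct`,
`isPotential_of_injective`). A subfunctor of Hom(P, -) with these two properties, and containing the
homomorphisms that kill the maximal ideal, is Hom(P/I, -) for an ideal I
(`exists_ideal_of_subfunctor`). -/

/-! ### Exponentials of nilpotent elements -/

section NilExp

variable {R : Type*} [Ring R] [Algebra ℂ R]

/-- The exponential of a nilpotent element of a complex algebra. -/
def nilExp (x : R) : R := ∑ᶠ n : ℕ, ((n.factorial : ℂ)⁻¹) • x ^ n

theorem nilExp_eq_sum {x : R} {N : ℕ} (hx : x ^ N = 0) :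
    nilExp x = ∑ n ∈ Finset.range N, ((n.factorial : ℂ)⁻¹) • x ^ n := by
  refine finsum_eq_sum_of_support_subset _ fun n hn => ?_
  by_contra h
  refine hn ?_
  simp only [pow_eq_zero_of_le (show N ≤ n by simpa using h) hx, smul_zero]

theorem map_nilExp {S : Type*} [Ring S] [Algebra ℂ S] (f : R →ₐ[ℂ] S) {x : R}
    (hx : IsNilpotent x) : f (nilExp x) = nilExp (f x) := by
  obtain ⟨N, hN⟩ := hx
  rw [nilExp_eq_sum hN, nilExp_eq_sum (N := N) (by rw [← map_pow, hN, map_zero]), map_sum]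
  simp

/-- An operator which behaves like a derivation on left multiples of `x`. -/
theorem derivation_pow (D : R →ₗ[ℂ] R) {x b : R} (h1 : D 1 = 0)
    (hD : ∀ z, D (x * z) = b * z + x * D z) (hc : Commute x b) (n : ℕ) :
    D (x ^ (n + 1)) = ((n : ℂ) + 1) • (b * x ^ n) := by
  induction n with
  | zero => simpa [h1] using hD 1
  | succ n ih =>
    rw [pow_succ' x (n + 1), hD, ih, mul_smul_comm, ← mul_assoc, hc.eq, mul_assoc, ← pow_succ']
    push_cast
    module

/-- The chain rule: D sends x^(n+1)/(n+1)! to b x^n/n!, which shifts the series by one. The Leibniz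
rule is asked only when the left factor is x, so that the lemma covers both the contraction Q_a and
d/dt. -/
theorem derivation_nilExp (D : R →ₗ[ℂ] R) {x b : R} (h1 : D 1 = 0)
    (hD : ∀ z, D (x * z) = b * z + x * D z) (hc : Commute x b) (hx : IsNilpotent x) :
    D (nilExp x) = b * nilExp x := by
  obtain ⟨N, hN⟩ := hx
  have hN' : x ^ (N + 1) = 0 := pow_eq_zero_of_le N.le_succ hN
  conv_lhs => rw [nilExp_eq_sum hN']
  rw [nilExp_eq_sum hN, map_sum, Finset.sum_range_succ', Finset.mul_sum]
  simp only [map_smul, pow_zero, h1, smul_zero, add_zero]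
  refine Finset.sum_congr rfl fun n _ => ?_
  rw [derivation_pow D h1 hD hc, smul_smul, mul_smul_comm]
  congr 1
  have : (n : ℂ) + 1 ≠ 0 := by exact_mod_cast Nat.succ_ne_zero n
  have h2 : (n.factorial : ℂ) ≠ 0 := by exact_mod_cast n.factorial_ne_zero
  rw [Nat.factorial_succ]
  push_cast
  field_simp

/-- An operator of order two on powers of `x`. -/
theorem secondOrder_nilExp (δ q : R →ₗ[ℂ] R) {x d b : R} (h1 : δ 1 = 0) (q1 : q 1 = 0)
    (hδ : ∀ z, δ (x * z) = d * z + x * δ z + q z) (hq : ∀ z, q (x * z) = b * z + x * q z)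
    (hd : Commute x d) (hb : Commute x b) (hx : IsNilpotent x) :
    δ (nilExp x) = (d + (1 / 2 : ℂ) • b) * nilExp x := by
  have hδ1 : δ x = d := by simpa [h1, q1] using hδ 1
  -- δ hits one factor, in n + 2 ways, or a pair of factors, in (n+2)(n+1)/2 ways. After division by
  -- (n+2)! the pair count leaves the coefficient 1/2 of b.
  have key : ∀ n : ℕ, δ (x ^ (n + 2)) =
      ((n : ℂ) + 2) • (d * x ^ (n + 1)) + (((n : ℂ) + 2) * ((n : ℂ) + 1) / 2) • (b * x ^ n) := by
    intro n
    induction n with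
    | zero =>
      rw [pow_succ' x (0 + 1), hδ, derivation_pow q q1 hq hb]
      simp only [zero_add, pow_one, hδ1, hd.eq, pow_zero]
      push_cast
      module
    | succ n ih =>
      rw [show n + 1 + 2 = (n + 2) + 1 by ring, pow_succ' x (n + 2), hδ, ih,
        show n + 2 = (n + 1) + 1 by ring, derivation_pow q q1 hq hb, mul_add, mul_smul_comm,
        mul_smul_comm, ← mul_assoc, hd.eq, mul_assoc, ← pow_succ', ← mul_assoc, hb.eq, mul_assoc,
        ← pow_succ']
      push_cast
      module
  obtain ⟨N, hN⟩ := hx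
  have hN1 : x ^ (N + 1) = 0 := pow_eq_zero_of_le N.le_succ hN
  have hN2 : x ^ (N + 2) = 0 := pow_eq_zero_of_le (by lia) hN
  have e1 : d * nilExp x = ∑ n ∈ Finset.range N, (((n + 1).factorial : ℂ)⁻¹) • (d * x ^ (n + 1)) +
      d := by
    rw [nilExp_eq_sum hN1, Finset.sum_range_succ', mul_add, Finset.mul_sum]
    simp
  rw [add_mul, e1, smul_mul_assoc]
  conv_lhs => rw [nilExp_eq_sum hN2]
  rw [map_sum, Finset.sum_range_succ', Finset.sum_range_succ']
  simp only [map_smul, pow_zero, h1, smul_zero, add_zero, zero_add, pow_one, hδ1]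
  rw [nilExp_eq_sum hN, Finset.mul_sum, Finset.smul_sum, add_right_comm, ← Finset.sum_add_distrib]
  simp only [Nat.factorial_one, Nat.cast_one, inv_one, one_smul]
  congr 1
  refine Finset.sum_congr rfl fun n _ => ?_
  rw [show n + 1 + 1 = n + 2 by ring, key, smul_add, smul_smul, smul_smul, mul_smul_comm, smul_smul]
  have h0 : (n : ℂ) + 1 ≠ 0 := by exact_mod_cast Nat.succ_ne_zero n
  have h0' : (n : ℂ) + 2 ≠ 0 := by exact_mod_cast Nat.succ_ne_zero (n + 1)
  have h2 : (n.factorial : ℂ) ≠ 0 := by exact_mod_cast n.factorial_ne_zero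
  rw [Nat.factorial_succ (n + 1), Nat.factorial_succ n]
  push_cast
  rw [show (n : ℂ) + 1 + 1 = n + 2 by ring]
  congr 2 <;> field_simp

/-- Perturbing `x` by an element annihilated by `x` and by itself. -/
theorem nilExp_add_of_mul_eq_zero {x h : R} (hx : IsNilpotent x) (h1 : x * h = 0) (h2 : h * x = 0)
    (h3 : h * h = 0) : nilExp (x + h) = nilExp x + h := by
  -- Every product of two factors involving h vanishes, so h survives only in the linear term of the
  -- series.
  have key : ∀ n : ℕ, (x + h) ^ (n + 2) = x ^ (n + 2) := by
    intro n
    induction n with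
    | zero => rw [pow_two, pow_two]; simp [mul_add, add_mul, h1, h2, h3]
    | succ n ih =>
      rw [pow_succ (x + h), ih, mul_add, pow_succ x (n + 1), mul_assoc _ x h, h1]
      simp [pow_succ, mul_assoc]
  obtain ⟨N, hN⟩ := hx
  have hN2 : x ^ (N + 2) = 0 := pow_eq_zero_of_le (by lia) hN
  rw [nilExp_eq_sum (x := x + h) ((key N).trans hN2), nilExp_eq_sum hN2, Finset.sum_range_succ',
    Finset.sum_range_succ', Finset.sum_range_succ', Finset.sum_range_succ']
  simp only [add_assoc, one_add_one_eq_two, key]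
  simp
  abel

theorem mul_nilExp_of_mul_eq_zero {x h : R} (hx : IsNilpotent x) (h1 : h * x = 0) :
    h * nilExp x = h := by
  obtain ⟨N, hN⟩ := hx
  have hN1 : x ^ (N + 1) = 0 := pow_eq_zero_of_le N.le_succ hN
  rw [nilExp_eq_sum hN1, Finset.sum_range_succ', mul_add, Finset.mul_sum,
    Finset.sum_eq_zero fun n _ => ?_]
  · simp
  · rw [mul_smul_comm, pow_succ', ← mul_assoc, h1, zero_mul, smul_zero]

end NilExp

/-! ### Extension of scalars of a graded space -/

section Coefficients

variable {W : Type*} [AddCommGroup W] [Module ℂ W]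

/-- The image of `W' ⊗ N` in `W ⊗ C`, for subspaces `W' ⊆ W` and `N ⊆ C`. -/
def tensorSub {C : Type*} [AddCommGroup C] [Module ℂ C] (W' : Submodule ℂ W)
    (N : Submodule ℂ C) : Submodule ℂ (W ⊗[ℂ] C) :=
  LinearMap.range (TensorProduct.map W'.subtype N.subtype)

section

variable {C : Type*} [AddCommGroup C] [Module ℂ C] {W' : Submodule ℂ W} {N : Submodule ℂ C}

theorem tmul_mem_tensorSub {w : W} {c : C} (hw : w ∈ W') (hc : c ∈ N) :
    w ⊗ₜ[ℂ] c ∈ tensorSub W' N :=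
  ⟨(⟨w, hw⟩ : W') ⊗ₜ (⟨c, hc⟩ : N), by simp⟩

theorem tensorSub_eq_span : tensorSub W' N =
    Submodule.span ℂ {z | ∃ w ∈ W', ∃ c ∈ N, z = w ⊗ₜ[ℂ] c} := by
  refine le_antisymm ?_ (Submodule.span_le.2 ?_)
  · rintro _ ⟨z, rfl⟩
    induction z with
    | zero => simp
    | add x y hx hy => rw [map_add]; exact add_mem hx hy
    | tmul w c => exact Submodule.subset_span ⟨w, w.2, c, c.2, rfl⟩
  · rintro _ ⟨w, hw, c, hc, rfl⟩
    exact tmul_mem_tensorSub hw hc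

theorem tensorSub_le {T : Submodule ℂ (W ⊗[ℂ] C)} :
    tensorSub W' N ≤ T ↔ ∀ w ∈ W', ∀ c ∈ N, w ⊗ₜ[ℂ] c ∈ T := by
  refine ⟨fun h w hw c hc => h (tmul_mem_tensorSub hw hc), fun h => ?_⟩
  rw [tensorSub_eq_span, Submodule.span_le]
  rintro _ ⟨w, hw, c, hc, rfl⟩
  exact h w hw c hc

theorem tensorSub_mono {W'' : Submodule ℂ W} {N' : Submodule ℂ C} (hW : W' ≤ W'') (hN : N ≤ N') :
    tensorSub W' N ≤ tensorSub W'' N' :=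
  tensorSub_le.2 fun _ hw _ hc => tmul_mem_tensorSub (hW hw) (hN hc)

theorem tensorSub_top : tensorSub (⊤ : Submodule ℂ W) (⊤ : Submodule ℂ C) = ⊤ := by
  rw [eq_top_iff, ← TensorProduct.span_tmul_eq_top, Submodule.span_le]
  rintro _ ⟨w, c, rfl⟩
  exact tmul_mem_tensorSub trivial trivial

@[elab_as_elim]
theorem tensorSub_induction {p : (x : W ⊗[ℂ] C) → x ∈ tensorSub W' N → Prop}
    (zero : p 0 (zero_mem _))
    (tmul : ∀ w (hw : w ∈ W') c (hc : c ∈ N), p (w ⊗ₜ c) (tmul_mem_tensorSub hw hc))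
    (add : ∀ x y hx hy, p x hx → p y hy → p (x + y) (add_mem hx hy))
    {x : W ⊗[ℂ] C} (hx : x ∈ tensorSub W' N) : p x hx := by
  suffices h : ∃ h, p x h from h.2
  obtain ⟨z, rfl⟩ := hx
  induction z with
  | zero => exact ⟨by simp, by simpa using zero⟩
  | add x y hx hy =>
    obtain ⟨h, hx⟩ := hx
    obtain ⟨h', hy⟩ := hy
    exact ⟨by rw [map_add]; exact add_mem h h', by simpa using add _ _ h h' hx hy⟩
  | tmul w c => exact ⟨_, tmul w w.2 c c.2⟩

theorem map_mem_tensorSub {W₁ C₁ : Type*} [AddCommGroup W₁] [Module ℂ W₁] [AddCommGroup C₁]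
    [Module ℂ C₁] {W₁' : Submodule ℂ W₁} {N₁ : Submodule ℂ C₁} {f : W →ₗ[ℂ] W₁} {g : C →ₗ[ℂ] C₁}
    (hf : ∀ w ∈ W', f w ∈ W₁') (hg : ∀ c ∈ N, g c ∈ N₁) {x : W ⊗[ℂ] C}
    (hx : x ∈ tensorSub W' N) : TensorProduct.map f g x ∈ tensorSub W₁' N₁ := by
  induction hx using tensorSub_induction with
  | zero => simp
  | tmul w hw c hc => exact tmul_mem_tensorSub (hf w hw) (hg c hc)
  | add x y _ _ hx hy => rw [map_add]; exact add_mem hx hy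

theorem map₂_mem_tensorSub {W₁ C₁ W₂ C₂ : Type*} [AddCommGroup W₁] [Module ℂ W₁] [AddCommGroup C₁]
    [Module ℂ C₁] [AddCommGroup W₂] [Module ℂ W₂] [AddCommGroup C₂]
    [Module ℂ C₂] {W₁' : Submodule ℂ W₁} {N₁ : Submodule ℂ C₁} {W₂' : Submodule ℂ W₂}
    {N₂ : Submodule ℂ C₂} {f : W →ₗ[ℂ] W₁ →ₗ[ℂ] W₂} {g : C →ₗ[ℂ] C₁ →ₗ[ℂ] C₂}
    (hf : ∀ w ∈ W', ∀ v ∈ W₁', f w v ∈ W₂') (hg : ∀ c ∈ N, ∀ e ∈ N₁, g c e ∈ N₂) {x : W ⊗[ℂ] C}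
    (hx : x ∈ tensorSub W' N) {y : W₁ ⊗[ℂ] C₁} (hy : y ∈ tensorSub W₁' N₁) :
    TensorProduct.map₂ f g x y ∈ tensorSub W₂' N₂ := by
  induction hx using tensorSub_induction with
  | zero => simp
  | add x x' _ _ hx hx' => rw [map_add, LinearMap.add_apply]; exact add_mem hx hx'
  | tmul w hw c hc =>
    induction hy using tensorSub_induction with
    | zero => simp
    | add x y _ _ hx hy => rw [map_add]; exact add_mem hx hy
    | tmul v hv e he =>
      rw [TensorProduct.map₂_apply_tmul]
      exact tmul_mem_tensorSub (hf w hw v hv) (hg c hc e he)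

end

variable {R : Type*} [Ring R] [Algebra ℂ R] {C : Type*} [CommRing C] [Algebra ℂ C]

theorem mul_mem_tensorSub_top {I J : Ideal C} {x y : R ⊗[ℂ] C}
    (hx : x ∈ tensorSub ⊤ (I.restrictScalars ℂ)) (hy : y ∈ tensorSub ⊤ (J.restrictScalars ℂ)) :
    x * y ∈ tensorSub ⊤ ((I * J).restrictScalars ℂ) := by
  induction hx using tensorSub_induction with
  | zero => simp
  | add x x' _ _ hx hx' => rw [add_mul]; exact add_mem hx hx'
  | tmul w hw c hc =>
    induction hy using tensorSub_induction with
    | zero => simp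
    | add x y _ _ hx hy => rw [mul_add]; exact add_mem hx hy
    | tmul v hv e he =>
      rw [Algebra.TensorProduct.tmul_mul_tmul]
      exact tmul_mem_tensorSub trivial (Ideal.mul_mem_mul hc he)

theorem pow_mem_tensorSub_top {I : Ideal C} {x : R ⊗[ℂ] C}
    (hx : x ∈ tensorSub ⊤ (I.restrictScalars ℂ)) (n : ℕ) :
    x ^ n ∈ tensorSub ⊤ ((I ^ n).restrictScalars ℂ) := by
  induction n with
  | zero =>
    rw [pow_zero, pow_zero]
    exact tmul_mem_tensorSub trivial (by simp)
  | succ n ih => rw [pow_succ, pow_succ]; exact mul_mem_tensorSub_top ih hx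

theorem tensorSub_bot {W C : Type*} [AddCommGroup W] [Module ℂ W] [AddCommGroup C] [Module ℂ C]
    (W' : Submodule ℂ W) : tensorSub W' (⊥ : Submodule ℂ C) = ⊥ := by
  rw [eq_bot_iff, tensorSub_le]
  rintro w - c rfl
  simp

theorem pow_eq_zero_of_mem_tensorSub {I : Ideal C} {N : ℕ} (hI : I ^ N = ⊥) {x : R ⊗[ℂ] C}
    (hx : x ∈ tensorSub ⊤ (I.restrictScalars ℂ)) : x ^ N = 0 := by
  have h := pow_mem_tensorSub_top hx N
  rw [hI] at h
  have : ((⊥ : Ideal C).restrictScalars ℂ : Submodule ℂ C) = ⊥ := rfl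
  rwa [this, tensorSub_bot, Submodule.mem_bot] at h

end Coefficients

/-! ### Extension of scalars of a differential graded Lie algebra -/

namespace DGLA

variable {V : Type*} [AddCommGroup V] [Module ℂ V] {𝒱 : ℤ → Submodule ℂ V} (L : DGLA 𝒱)
  (C : Type*) [CommRing C] [Algebra ℂ C]

/-- The differential of `V ⊗ C`. -/
def dC : V ⊗[ℂ] C →ₗ[ℂ] V ⊗[ℂ] C := TensorProduct.map L.d LinearMap.id

/-- The bracket of `V ⊗ C`. -/
def brC : V ⊗[ℂ] C →ₗ[ℂ] V ⊗[ℂ] C →ₗ[ℂ] V ⊗[ℂ] C :=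
  TensorProduct.map₂ L.bracket (LinearMap.mul ℂ C)

/-- The curvature `d x + [x, x] / 2` in `V ⊗ C`. -/
def curvC (x : V ⊗[ℂ] C) : V ⊗[ℂ] C := L.dC C x + (1 / 2 : ℂ) • L.brC C x x

variable {C}

@[simp] theorem dC_tmul (v : V) (c : C) : L.dC C (v ⊗ₜ c) = L.d v ⊗ₜ c := by simp [dC]

@[simp] theorem brC_tmul (v w : V) (c e : C) :
    L.brC C (v ⊗ₜ c) (w ⊗ₜ e) = L.bracket v w ⊗ₜ (c * e) := by simp [brC]

theorem dC_mem {i : ℤ} {N : Submodule ℂ C} {x : V ⊗[ℂ] C} (hx : x ∈ tensorSub (𝒱 i) N) :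
    L.dC C x ∈ tensorSub (𝒱 (i + 1)) N :=
  map_mem_tensorSub (fun _ h => L.d_mem h) (fun _ h => h) hx

theorem brC_mem {i j : ℤ} {N N' N'' : Submodule ℂ C} (hN : ∀ a ∈ N, ∀ b ∈ N', a * b ∈ N'')
    {x y : V ⊗[ℂ] C} (hx : x ∈ tensorSub (𝒱 i) N) (hy : y ∈ tensorSub (𝒱 j) N') :
    L.brC C x y ∈ tensorSub (𝒱 (i + j)) N'' :=
  map₂_mem_tensorSub (fun _ h _ h' => L.bracket_mem h h') hN hx hy

theorem dC_dC (x : V ⊗[ℂ] C) : L.dC C (L.dC C x) = 0 := by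
  induction x with
  | zero => simp
  | add x y hx hy => simp [hx, hy]
  | tmul v c => simp [L.d_d]

variable {x y a : V ⊗[ℂ] C}

theorem brC_symm (hx : x ∈ tensorSub (𝒱 1) ⊤) (hy : y ∈ tensorSub (𝒱 1) ⊤) :
    L.brC C x y = L.brC C y x := by
  induction hx using tensorSub_induction with
  | zero => simp
  | add x x' _ _ hx hx' => simp [hx, hx']
  | tmul v hv c hc =>
    induction hy using tensorSub_induction with
    | zero => simp
    | add x x' _ _ hx hx' => simp [hx, hx']
    | tmul w hw e he =>
      have h := L.bracket_skew hv hw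
      norm_num at h
      simp [h, mul_comm c e]

theorem dC_brC (ha : a ∈ tensorSub (𝒱 0) ⊤) (y : V ⊗[ℂ] C) :
    L.dC C (L.brC C a y) = L.brC C (L.dC C a) y + L.brC C a (L.dC C y) := by
  induction ha using tensorSub_induction with
  | zero => simp
  | add x x' _ _ hx hx' => simp [hx, hx']; abel
  | tmul v hv c hc =>
    induction y with
    | zero => simp
    | add x x' hx hx' => simp [hx, hx']; abel
    | tmul w e => simp [L.leibniz w hv, TensorProduct.add_tmul]

theorem brC_brC (ha : a ∈ tensorSub (𝒱 0) ⊤) (hx : x ∈ tensorSub (𝒱 1) ⊤) (y : V ⊗[ℂ] C) :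
    L.brC C a (L.brC C x y) = L.brC C (L.brC C a x) y + L.brC C x (L.brC C a y) := by
  induction ha using tensorSub_induction with
  | zero => simp
  | add x x' _ _ hx hx' => simp [hx, hx']; abel
  | tmul v hv c hc =>
    induction hx using tensorSub_induction with
    | zero => simp
    | add x x' _ _ hx hx' => simp [hx, hx']; abel
    | tmul u hu b hb =>
      induction y with
      | zero => simp
      | add x x' hx hx' => simp only [map_add, hx, hx']; abel
      | tmul w e =>
        simp [L.jacobi w hv hu, TensorProduct.add_tmul, mul_assoc, mul_left_comm b c e]

variable (𝒱 C) in
/-- The inclusion `V ⊗ C → S(V[1]) ⊗ C`. -/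
def iotaC : V ⊗[ℂ] C →ₗ[ℂ] GSym (gradedShift 𝒱 1) ⊗[ℂ] C :=
  TensorProduct.map (GSym.ι (gradedShift 𝒱 1)) LinearMap.id

@[simp] theorem iotaC_tmul (v : V) (c : C) :
    iotaC 𝒱 C (v ⊗ₜ c) = GSym.ι (gradedShift 𝒱 1) v ⊗ₜ c := by simp [iotaC]

theorem mem_shift_iff {i : ℤ} {v : V} : v ∈ gradedShift 𝒱 1 (i - 1) ↔ v ∈ 𝒱 i := by
  rw [gradedShift, add_sub_cancel]

variable [DirectSum.Decomposition 𝒱]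

variable (C) in
/-- The codifferential of `S(V[1]) ⊗ C`. -/
def codiffC : GSym (gradedShift 𝒱 1) ⊗[ℂ] C →ₗ[ℂ] GSym (gradedShift 𝒱 1) ⊗[ℂ] C :=
  TensorProduct.map L.codiffFull LinearMap.id

variable (C) in
/-- The `C`-bilinear extension of `(a, x) ↦ Q_a x`. -/
def contractC : V ⊗[ℂ] C →ₗ[ℂ] GSym (gradedShift 𝒱 1) ⊗[ℂ] C →ₗ[ℂ]
    GSym (gradedShift 𝒱 1) ⊗[ℂ] C :=
  TensorProduct.map₂ L.contract.flip (LinearMap.mul ℂ C)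

@[simp] theorem codiffC_tmul (v : GSym (gradedShift 𝒱 1)) (c : C) :
    L.codiffC C (v ⊗ₜ c) = L.codiffFull v ⊗ₜ c := by simp [codiffC]

@[simp] theorem contractC_tmul (v : V) (w : GSym (gradedShift 𝒱 1)) (c e : C) :
    L.contractC C (v ⊗ₜ c) (w ⊗ₜ e) = L.contract w v ⊗ₜ (c * e) := by simp [contractC]

/-- V^1 is the degree zero part of V[1], so its Koszul signs are trivial and it commutes with all of
V[1]. This makes the ordinary exponential calculus available. -/
theorem commute_iotaC (hx : x ∈ tensorSub (𝒱 1) ⊤) (y : V ⊗[ℂ] C) :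
    Commute (iotaC 𝒱 C x) (iotaC 𝒱 C y) := by
  induction hx using tensorSub_induction with
  | zero => simp
  | add x x' _ _ hx hx' => rw [map_add]; exact hx.add_left hx'
  | tmul v hv c hc =>
    induction y with
    | zero => simp
    | add x x' hx hx' => rw [map_add]; exact hx.add_right hx'
    | tmul w e =>
      have h : GSym.ι (gradedShift 𝒱 1) v * GSym.ι _ w = GSym.ι _ w * GSym.ι _ v := by
        induction w using DirectSum.Decomposition.inductionOn (gradedShift 𝒱 1) with
        | zero => simp
        | homogeneous w => simpa using GSym.ι_mul_ι (gradedShift 𝒱 1) (mem_shift_iff.2 hv) w.2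
        | add a b ha hb => rw [map_add, mul_add, add_mul, ha, hb]
      simp [commute_iff_eq, h, mul_comm c e]

theorem codiffC_one : L.codiffC C 1 = 0 := by
  rw [Algebra.TensorProduct.one_def, codiffC_tmul, codiffFull_one, TensorProduct.zero_tmul]

theorem contractC_one (y : V ⊗[ℂ] C) : L.contractC C y 1 = 0 := by
  rw [Algebra.TensorProduct.one_def]
  induction y with
  | zero => simp
  | add x x' hx hx' => simp [hx, hx']
  | tmul v c => rw [contractC_tmul, contract_one]; simp

/-- The term `contractC` measures the failure of δ to be a derivation. It is itself a derivation in
`z`, so δ is a second order operator. -/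
theorem codiffC_mul_even (hx : x ∈ tensorSub (𝒱 1) ⊤) (z : GSym (gradedShift 𝒱 1) ⊗[ℂ] C) :
    L.codiffC C (iotaC 𝒱 C x * z) =
      iotaC 𝒱 C (L.dC C x) * z + iotaC 𝒱 C x * L.codiffC C z + L.contractC C x z := by
  induction hx using tensorSub_induction with
  | zero => simp
  | add x x' _ _ hx hx' => simp only [map_add, add_mul, LinearMap.add_apply, hx, hx']; abel
  | tmul v hv c hc =>
    induction z with
    | zero => simp
    | add x x' hx hx' => simp only [map_add, mul_add, hx, hx']; abel
    | tmul w e =>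
      have := parityMap_of_mem (gradedShift 𝒱 1) (mem_shift_iff.2 hv)
      simp [L.codiffFull_ι_mul, this, TensorProduct.add_tmul]

theorem codiffC_mul_odd (ha : a ∈ tensorSub (𝒱 0) ⊤) (z : GSym (gradedShift 𝒱 1) ⊗[ℂ] C) :
    L.codiffC C (iotaC 𝒱 C a * z) =
      iotaC 𝒱 C (L.dC C a) * z - iotaC 𝒱 C a * L.codiffC C z + L.contractC C a z := by
  induction ha using tensorSub_induction with
  | zero => simp
  | add x x' _ _ hx hx' => simp only [map_add, add_mul, LinearMap.add_apply, hx, hx']; abel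
  | tmul v hv c hc =>
    induction z with
    | zero => simp
    | add x x' hx hx' => simp only [map_add, mul_add, hx, hx']; abel
    | tmul w e =>
      have := parityMap_of_mem (gradedShift 𝒱 1) (mem_shift_iff.2 hv)
      norm_num at this
      simp [L.codiffFull_ι_mul, this, TensorProduct.add_tmul, TensorProduct.neg_tmul, sub_eq_add_neg]

theorem contractC_mul_even (hx : x ∈ tensorSub (𝒱 1) ⊤) (hy : y ∈ tensorSub (𝒱 1) ⊤)
    (z : GSym (gradedShift 𝒱 1) ⊗[ℂ] C) :
    L.contractC C x (iotaC 𝒱 C y * z) =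
      iotaC 𝒱 C (L.brC C x y) * z + iotaC 𝒱 C y * L.contractC C x z := by
  induction hx using tensorSub_induction with
  | zero => simp
  | add x x' _ _ hx hx' =>
    simp only [map_add, mul_add, add_mul, LinearMap.add_apply, hx, hx']; abel
  | tmul v hv c hc =>
    induction hy using tensorSub_induction with
    | zero => simp
    | add x x' _ _ hx hx' =>
      simp only [map_add, add_mul, hx, hx']; abel
    | tmul u hu b hb =>
      induction z with
      | zero => simp
      | add x x' hx hx' => simp only [map_add, mul_add, hx, hx']; abel
      | tmul w e =>
        have := parityMap_of_mem (gradedShift 𝒱 1) (mem_shift_iff.2 hv)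
        simp [L.contract_ι_mul (mem_shift_iff.2 hv) (mem_shift_iff.2 hu), Q, this,
          TensorProduct.add_tmul, mul_assoc, mul_left_comm b c e]

/-- The minus sign is that of Q(a ⊙ y) = (-1)^(deg a) [a, y], as V^0 has degree -1 in V[1]. -/
theorem contractC_mul_odd (ha : a ∈ tensorSub (𝒱 0) ⊤) (hy : y ∈ tensorSub (𝒱 1) ⊤)
    (z : GSym (gradedShift 𝒱 1) ⊗[ℂ] C) :
    L.contractC C a (iotaC 𝒱 C y * z) =
      iotaC 𝒱 C (-L.brC C a y) * z + iotaC 𝒱 C y * L.contractC C a z := by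
  induction ha using tensorSub_induction with
  | zero => simp
  | add x x' _ _ hx hx' =>
    simp only [map_add, mul_add, add_mul, neg_add, LinearMap.add_apply, hx, hx']; abel
  | tmul v hv c hc =>
    induction hy using tensorSub_induction with
    | zero => simp
    | add x x' _ _ hx hx' =>
      simp only [map_add, add_mul, neg_add, hx, hx']; abel
    | tmul u hu b hb =>
      induction z with
      | zero => simp
      | add x x' hx hx' => simp only [map_add, mul_add, hx, hx']; abel
      | tmul w e =>
        have := parityMap_of_mem (gradedShift 𝒱 1) (mem_shift_iff.2 hv)
        norm_num at this
        simp [L.contract_ι_mul (mem_shift_iff.2 hv) (mem_shift_iff.2 hu), Q, this,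
          TensorProduct.add_tmul, TensorProduct.neg_tmul, mul_assoc, mul_left_comm b c e]

/-- The instance of `secondOrder_nilExp` in which the first order part of δ is dx and the second
order part is [x, x]. Thus e^x is δ-closed as soon as x is Maurer-Cartan. -/
theorem codiffC_nilExp (hx : x ∈ tensorSub (𝒱 1) ⊤) (hn : IsNilpotent (iotaC 𝒱 C x)) :
    L.codiffC C (nilExp (iotaC 𝒱 C x)) =
      iotaC 𝒱 C (L.curvC C x) * nilExp (iotaC 𝒱 C x) := by
  rw [secondOrder_nilExp (L.codiffC C) (L.contractC C x) L.codiffC_one (L.contractC_one x)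
    (L.codiffC_mul_even hx) (L.contractC_mul_even hx hx) (commute_iotaC hx _) (commute_iotaC hx _)
    hn, curvC, map_add, map_smul]

/-- Since δ(e^x) = 0, only da · e^x and Q_a(e^x) = -[a, x] e^x remain. Consequently the variation of
e^x under an infinitesimal gauge transformation is δ-exact. -/
theorem codiffC_mul_nilExp (ha : a ∈ tensorSub (𝒱 0) ⊤) (hx : x ∈ tensorSub (𝒱 1) ⊤)
    (hn : IsNilpotent (iotaC 𝒱 C x)) (hc : L.curvC C x = 0) :
    L.codiffC C (iotaC 𝒱 C a * nilExp (iotaC 𝒱 C x)) =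
      -(iotaC 𝒱 C (L.brC C a x - L.dC C a) * nilExp (iotaC 𝒱 C x)) := by
  rw [L.codiffC_mul_odd ha, L.codiffC_nilExp hx hn, hc, derivation_nilExp (L.contractC C a)
    (L.contractC_one a) (L.contractC_mul_odd ha hx) (commute_iotaC hx _) hn, map_zero, zero_mul,
    mul_zero, map_sub, map_neg, sub_mul, neg_mul]
  abel

end DGLA

/-! ### The corestriction of an L_∞-morphism to a graded vector space. -/

namespace RSym

variable {W : Type*} [AddCommGroup W] [Module ℂ W] (𝒲 : ℤ → Submodule ℂ W)

theorem coe_proj (z : GSym 𝒲) : (proj 𝒲 z : GSym 𝒲) = z - algebraMap ℂ _ (GSym.counit 𝒲 z) := rfl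

theorem proj_coe (x : RSym 𝒲) : proj 𝒲 (x : GSym 𝒲) = x := by
  refine Subtype.ext ?_
  have : GSym.counit _ (x : GSym 𝒲) = 0 := x.2
  rw [coe_proj, this, map_zero, sub_zero]

end RSym

namespace LInftyHom

variable {V : Type*} [AddCommGroup V] [Module ℂ V] {𝒱 : ℤ → Submodule ℂ V}
  [DirectSum.Decomposition 𝒱] {M : Type*} [AddCommGroup M] [Module ℂ M]
  {ℳ : ℤ → Submodule ℂ M} [DirectSum.Decomposition ℳ] {L : DGLA 𝒱}

/-- The corestriction `S(V[1]) → M` of an `L_∞`-morphism, extended by zero to `⊙^0`. -/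
def corestriction (μ : LInftyHom L (DGLA.trivial ℳ)) : GSym (gradedShift 𝒱 1) →ₗ[ℂ] M :=
  RSym.proj₁ (gradedShift ℳ 1) ∘ₗ μ.toLinearMap ∘ₗ RSym.proj (gradedShift 𝒱 1)

theorem corestriction_one (μ : LInftyHom L (DGLA.trivial ℳ)) : μ.corestriction 1 = 0 := by
  have : RSym.proj (gradedShift 𝒱 1) 1 = 0 := by
    refine Subtype.ext ?_
    simp [RSym.proj, GSym.counit, GSym.trunc_one]
  simp [corestriction, this]

theorem corestriction_ι (μ : LInftyHom L (DGLA.trivial ℳ)) (v : V) :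
    μ.corestriction (GSym.ι _ v) = μ.linearPart v := by
  rw [corestriction, LinearMap.comp_apply, LinearMap.comp_apply]
  exact congrArg (fun z => RSym.proj₁ (gradedShift ℳ 1) (μ.toLinearMap z))
    (RSym.proj_coe _ (RSym.ι (gradedShift 𝒱 1) v))

/-- μ intertwines δ with the codifferential of C(M), which is zero. As δ(1) = 0, the constant term
discarded by the projection to the reduced coalgebra does no harm. -/
theorem corestriction_codiffFull (μ : LInftyHom L (DGLA.trivial ℳ))
    (z : GSym (gradedShift 𝒱 1)) : μ.corestriction (L.codiffFull z) = 0 := by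
  have h : RSym.proj (gradedShift 𝒱 1) (L.codiffFull z) =
      L.codiff (RSym.proj (gradedShift 𝒱 1) z) := by
    rw [show L.codiffFull z = ((⟨_, L.codiffFull_mem z⟩ : RSym (gradedShift 𝒱 1)) : GSym _) from rfl,
      RSym.proj_coe]
    refine Subtype.ext ?_
    rw [show ((L.codiff (RSym.proj (gradedShift 𝒱 1) z) : RSym _) : GSym (gradedShift 𝒱 1)) =
      L.codiffFull (RSym.proj (gradedShift 𝒱 1) z) from rfl, RSym.coe_proj, map_sub,
      Algebra.algebraMap_eq_smul_one, map_smul, L.codiffFull_one, smul_zero, sub_zero]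
  rw [corestriction, LinearMap.comp_apply, LinearMap.comp_apply, h, μ.map_codiff,
    DGLA.codiff_trivial]
  simp

end LInftyHom

/-! ### Obstructions are killed by the linear component. -/

namespace DGLA

variable {V : Type*} [AddCommGroup V] [Module ℂ V] {𝒱 : ℤ → Submodule ℂ V} (L : DGLA 𝒱)

theorem map_codiffC [DirectSum.Decomposition 𝒱] {U : Type*} [AddCommGroup U] [Module ℂ U]
    {ψ : GSym (gradedShift 𝒱 1) →ₗ[ℂ] U}
    (hψ : ∀ z, ψ (L.codiffFull z) = 0) {C D : Type*} [CommRing C] [Algebra ℂ C] [AddCommGroup D]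
    [Module ℂ D] (f : C →ₗ[ℂ] D) (z : GSym (gradedShift 𝒱 1) ⊗[ℂ] C) :
    TensorProduct.map ψ f (L.codiffC C z) = 0 := by
  induction z with
  | zero => simp
  | add x y hx hy => simp only [map_add, hx, hy, add_zero]
  | tmul v c => simp [hψ]

theorem iotaC_mem {C : Type*} [CommRing C] [Algebra ℂ C] {W' : Submodule ℂ V} {N : Submodule ℂ C}
    {x : V ⊗[ℂ] C} (hx : x ∈ tensorSub W' N) : iotaC 𝒱 C x ∈ tensorSub ⊤ N :=
  map_mem_tensorSub (fun _ _ => Submodule.mem_top) (fun _ h => h) hx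

theorem isNilpotent_iotaC {A : ArtAlg} {W' : Submodule ℂ V} {x : V ⊗[ℂ] A.carrier}
    (hx : x ∈ tensorSub W' A.maxIdeal) : IsNilpotent (iotaC 𝒱 A.carrier x) := by
  obtain ⟨N, hN⟩ := A.maximalIdeal_nilpotent
  exact ⟨N, pow_eq_zero_of_mem_tensorSub hN (iotaC_mem hx)⟩

end DGLA

theorem mul_eq_zero_of_mem_tensorSub {R C : Type*} [Ring R] [Algebra ℂ R] [CommRing C]
    [Algebra ℂ C] {N N' : Submodule ℂ C} (h : ∀ a ∈ N, ∀ b ∈ N', a * b = 0) {x y : R ⊗[ℂ] C}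
    (hx : x ∈ tensorSub ⊤ N) (hy : y ∈ tensorSub ⊤ N') : x * y = 0 := by
  have := map₂_mem_tensorSub (W₂' := ⊤) (N₂ := (⊥ : Submodule ℂ C)) (f := LinearMap.mul ℂ R)
    (g := LinearMap.mul ℂ C) (fun _ _ _ _ => trivial) (fun a ha b hb => by simp [h a ha b hb]) hx hy
  rw [tensorSub_bot, Submodule.mem_bot] at this
  rw [← this]
  clear this hx hy
  induction x with
  | zero => simp
  | add x x' hx hx' => simp [add_mul, hx, hx']
  | tmul r c =>
    induction y with
    | zero => simp
    | add x x' hx hx' => simp [mul_add, hx, hx']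
    | tmul s e => simp

/-- The obstruction space is annihilated by `H^2(μ₁¹)`. -/
theorem LInftyHom.obstructionSpace_le_ker {V : Type*} [AddCommGroup V] [Module ℂ V]
    {𝒱 : ℤ → Submodule ℂ V} [DirectSum.Decomposition 𝒱] {M : Type*} [AddCommGroup M] [Module ℂ M]
    {ℳ : ℤ → Submodule ℂ M} [DirectSum.Decomposition ℳ] {L : DGLA 𝒱}
    (μ : LInftyHom L (DGLA.trivial ℳ)) :
    L.obstructionSpace ≤ LinearMap.ker (μ.cohomologyMap 2) := by
  refine Submodule.span_le.2 ?_
  rintro _ ⟨A, B, e, β, ω, f, ⟨b, -, a, ha, -, z, hz, rfl⟩, rfl⟩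
  have ha' : a ∈ tensorSub (𝒱 1) A.maxIdeal := ha
  have hn := DGLA.isNilpotent_iotaC (𝒱 := 𝒱) ha'
  -- The curvature has coefficients in J and m_A J = 0, so in its product with e^a only the constant
  -- term 1 of the exponential contributes.
  have h1 : L.codiffC A.carrier (nilExp (DGLA.iotaC 𝒱 A.carrier a)) =
      DGLA.iotaC 𝒱 A.carrier (L.curvC A.carrier a) := by
    rw [L.codiffC_nilExp (tensorSub_mono le_rfl le_top ha') hn]
    refine mul_nilExp_of_mul_eq_zero hn ?_
    refine mul_eq_zero_of_mem_tensorSub (N := e.J) (N' := A.maxIdeal) ?_ ?_ (DGLA.iotaC_mem ha')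
    · intro x hx y hy
      rw [mul_comm]
      exact e.mul_eq_zero y hy x hx
    · rw [show L.curvC A.carrier a = L.curvature A a from rfl, ← hz]
      exact DGLA.iotaC_mem (W' := L.cocycles 2) ⟨z, rfl⟩
  have h2 : TensorProduct.map μ.linearPart LinearMap.id (L.curvC A.carrier a) = 0 := by
    have := L.map_codiffC μ.corestriction_codiffFull LinearMap.id
      (nilExp (DGLA.iotaC 𝒱 A.carrier a))
    rw [h1, DGLA.iotaC, ← LinearMap.comp_apply, ← TensorProduct.map_comp] at this
    rwa [show μ.corestriction ∘ₗ GSym.ι _ = μ.linearPart from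
      LinearMap.ext μ.corestriction_ι] at this
  have h3 : TensorProduct.map (μ.cohomologyMap 2) LinearMap.id
      (TensorProduct.map (Submodule.mkQ _) LinearMap.id z) = (0 : ℳ 2 ⊗[ℂ] e.J) := by
    -- M^2 ⊗ J embeds in M ⊗ A, where the vanishing is `h2`.
    apply TensorProduct.map_injective_of_flat_flat (ℳ 2).subtype e.J.subtype
      (Submodule.subtype_injective _) (Submodule.subtype_injective _)
    rw [map_zero, ← h2, show L.curvC A.carrier a = L.curvature A a from rfl, ← hz]
    simp only [← LinearMap.comp_apply, ← TensorProduct.map_comp]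
    congr 1
  have h4 : ∀ w : L.Cohomology 2 ⊗[ℂ] e.J, μ.cohomologyMap 2 (TensorProduct.rid ℂ _
      (TensorProduct.map LinearMap.id f w)) = TensorProduct.rid ℂ _ (TensorProduct.map LinearMap.id f
        (TensorProduct.map (μ.cohomologyMap 2) LinearMap.id w)) := by
    intro w
    induction w with
    | zero => simp
    | add x y hx hy => simp only [map_add, hx, hy]
    | tmul v c => simp
  rw [SetLike.mem_coe, LinearMap.mem_ker, h4, h3]
  simp

/-! ### Calculus with polynomial paths -/

section PolynomialCalculus

open Polynomial

variable (C : Type*) [CommRing C] [Algebra ℂ C]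

/-- The map `c ↦ c X^k`, over `ℂ`. -/
def polyMono (k : ℕ) : C →ₗ[ℂ] C[X] := (Polynomial.monomial k).restrictScalars ℂ

/-- The derivative, over `ℂ`. -/
def polyDer : C[X] →ₗ[ℂ] C[X] := Polynomial.derivative.restrictScalars ℂ

/-- The primitive of a polynomial without constant term. -/
def polyInt : C[X] →ₗ[ℂ] C[X] := Polynomial.lsum fun k => ((k : ℂ) + 1)⁻¹ • polyMono C (k + 1)

/-- The evaluation at a point of `C`, over `ℂ`. -/
def polyEval (t : C) : C[X] →ₐ[ℂ] C := (Polynomial.aeval t).restrictScalars ℂ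

variable {C}

@[simp] theorem polyMono_apply (k : ℕ) (c : C) : polyMono C k c = monomial k c := rfl

@[simp] theorem polyDer_apply (p : C[X]) : polyDer C p = derivative p := rfl

@[simp] theorem polyEval_apply (t : C) (p : C[X]) : polyEval C t p = p.eval t := by
  rw [← Polynomial.coe_aeval_eq_eval]
  rfl

@[simp] theorem polyInt_monomial (k : ℕ) (c : C) :
    polyInt C (monomial k c) = monomial (k + 1) (((k : ℂ) + 1)⁻¹ • c) := by
  rw [polyInt, Polynomial.lsum_apply, Polynomial.sum_monomial_index _ _ (by simp)]
  simp only [LinearMap.smul_apply, polyMono_apply, Polynomial.smul_monomial]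

theorem polyInt_mul (c : C) (p : C[X]) :
    polyInt C (Polynomial.C c * p) = Polynomial.C c * polyInt C p := by
  induction p using Polynomial.induction_on' with
  | add p q hp hq => simp only [mul_add, map_add, hp, hq]
  | monomial n a => simp [Polynomial.C_mul_monomial]

/-- The fundamental theorem of calculus, with `polyInt` the primitive vanishing at 0. -/
theorem polyInt_polyDer (p : C[X]) :
    polyInt C (polyDer C p) + polyMono C 0 (polyEval C 0 p) = p := by
  induction p using Polynomial.induction_on' with
  | add p q hp hq =>
    conv_rhs => rw [← hp, ← hq]
    simp only [map_add]; abel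
  | monomial n a =>
    rcases n with _ | n
    · simp
    · have h : (n : ℂ) + 1 ≠ 0 := by exact_mod_cast Nat.succ_ne_zero n
      have e : a * ((n : C) + 1) = ((n : ℂ) + 1) • a := by
        rw [Algebra.smul_def, mul_comm]; simp
      simp [e, smul_smul, mul_inv_cancel₀ h]

end PolynomialCalculus

namespace DGLA

open Polynomial

variable {V : Type*} [AddCommGroup V] [Module ℂ V] {𝒱 : ℤ → Submodule ℂ V} (L : DGLA 𝒱)
  {C : Type*} [CommRing C] [Algebra ℂ C]

theorem lTensor_mem_tensorSub {D : Type*} [AddCommGroup D] [Module ℂ D] {W' : Submodule ℂ V}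
    {N : Submodule ℂ C} {N' : Submodule ℂ D} {f : C →ₗ[ℂ] D} (hf : ∀ c ∈ N, f c ∈ N')
    {x : V ⊗[ℂ] C} (hx : x ∈ tensorSub W' N) : LinearMap.lTensor V f x ∈ tensorSub W' N' :=
  map_mem_tensorSub (f := LinearMap.id) (fun _ h => h) hf hx

theorem lTensor_dC {D : Type*} [CommRing D] [Algebra ℂ D] (f : C →ₗ[ℂ] D) (x : V ⊗[ℂ] C) :
    LinearMap.lTensor V f (L.dC C x) = L.dC D (LinearMap.lTensor V f x) := by
  induction x with
  | zero => simp
  | add x y hx hy => simp only [map_add, hx, hy]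
  | tmul v c => simp

theorem lTensor_brC {D : Type*} [CommRing D] [Algebra ℂ D] (f : C →ₐ[ℂ] D) (x y : V ⊗[ℂ] C) :
    LinearMap.lTensor V f.toLinearMap (L.brC C x y) =
      L.brC D (LinearMap.lTensor V f.toLinearMap x) (LinearMap.lTensor V f.toLinearMap y) := by
  induction x with
  | zero => simp
  | add x y hx hy => simp only [map_add, LinearMap.add_apply, hx, hy]
  | tmul v c =>
    induction y with
    | zero => simp
    | add x y hx hy => simp only [map_add, hx, hy]
    | tmul w e => simp

theorem lTensor_curvC {D : Type*} [CommRing D] [Algebra ℂ D] (f : C →ₐ[ℂ] D) (x : V ⊗[ℂ] C) :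
    LinearMap.lTensor V f.toLinearMap (L.curvC C x) =
      L.curvC D (LinearMap.lTensor V f.toLinearMap x) := by
  rw [curvC, curvC, map_add, map_smul, lTensor_dC, lTensor_brC]

theorem lTensor_polyDer_brC (x y : V ⊗[ℂ] C[X]) :
    LinearMap.lTensor V (polyDer C) (L.brC _ x y) =
      L.brC _ (LinearMap.lTensor V (polyDer C) x) y +
        L.brC _ x (LinearMap.lTensor V (polyDer C) y) := by
  induction x with
  | zero => simp
  | add x y hx hy => simp only [map_add, LinearMap.add_apply, hx, hy]; abel
  | tmul v c =>
    induction y with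
    | zero => simp
    | add x y hx hy => simp only [map_add, hx, hy]; abel
    | tmul w e => simp [TensorProduct.tmul_add]

theorem brC_polyMono (k : ℕ) (a x : V ⊗[ℂ] C) :
    L.brC _ (LinearMap.lTensor V (polyMono C 0) a) (LinearMap.lTensor V (polyMono C k) x) =
      LinearMap.lTensor V (polyMono C k) (L.brC _ a x) := by
  induction a with
  | zero => simp
  | add x y hx hy => simp only [map_add, LinearMap.add_apply, hx, hy]
  | tmul v c =>
    induction x with
    | zero => simp
    | add x y hx hy => simp only [map_add, hx, hy]
    | tmul w e => simp [Polynomial.C_mul_monomial]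

theorem brC_polyInt (a : V ⊗[ℂ] C) (x : V ⊗[ℂ] C[X]) :
    L.brC _ (LinearMap.lTensor V (polyMono C 0) a) (LinearMap.lTensor V (polyInt C) x) =
      LinearMap.lTensor V (polyInt C) (L.brC _ (LinearMap.lTensor V (polyMono C 0) a) x) := by
  induction a with
  | zero => simp
  | add x y hx hy => simp only [map_add, LinearMap.add_apply, hx, hy]
  | tmul v c =>
    induction x with
    | zero => simp
    | add x y hx hy => simp only [map_add, hx, hy]
    | tmul w e => simp [polyInt_mul]

theorem pow_brC_mem {i : ℤ} {I J : Ideal C} {a x : V ⊗[ℂ] C}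
    (ha : a ∈ tensorSub (𝒱 0) (I.restrictScalars ℂ))
    (hx : x ∈ tensorSub (𝒱 i) (J.restrictScalars ℂ)) (n : ℕ) :
    ((L.brC C a) ^ n) x ∈ tensorSub (𝒱 i) ((I ^ n * J).restrictScalars ℂ) := by
  induction n with
  | zero => simpa using hx
  | succ n ih =>
    rw [pow_succ' I, mul_assoc, pow_succ' (L.brC C a), Module.End.mul_apply]
    have := L.brC_mem (N'' := (I * (I ^ n * J)).restrictScalars ℂ)
      (fun a ha b hb => Ideal.mul_mem_mul ha hb) ha ih
    rwa [zero_add] at this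

theorem pow_brC_eq_zero {I : Ideal C} {N : ℕ} (hN : I ^ N = ⊥) {a : V ⊗[ℂ] C}
    (ha : a ∈ tensorSub (𝒱 0) (I.restrictScalars ℂ)) (x : V ⊗[ℂ] C) :
    ((L.brC C a) ^ N) x = 0 := by
  have h : ∀ n, ((L.brC C a) ^ n) x ∈ tensorSub ⊤ ((I ^ n).restrictScalars ℂ) := by
    intro n
    induction n with
    | zero =>
      rw [pow_zero, pow_zero, Module.End.one_apply, Ideal.one_eq_top]
      exact tensorSub_top.ge Submodule.mem_top
    | succ n ih =>
      rw [pow_succ' I, pow_succ' (L.brC C a), Module.End.mul_apply]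
      have hm : ∀ a ∈ I.restrictScalars ℂ, ∀ b ∈ (I ^ n).restrictScalars ℂ,
          LinearMap.mul ℂ C a b ∈ (I * I ^ n).restrictScalars ℂ :=
        fun a ha b hb => Ideal.mul_mem_mul ha hb
      exact map₂_mem_tensorSub (f := L.bracket) (fun _ _ _ _ => Submodule.mem_top) hm ha ih
  have h := h N
  rw [hN, show ((⊥ : Ideal C).restrictScalars ℂ : Submodule ℂ C) = ⊥ from rfl, tensorSub_bot] at h
  exact h

/-- A solution of `F' = [a, F]` with `F(0) = 0` vanishes, for `a` nilpotent. -/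
theorem eq_zero_of_polyDer_eq {a : V ⊗[ℂ] C} {N : ℕ}
    (ha : ∀ y, ((L.brC C[X] (LinearMap.lTensor V (polyMono C 0) a)) ^ N) y = 0) {F : V ⊗[ℂ] C[X]}
    (hF : LinearMap.lTensor V (polyDer C) F = L.brC _ (LinearMap.lTensor V (polyMono C 0) a) F)
    (h0 : LinearMap.lTensor V (polyEval C 0).toLinearMap F = 0) : F = 0 := by
  have ftc : ∀ G : V ⊗[ℂ] C[X], LinearMap.lTensor V (polyInt C) (LinearMap.lTensor V (polyDer C) G) +
      LinearMap.lTensor V (polyMono C 0) (LinearMap.lTensor V (polyEval C 0).toLinearMap G) = G := by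
    intro G
    induction G with
    | zero => simp
    | add x y hx hy =>
      conv_rhs => rw [← hx, ← hy]
      simp only [map_add]; abel
    | tmul v p =>
      conv_rhs => rw [← polyInt_polyDer p]
      simp [TensorProduct.tmul_add]
  have h1 : F = LinearMap.lTensor V (polyInt C)
      (L.brC _ (LinearMap.lTensor V (polyMono C 0) a) F) := by
    have := ftc F
    rw [h0, map_zero, add_zero, hF] at this
    exact this.symm
  -- Picard iteration: integration commutes with ad a because a does not depend on t. Hence F equals
  -- the n-fold integral of (ad a)^n F, which vanishes for n = N.
  have h2 : ∀ n : ℕ, F = ((LinearMap.lTensor V (polyInt C)) ^ n)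
      (((L.brC _ (LinearMap.lTensor V (polyMono C 0) a)) ^ n) F) := by
    intro n
    induction n with
    | zero => rfl
    | succ n ih =>
      have hc : ∀ G, ((L.brC _ (LinearMap.lTensor V (polyMono C 0) a)) ^ n)
          (LinearMap.lTensor V (polyInt C) G) = LinearMap.lTensor V (polyInt C)
          (((L.brC _ (LinearMap.lTensor V (polyMono C 0) a)) ^ n) G) := by
        intro G
        clear ih
        induction n with
        | zero => rfl
        | succ n ih =>
          rw [pow_succ', Module.End.mul_apply, ih, brC_polyInt, Module.End.mul_apply]
      conv_lhs => rw [ih, h1, hc]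
      rw [pow_succ, pow_succ]
      rfl
  rw [h2 N, ha, map_zero]

/-- The path `t ↦ e^{ta} * x`, truncated after `N` terms. -/
def gaugePath (N : ℕ) (a x : V ⊗[ℂ] C) : V ⊗[ℂ] C[X] :=
  LinearMap.lTensor V (polyMono C 0) x + ∑ n ∈ Finset.range N, (((n + 1).factorial : ℂ)⁻¹) •
    LinearMap.lTensor V (polyMono C (n + 1)) (((L.brC C a) ^ n) (L.brC C a x - L.dC C a))

theorem lTensor_polyEval_polyMono (t : C) (k : ℕ) (x : V ⊗[ℂ] C) :
    LinearMap.lTensor V (polyEval C t).toLinearMap (LinearMap.lTensor V (polyMono C k) x) =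
      LinearMap.lTensor V (LinearMap.mulRight ℂ (t ^ k)) x := by
  induction x with
  | zero => simp
  | add x y hx hy => simp only [map_add, hx, hy]
  | tmul v c => simp

theorem gaugePath_eval_zero (N : ℕ) (a x : V ⊗[ℂ] C) :
    LinearMap.lTensor V (polyEval C 0).toLinearMap (L.gaugePath N a x) = x := by
  simp [gaugePath, lTensor_polyEval_polyMono]

theorem gaugePath_eval_one (N : ℕ) (a x : V ⊗[ℂ] C) :
    LinearMap.lTensor V (polyEval C 1).toLinearMap (L.gaugePath N a x) =
      x + ∑ n ∈ Finset.range N, (((n + 1).factorial : ℂ)⁻¹) •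
        ((L.brC C a) ^ n) (L.brC C a x - L.dC C a) := by
  simp [gaugePath, lTensor_polyEval_polyMono]

theorem lTensor_polyDer_polyMono_zero (x : V ⊗[ℂ] C) :
    LinearMap.lTensor V (polyDer C) (LinearMap.lTensor V (polyMono C 0) x) = 0 := by
  induction x with
  | zero => simp
  | add x y hx hy => simp only [map_add, hx, hy, add_zero]
  | tmul v c => simp

theorem lTensor_polyDer_polyMono_succ (k : ℕ) (x : V ⊗[ℂ] C) :
    LinearMap.lTensor V (polyDer C) (LinearMap.lTensor V (polyMono C (k + 1)) x) =
      ((k : ℂ) + 1) • LinearMap.lTensor V (polyMono C k) x := by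
  induction x with
  | zero => simp
  | add x y hx hy => simp only [map_add, hx, hy, smul_add]
  | tmul v c =>
    have e : c * ((k : C) + 1) = ((k : ℂ) + 1) • c := by
      rw [Algebra.smul_def, mul_comm]; simp
    simp [e]

/-- The path is the solution of p' = [a, p] - da. All later facts about the gauge action are drawn
from this equation instead of from the series. -/
theorem lTensor_polyDer_gaugePath {N : ℕ} {a : V ⊗[ℂ] C}
    (ha : ∀ y, ((L.brC C a) ^ N) y = 0) (x : V ⊗[ℂ] C) :
    LinearMap.lTensor V (polyDer C) (L.gaugePath N a x) =
      L.brC _ (LinearMap.lTensor V (polyMono C 0) a) (L.gaugePath N a x) -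
        L.dC _ (LinearMap.lTensor V (polyMono C 0) a) := by
  have e : ∀ n : ℕ, ((n + 1).factorial : ℂ)⁻¹ * ((n : ℂ) + 1) = (n.factorial : ℂ)⁻¹ := by
    intro n
    have h : (n : ℂ) + 1 ≠ 0 := by exact_mod_cast Nat.succ_ne_zero n
    rw [Nat.factorial_succ]
    push_cast
    rw [mul_inv, mul_right_comm, inv_mul_cancel₀ h, one_mul]
  -- The summand n = N is zero by `ha`. It is added so that splitting off n = 0 leaves a sum over
  -- the same range as ad a applied to the path.
  have h1 : LinearMap.lTensor V (polyDer C) (L.gaugePath N a x) =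
      ∑ n ∈ Finset.range (N + 1), ((n.factorial : ℂ)⁻¹) •
        LinearMap.lTensor V (polyMono C n) (((L.brC C a) ^ n) (L.brC C a x - L.dC C a)) := by
    rw [Finset.sum_range_succ, ha, map_zero, smul_zero, add_zero, gaugePath, map_add,
      lTensor_polyDer_polyMono_zero, zero_add, map_sum]
    refine Finset.sum_congr rfl fun n _ => ?_
    rw [map_smul, lTensor_polyDer_polyMono_succ, smul_smul, e]
  rw [h1, Finset.sum_range_succ', gaugePath, map_add, brC_polyMono, map_sum, ← lTensor_dC,
    add_sub_right_comm, ← map_sub, add_comm]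
  congr 1
  · simp
  · refine Finset.sum_congr rfl fun n _ => ?_
    rw [map_smul, brC_polyMono, pow_succ']
    rfl

theorem gaugePath_mem {I : Ideal C} {a x : V ⊗[ℂ] C}
    (ha : a ∈ tensorSub (𝒱 0) (I.restrictScalars ℂ))
    (hx : x ∈ tensorSub (𝒱 1) (I.restrictScalars ℂ)) (N : ℕ) :
    L.gaugePath N a x ∈ tensorSub (𝒱 1) ((I.map (Polynomial.C : C →+* C[X])).restrictScalars ℂ) := by
  have hm : ∀ k, ∀ y ∈ tensorSub (𝒱 1) (I.restrictScalars ℂ),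
      LinearMap.lTensor V (polyMono C k) y ∈
        tensorSub (𝒱 1) ((I.map (Polynomial.C : C →+* C[X])).restrictScalars ℂ) := by
    intro k y hy
    refine lTensor_mem_tensorSub (fun c hc => ?_) hy
    rw [Submodule.restrictScalars_mem, polyMono_apply, ← Polynomial.C_mul_X_pow_eq_monomial]
    exact Ideal.mul_mem_right _ _ (Ideal.mem_map_of_mem _ hc)
  have hw : L.brC C a x - L.dC C a ∈ tensorSub (𝒱 1) (I.restrictScalars ℂ) := by
    have h1 := L.dC_mem ha
    have h2 := L.brC_mem (N'' := I.restrictScalars ℂ) (fun a _ b hb => Ideal.mul_mem_left I a hb)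
      ha hx
    rw [zero_add] at h1 h2
    exact sub_mem h2 h1
  have hle : ∀ n, (I ^ n * I).restrictScalars ℂ ≤ I.restrictScalars ℂ :=
    fun n z hz => (Ideal.mul_le_right : I ^ n * I ≤ I) hz
  exact add_mem (hm 0 x hx) (sum_mem fun n _ => Submodule.smul_mem _ _
    (hm _ _ (tensorSub_mono le_rfl (hle n) (L.pow_brC_mem ha hw n))))

/-- The curvature F of the path satisfies F' = dp' + [p', p] = [a, F], the terms in da cancelling by
the Leibniz rule, and F(0) = 0. By uniqueness for this linear equation F vanishes identically. -/
theorem curvC_gaugePath {I : Ideal C} {N : ℕ} (hN : I ^ N = ⊥) {a x : V ⊗[ℂ] C}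
    (ha : a ∈ tensorSub (𝒱 0) (I.restrictScalars ℂ))
    (hx : x ∈ tensorSub (𝒱 1) (I.restrictScalars ℂ)) (hc : L.curvC C x = 0) :
    L.curvC _ (L.gaugePath N a x) = 0 := by
  have ha0 : LinearMap.lTensor V (polyMono C 0) a ∈
      tensorSub (𝒱 0) ((I.map (Polynomial.C : C →+* C[X])).restrictScalars ℂ) :=
    lTensor_mem_tensorSub
      (fun c hc => Ideal.mem_map_of_mem (Polynomial.C : C →+* C[X]) (I := I) hc) ha
  have hI : (I.map (Polynomial.C : C →+* C[X])) ^ N = ⊥ := by rw [← Ideal.map_pow, hN, Ideal.map_bot]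
  refine L.eq_zero_of_polyDer_eq (a := a) (N := N) (L.pow_brC_eq_zero hI ha0) ?_ ?_
  · have hp := L.gaugePath_mem ha hx N
    have hd := L.lTensor_polyDer_gaugePath (L.pow_brC_eq_zero hN ha) x
    revert hp hd ha0
    generalize L.gaugePath N a x = p
    generalize LinearMap.lTensor V (polyMono C 0) a = b
    intro hb hp hd
    have hb' := tensorSub_mono (le_refl (𝒱 0)) le_top hb
    have hp' := tensorSub_mono (le_refl (𝒱 1)) le_top hp
    have hbp : L.brC _ b p ∈ tensorSub (𝒱 1) ⊤ := by
      have := L.brC_mem (N'' := ⊤) (fun _ _ _ _ => Submodule.mem_top) hb' hp'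
      rwa [zero_add] at this
    have hdb : L.dC _ b ∈ tensorSub (𝒱 1) ⊤ := by
      have := L.dC_mem hb'
      rwa [zero_add] at this
    rw [curvC, map_add, map_smul, lTensor_dC, lTensor_polyDer_brC, hd,
      L.brC_symm hp' (sub_mem hbp hdb), map_sub, dC_dC, L.dC_brC hb', map_add, map_smul,
      L.brC_brC hb' hp', L.brC_symm hp' hbp, map_sub, LinearMap.sub_apply]
    module
  · rw [lTensor_curvC, gaugePath_eval_zero, hc]

/-! ### The potential attached to a functional on `S(V[1])` -/

variable {U : Type*} [AddCommGroup U] [Module ℂ U]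

variable (C) in
/-- For a functional `ψ` on `S(V[1])`, the function `x ↦ ψ(e^x) = ∑ ψ(x^n) / n!`. -/
def potential (ψ : GSym (gradedShift 𝒱 1) →ₗ[ℂ] U) (x : V ⊗[ℂ] C) : U ⊗[ℂ] C :=
  TensorProduct.map ψ LinearMap.id (nilExp (iotaC 𝒱 C x))

theorem lTensor_potential (ψ : GSym (gradedShift 𝒱 1) →ₗ[ℂ] U) {D : Type*} [CommRing D]
    [Algebra ℂ D] (f : C →ₐ[ℂ] D) {x : V ⊗[ℂ] C} (hx : IsNilpotent (iotaC 𝒱 C x)) :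
    TensorProduct.map ψ f.toLinearMap (nilExp (iotaC 𝒱 C x)) =
      potential D ψ (LinearMap.lTensor V f.toLinearMap x) := by
  have h := map_nilExp (Algebra.TensorProduct.map (AlgHom.id ℂ (GSym (gradedShift 𝒱 1))) f) hx
  have h2 : Algebra.TensorProduct.map (AlgHom.id ℂ (GSym (gradedShift 𝒱 1))) f (iotaC 𝒱 C x) =
      iotaC 𝒱 D (LinearMap.lTensor V f.toLinearMap x) := by
    clear h hx
    induction x with
    | zero => simp
    | add x y hx hy => simp only [map_add, hx, hy]
    | tmul v c => simp
  rw [h2] at h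
  rw [potential, ← h]
  generalize nilExp (iotaC 𝒱 C x) = z
  induction z with
  | zero => simp
  | add x y hx hy => simp only [map_add, hx, hy]
  | tmul v c => simp

/-- Gauge invariance of the potential: the t-derivative of e^{p(t)} is δ-exact, so ψ kills it, and
the values at t = 0 and t = 1 agree. -/
theorem potential_gaugePath [DirectSum.Decomposition 𝒱] {ψ : GSym (gradedShift 𝒱 1) →ₗ[ℂ] U}
    (hψ : ∀ z, ψ (L.codiffFull z) = 0) {I : Ideal C} {N : ℕ} (hN : I ^ N = ⊥) {a x : V ⊗[ℂ] C}
    (ha : a ∈ tensorSub (𝒱 0) (I.restrictScalars ℂ))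
    (hx : x ∈ tensorSub (𝒱 1) (I.restrictScalars ℂ)) (hc : L.curvC C x = 0) :
    potential C ψ (LinearMap.lTensor V (polyEval C 1).toLinearMap (L.gaugePath N a x)) =
      potential C ψ x := by
  have ha0 : LinearMap.lTensor V (polyMono C 0) a ∈ tensorSub (𝒱 0) ⊤ :=
    lTensor_mem_tensorSub (fun c hc => Submodule.mem_top) ha
  have hI : (I.map (Polynomial.C : C →+* C[X])) ^ N = ⊥ := by rw [← Ideal.map_pow, hN, Ideal.map_bot]
  have hp := L.gaugePath_mem ha hx N
  have hp' := tensorSub_mono (le_refl (𝒱 1)) le_top hp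
  have hn : IsNilpotent (iotaC 𝒱 C[X] (L.gaugePath N a x)) :=
    ⟨N, pow_eq_zero_of_mem_tensorSub hI (iotaC_mem hp)⟩
  have hd := L.lTensor_polyDer_gaugePath (L.pow_brC_eq_zero hN ha) x
  have hι : ∀ y : V ⊗[ℂ] C[X], LinearMap.lTensor _ (polyDer C) (iotaC 𝒱 C[X] y) =
      iotaC 𝒱 C[X] (LinearMap.lTensor V (polyDer C) y) := by
    intro y
    induction y with
    | zero => simp
    | add x y hx hy => simp only [map_add, hx, hy]
    | tmul v c => simp
  have hleib : ∀ y z : GSym (gradedShift 𝒱 1) ⊗[ℂ] C[X], LinearMap.lTensor _ (polyDer C) (y * z) =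
      LinearMap.lTensor _ (polyDer C) y * z + y * LinearMap.lTensor _ (polyDer C) z := by
    intro y z
    induction y with
    | zero => simp
    | add x y hx hy => simp only [map_add, add_mul, hx, hy]; abel
    | tmul v c =>
      induction z with
      | zero => simp
      | add x y hx hy => simp only [map_add, mul_add, hx, hy]; abel
      | tmul w e => simp [TensorProduct.tmul_add]
  have hder : LinearMap.lTensor _ (polyDer C) (nilExp (iotaC 𝒱 C[X] (L.gaugePath N a x))) =
      L.codiffC _ (-(iotaC 𝒱 C[X] (LinearMap.lTensor V (polyMono C 0) a) *
        nilExp (iotaC 𝒱 C[X] (L.gaugePath N a x)))) := by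
    rw [map_neg, L.codiffC_mul_nilExp ha0 hp' hn (L.curvC_gaugePath hN ha hx hc), neg_neg, ← hd,
      ← hι]
    refine derivation_nilExp _ ?_ (hleib _) (by rw [hι]; exact commute_iotaC hp' _) hn
    rw [Algebra.TensorProduct.one_def]
    simp
  -- Integration from 0 to 1 on the polynomial factor, performed together with ψ on the other
  -- factor.
  have hint : ∀ z : GSym (gradedShift 𝒱 1) ⊗[ℂ] C[X],
      TensorProduct.map ψ ((polyEval C 1).toLinearMap ∘ₗ polyInt C)
        (LinearMap.lTensor _ (polyDer C) z) + TensorProduct.map ψ (polyEval C 0).toLinearMap z =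
      TensorProduct.map ψ (polyEval C 1).toLinearMap z := by
    intro z
    induction z with
    | zero => simp
    | add x y hx hy =>
      simp only [map_add, ← hx, ← hy]; abel
    | tmul v p =>
      have := congrArg (polyEval C 1) (polyInt_polyDer p)
      rw [map_add] at this
      simp only [LinearMap.lTensor_tmul, TensorProduct.map_tmul, LinearMap.comp_apply,
        AlgHom.toLinearMap_apply, ← TensorProduct.tmul_add, ← this]
      simp
  have := hint (nilExp (iotaC 𝒱 C[X] (L.gaugePath N a x)))
  rw [hder, L.map_codiffC hψ, zero_add, lTensor_potential ψ _ hn, lTensor_potential ψ _ hn,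
    gaugePath_eval_zero] at this
  exact this.symm

end DGLA

/-! ### Linear algebra of subspaces of tensor products -/

section TensorSub

/-- A generalized inverse, obtained by extending a section of X → range f to all of Y. Then id - g ∘
f maps into ker f and fixes ker f, which is how kernels are handled after tensoring. -/
theorem LinearMap.exists_comp_comp_eq {X Y : Type*} [AddCommGroup X] [Module ℂ X] [AddCommGroup Y]
    [Module ℂ Y] (f : X →ₗ[ℂ] Y) : ∃ g : Y →ₗ[ℂ] X, ∀ x, f (g (f x)) = f x := by
  obtain ⟨s, hs⟩ := f.rangeRestrict.exists_rightInverse_of_surjective f.range_rangeRestrict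
  obtain ⟨g, hg⟩ := LinearMap.exists_extend s
  refine ⟨g, fun x => ?_⟩
  have h1 : g (f x) = s ⟨f x, x, rfl⟩ := LinearMap.congr_fun hg ⟨f x, x, rfl⟩
  rw [h1]
  exact congrArg Subtype.val (LinearMap.congr_fun hs ⟨f x, x, rfl⟩)

variable {W C D : Type*} [AddCommGroup W] [Module ℂ W] [AddCommGroup C] [Module ℂ C]
  [AddCommGroup D] [Module ℂ D] {W' : Submodule ℂ W} {N : Submodule ℂ C}

theorem mem_tensorSub_inf_ker_right {f : C →ₗ[ℂ] D} {z : W ⊗[ℂ] C} (hz : z ∈ tensorSub W' N)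
    (h : LinearMap.lTensor W f z = 0) : z ∈ tensorSub W' (N ⊓ LinearMap.ker f) := by
  obtain ⟨g, hg⟩ := (f ∘ₗ N.subtype).exists_comp_comp_eq
  have hz' : z = LinearMap.lTensor W (LinearMap.id - N.subtype ∘ₗ g ∘ₗ f) z := by
    rw [LinearMap.lTensor_sub, LinearMap.sub_apply, LinearMap.lTensor_comp, LinearMap.lTensor_comp,
      LinearMap.comp_apply, LinearMap.comp_apply, h]
    simp
  rw [hz']
  refine map_mem_tensorSub (f := LinearMap.id) (fun _ h => h)
    (fun c hc => Submodule.mem_inf.2 ⟨?_, ?_⟩) hz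
  · exact N.sub_mem hc (g _).2
  · have := hg ⟨c, hc⟩
    simp only [LinearMap.comp_apply, Submodule.subtype_apply] at this
    simp [LinearMap.mem_ker, this]

theorem mem_tensorSub_inf_ker_left {f : W →ₗ[ℂ] D} {z : W ⊗[ℂ] C} (hz : z ∈ tensorSub W' N)
    (h : LinearMap.rTensor C f z = 0) : z ∈ tensorSub (W' ⊓ LinearMap.ker f) N := by
  obtain ⟨g, hg⟩ := (f ∘ₗ W'.subtype).exists_comp_comp_eq
  have hz' : z = LinearMap.rTensor C (LinearMap.id - W'.subtype ∘ₗ g ∘ₗ f) z := by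
    rw [LinearMap.rTensor_sub, LinearMap.sub_apply, LinearMap.rTensor_comp, LinearMap.rTensor_comp,
      LinearMap.comp_apply, LinearMap.comp_apply, h]
    simp
  rw [hz']
  refine map_mem_tensorSub (g := LinearMap.id) (fun c hc => Submodule.mem_inf.2 ⟨?_, ?_⟩)
    (fun _ h => h) hz
  · exact W'.sub_mem hc (g _).2
  · have := hg ⟨c, hc⟩
    simp only [LinearMap.comp_apply, Submodule.subtype_apply] at this
    simp [LinearMap.mem_ker, this]

theorem exists_of_mem_tensorSub_map_left {f : W →ₗ[ℂ] D} {z : D ⊗[ℂ] C}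
    (hz : z ∈ tensorSub (W'.map f) N) : ∃ y ∈ tensorSub W' N, LinearMap.rTensor C f y = z := by
  induction hz using tensorSub_induction with
  | zero => exact ⟨0, zero_mem _, map_zero _⟩
  | tmul w hw c hc =>
    obtain ⟨v, hv, rfl⟩ := hw
    exact ⟨v ⊗ₜ c, tmul_mem_tensorSub hv hc, by simp⟩
  | add x y _ _ hx hy =>
    obtain ⟨x, hx, rfl⟩ := hx
    obtain ⟨y, hy, rfl⟩ := hy
    exact ⟨x + y, add_mem hx hy, map_add _ _ _⟩

theorem exists_of_mem_tensorSub_map_right {f : C →ₗ[ℂ] D} {z : W ⊗[ℂ] D}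
    (hz : z ∈ tensorSub W' (N.map f)) : ∃ y ∈ tensorSub W' N, LinearMap.lTensor W f y = z := by
  induction hz using tensorSub_induction with
  | zero => exact ⟨0, zero_mem _, map_zero _⟩
  | tmul w hw c hc =>
    obtain ⟨v, hv, rfl⟩ := hc
    exact ⟨w ⊗ₜ v, tmul_mem_tensorSub hw hv, by simp⟩
  | add x y _ _ hx hy =>
    obtain ⟨x, hx, rfl⟩ := hx
    obtain ⟨y, hy, rfl⟩ := hy
    exact ⟨x + y, add_mem hx hy, map_add _ _ _⟩

end TensorSub

/-! ### Constructions with local Artinian algebras -/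

namespace ArtAlg

open IsLocalRing

theorem residue_bijective_of_surjective {C : Type*} [CommRing C] [Algebra ℂ C] [IsLocalRing C]
    (h : ∀ x : C, ∃ c : ℂ, x - algebraMap ℂ C c ∈ maximalIdeal C) :
    Function.Bijective (algebraMap ℂ (ResidueField C)) := by
  refine ⟨(algebraMap ℂ (ResidueField C)).injective, fun y => ?_⟩
  obtain ⟨x, rfl⟩ := residue_surjective y
  obtain ⟨c, hc⟩ := h x
  refine ⟨c, ?_⟩
  rw [← residue_eq_zero_iff, map_sub, sub_eq_zero] at hc
  exact hc.symm

theorem exists_sub_mem (A : ArtAlg) (x : A.carrier) :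
    ∃ c : ℂ, x - algebraMap ℂ A.carrier c ∈ maximalIdeal A.carrier := by
  obtain ⟨c, hc⟩ := A.residue_bijective.2 (residue A.carrier x)
  refine ⟨c, ?_⟩
  rw [← residue_eq_zero_iff, map_sub, sub_eq_zero, ← hc]
  rfl

/-- The quotient of a local Artinian algebra by a proper ideal. -/
def quot (A : ArtAlg) (I : Ideal A.carrier) (hI : I ≠ ⊤) : ArtAlg :=
  haveI : Nontrivial (A.carrier ⧸ I) := Ideal.Quotient.nontrivial_iff.2 hI
  haveI : IsLocalRing (A.carrier ⧸ I) :=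
    IsLocalRing.of_surjective' (Ideal.Quotient.mk I) Ideal.Quotient.mk_surjective
  { carrier := A.carrier ⧸ I
    residue_bijective := residue_bijective_of_surjective fun x => by
      obtain ⟨x, rfl⟩ := Ideal.Quotient.mk_surjective x
      obtain ⟨c, hc⟩ := A.exists_sub_mem x
      refine ⟨c, (mem_maximalIdeal _).2 fun hu => ?_⟩
      have h2 : IsUnit (Ideal.Quotient.mk I (x - algebraMap ℂ A.carrier c)) := by
        rw [map_sub]; exact hu
      have := IsLocalHom.of_surjective (Ideal.Quotient.mk I) Ideal.Quotient.mk_surjective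
      exact (mem_maximalIdeal _).1 hc (isUnit_of_map_unit _ _ h2) }

/-- The projection onto a quotient. -/
def quotMap (A : ArtAlg) (I : Ideal A.carrier) (hI : I ≠ ⊤) :
    A.carrier →ₐ[ℂ] (A.quot I hI).carrier := Ideal.Quotient.mkₐ ℂ I

theorem quotMap_surjective (A : ArtAlg) (I : Ideal A.carrier) (hI : I ≠ ⊤) :
    Function.Surjective (A.quotMap I hI) := Ideal.Quotient.mk_surjective

theorem quotMap_eq_zero (A : ArtAlg) (I : Ideal A.carrier) (hI : I ≠ ⊤) (x : A.carrier) :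
    A.quotMap I hI x = 0 ↔ x ∈ I := Ideal.Quotient.eq_zero_iff_mem

variable {A B : ArtAlg}

theorem mem_maxIdeal_of_map (p : A.carrier →ₐ[ℂ] B.carrier) {x : A.carrier}
    (hx : p x ∈ B.maxIdeal) : x ∈ A.maxIdeal :=
  (mem_maximalIdeal _).2 fun hu => (mem_maximalIdeal _).1 hx (hu.map p)

theorem map_maxIdeal {p : A.carrier →ₐ[ℂ] B.carrier} (hp : Function.Surjective p) :
    A.maxIdeal.map p.toLinearMap = B.maxIdeal := by
  refine le_antisymm ?_ fun y hy => ?_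
  · rintro _ ⟨x, hx, rfl⟩
    exact map_mem p hx
  · obtain ⟨x, rfl⟩ := hp y
    exact ⟨x, mem_maxIdeal_of_map p hy, rfl⟩

theorem maximalIdeal_map {p : A.carrier →ₐ[ℂ] B.carrier} (hp : Function.Surjective p) :
    (maximalIdeal A.carrier).map p = maximalIdeal B.carrier := by
  refine le_antisymm (Ideal.map_le_iff_le_comap.2 fun x hx => map_mem p hx) fun y hy => ?_
  obtain ⟨x, rfl⟩ := hp y
  exact Ideal.mem_map_of_mem p (mem_maxIdeal_of_map p hy)

end ArtAlg

/-! ### The potential separates gauge classes. -/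

namespace DGLA

open IsLocalRing Relation

variable {V : Type*} [AddCommGroup V] [Module ℂ V] {𝒱 : ℤ → Submodule ℂ V} (L : DGLA 𝒱)
  {A B : ArtAlg}

theorem gauge_eq {N : ℕ} (hN : maximalIdeal A.carrier ^ N = ⊥) {a : V ⊗[ℂ] A.carrier}
    (ha : a ∈ tensorMax 𝒱 0 A) (x : V ⊗[ℂ] A.carrier) :
    L.gauge A a x =
      LinearMap.lTensor V (polyEval A.carrier 1).toLinearMap (L.gaugePath N a x) := by
  rw [gaugePath_eval_one, gauge]
  congr 1
  refine finsum_eq_sum_of_support_subset _ fun n hn => ?_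
  by_contra h
  refine hn ?_
  have h0 : ((L.brC A.carrier a) ^ n) (L.brC A.carrier a x - L.dC A.carrier a) = 0 :=
    L.pow_brC_eq_zero (le_bot_iff.1 (hN ▸ Ideal.pow_le_pow_right (by simpa using h))) ha _
  exact (congrArg _ h0).trans (smul_zero _)

/-- The gauge action on Maurer-Cartan elements. -/
def MC.gauge {a : V ⊗[ℂ] A.carrier} (ha : a ∈ tensorMax 𝒱 0 A) (x : L.MC A) : L.MC A :=
  ⟨L.gauge A a x.1, by
    obtain ⟨N, hN⟩ := A.maximalIdeal_nilpotent
    rw [L.gauge_eq hN ha]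
    refine lTensor_mem_tensorSub ?_ (L.gaugePath_mem (I := maximalIdeal A.carrier) ha x.2.1 N)
    intro p hp
    have h : Ideal.map (Polynomial.C : A.carrier →+* _) (maximalIdeal A.carrier) ≤
        (maximalIdeal A.carrier).comap (polyEval A.carrier 1) :=
      Ideal.map_le_iff_le_comap.2 fun c hc => by simpa using hc
    exact h hp, by
    obtain ⟨N, hN⟩ := A.maximalIdeal_nilpotent
    rw [L.gauge_eq hN ha]
    change L.curvC _ _ = 0
    rw [← lTensor_curvC, L.curvC_gaugePath hN ha x.2.1 x.2.2, map_zero]⟩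

theorem gaugeRel_gauge {a : V ⊗[ℂ] A.carrier} (ha : a ∈ tensorMax 𝒱 0 A) (x : L.MC A) :
    L.GaugeRel A x (MC.gauge L ha x) := ⟨a, ha, rfl⟩

theorem exists_lift_tensorMax {p : A.carrier →ₐ[ℂ] B.carrier} (hp : Function.Surjective p) {i : ℤ}
    {b : V ⊗[ℂ] B.carrier} (hb : b ∈ tensorMax 𝒱 i B) :
    ∃ a ∈ tensorMax 𝒱 i A, baseChange V p a = b := by
  have hb' : b ∈ tensorSub (𝒱 i) (A.maxIdeal.map p.toLinearMap) := by
    rw [ArtAlg.map_maxIdeal hp]; exact hb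
  exact exists_of_mem_tensorSub_map_right hb'

/-- Chains of gauge equivalences can be lifted along surjections. -/
theorem exists_lift_reflTransGen {p : A.carrier →ₐ[ℂ] B.carrier} (hp : Function.Surjective p)
    -- Working with chains of gauge moves avoids composing them by the Baker-Campbell-Hausdorff
    -- product. Each gauge parameter lifts separately, since V^0 ⊗ m_A surjects onto V^0 ⊗ m_B.
    (x : L.MC A) {y : L.MC B} (h : ReflTransGen (L.GaugeRel B) (MC.map L p x) y) :
    ∃ x' : L.MC A, ReflTransGen (L.GaugeRel A) x x' ∧ MC.map L p x' = y := by
  induction h with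
  | refl => exact ⟨x, .refl, rfl⟩
  | tail _ h ih =>
    obtain ⟨x', hx', rfl⟩ := ih
    obtain ⟨b, hb, h⟩ := h
    obtain ⟨a, ha, rfl⟩ := exists_lift_tensorMax hp hb
    exact ⟨MC.gauge L ha x', hx'.tail (L.gaugeRel_gauge ha x'),
      Subtype.ext ((L.baseChange_gauge p ha x'.1).trans h.symm)⟩

variable {U : Type*} [AddCommGroup U] [Module ℂ U]

theorem lTensor_potential_map (ψ : GSym (gradedShift 𝒱 1) →ₗ[ℂ] U) (p : A.carrier →ₐ[ℂ] B.carrier)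
    (x : L.MC A) : LinearMap.lTensor U p.toLinearMap (potential A.carrier ψ x.1) =
      potential B.carrier ψ (MC.map L p x).1 := by
  have h := lTensor_potential (𝒱 := 𝒱) ψ p (isNilpotent_iotaC x.2.1)
  refine Eq.trans ?_ h
  rw [potential, LinearMap.lTensor, ← LinearMap.comp_apply, ← TensorProduct.map_comp]
  simp

/-- The positive powers of x have coefficients in m_A, and ψ 1 = 0 removes the constant term of the
exponential. -/
theorem potential_mem {ψ : GSym (gradedShift 𝒱 1) →ₗ[ℂ] U} (h1 : ψ 1 = 0) (x : L.MC A) :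
    potential A.carrier ψ x.1 ∈ tensorSub ⊤ A.maxIdeal := by
  have hx : iotaC 𝒱 A.carrier x.1 ∈ tensorSub ⊤ ((maximalIdeal A.carrier).restrictScalars ℂ) :=
    iotaC_mem x.2.1
  obtain ⟨N, hN⟩ := isNilpotent_iotaC (𝒱 := 𝒱) x.2.1
  have hN1 := pow_eq_zero_of_le N.le_succ hN
  rw [potential, nilExp_eq_sum hN1, Finset.sum_range_succ', map_add, map_sum]
  refine add_mem (sum_mem fun n _ => ?_) ?_
  · rw [map_smul]
    refine Submodule.smul_mem _ _ (map_mem_tensorSub (fun _ _ => Submodule.mem_top) (fun _ h => h)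
      (tensorSub_mono le_rfl ?_ (pow_mem_tensorSub_top hx (n + 1))))
    exact fun z hz => Ideal.pow_le_self n.succ_ne_zero hz
  · rw [pow_zero, map_smul, Algebra.TensorProduct.one_def, TensorProduct.map_tmul, h1]
    simp

variable {ψ : GSym (gradedShift 𝒱 1) →ₗ[ℂ] U}

theorem brC_eq_zero {C : Type*} [CommRing C] [Algebra ℂ C] {W₁ W₂ : Submodule ℂ V}
    {N N' : Submodule ℂ C} (h : ∀ a ∈ N, ∀ b ∈ N', a * b = 0) {x y : V ⊗[ℂ] C}
    (hx : x ∈ tensorSub W₁ N) (hy : y ∈ tensorSub W₂ N') : L.brC C x y = 0 := by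
  have := map₂_mem_tensorSub (W₂' := ⊤) (N₂ := (⊥ : Submodule ℂ C)) (f := L.bracket)
    (g := LinearMap.mul ℂ C) (fun _ _ _ _ => Submodule.mem_top)
    (fun a ha b hb => by simp [h a ha b hb]) hx hy
  rwa [tensorSub_bot] at this

/-- Two Maurer-Cartan elements with the same potential which agree modulo an ideal annihilated by
`m_A` are gauge equivalent. -/
theorem gaugeRel_of_map_eq (hψ : ∀ v ∈ L.cocycles 1, ψ (GSym.ι _ v) = 0 → v ∈ (𝒱 0).map L.d)
    (e : SmallExtension A B) {x y : L.MC A} (h : MC.map L e.p x = MC.map L e.p y)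
    (hp : potential A.carrier ψ x.1 = potential A.carrier ψ y.1) : L.GaugeRel A x y := by
  have hJ : ∀ a ∈ A.maxIdeal, ∀ b ∈ A.maxIdeal ⊓ e.J, a * b = 0 :=
    fun a ha b hb => e.mul_eq_zero a ha b hb.2
  have hJ' : ∀ b ∈ A.maxIdeal ⊓ e.J, ∀ a ∈ A.maxIdeal, b * a = 0 :=
    fun b hb a ha => by rw [mul_comm]; exact hJ a ha b hb
  have hJJ : ∀ b ∈ A.maxIdeal ⊓ e.J, ∀ a ∈ A.maxIdeal ⊓ e.J, b * a = 0 :=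
    fun b hb a ha => hJ b hb.1 a ha
  have hx : x.1 ∈ tensorSub (𝒱 1) A.maxIdeal := x.2.1
  obtain ⟨k, hk⟩ : ∃ k, y.1 = x.1 + k := ⟨y.1 - x.1, by abel⟩
  have hk1 : k ∈ tensorSub (𝒱 1) (A.maxIdeal ⊓ e.J) := by
    have hk' : k = y.1 - x.1 := by rw [hk]; abel
    refine mem_tensorSub_inf_ker_right ?_ ?_
    · rw [hk']
      exact sub_mem y.2.1 hx
    · rw [hk', map_sub, sub_eq_zero]
      exact (congrArg Subtype.val h).symm
  -- All brackets with k vanish because m_A J = 0, so the two Maurer-Cartan equations differ by dk.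
  have hk2 : L.dC A.carrier k = 0 := by
    have h1 : L.curvC A.carrier y.1 = 0 := y.2.2
    have h2 : L.curvC A.carrier x.1 = 0 := x.2.2
    rw [hk, curvC, map_add, map_add, map_add, LinearMap.add_apply, LinearMap.add_apply,
      L.brC_eq_zero hJ hx hk1, L.brC_eq_zero hJ' hk1 hx, L.brC_eq_zero hJJ hk1 hk1] at h1
    rw [curvC] at h2
    rw [← h1]
    simp only [add_zero]
    rw [add_right_comm, h2, zero_add]
  -- For the same reason e^(x+k) = e^x + k, and equality of the potentials becomes the vanishing of
  -- the linear part of ψ on k.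
  have hk3 : LinearMap.rTensor A.carrier (ψ ∘ₗ GSym.ι (gradedShift 𝒱 1)) k = 0 := by
    have hn := isNilpotent_iotaC (𝒱 := 𝒱) hx
    rw [hk, potential, potential, map_add, nilExp_add_of_mul_eq_zero hn
      (mul_eq_zero_of_mem_tensorSub hJ (iotaC_mem hx) (iotaC_mem hk1))
      (mul_eq_zero_of_mem_tensorSub hJ' (iotaC_mem hk1) (iotaC_mem hx))
      (mul_eq_zero_of_mem_tensorSub hJJ (iotaC_mem hk1) (iotaC_mem hk1)), map_add,
      left_eq_add] at hp
    rw [← hp, iotaC, ← LinearMap.comp_apply, ← TensorProduct.map_comp]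
    rfl
  have hk4 := mem_tensorSub_inf_ker_left (mem_tensorSub_inf_ker_left hk1 hk2) hk3
  have hle : 𝒱 1 ⊓ LinearMap.ker L.d ⊓ LinearMap.ker (ψ ∘ₗ GSym.ι (gradedShift 𝒱 1)) ≤
      (𝒱 0).map L.d := fun v hv => hψ v hv.1 hv.2
  obtain ⟨a, ha, hak⟩ := exists_of_mem_tensorSub_map_left (tensorSub_mono hle le_rfl hk4)
  -- With da = k and [a, x] = 0, the gauge action of -a reduces to x ↦ x - d(-a) = x + k.
  refine ⟨-a, neg_mem (tensorSub_mono le_rfl inf_le_left ha), ?_⟩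
  have e1 : L.bracketT A (-a) x.1 - L.dT A (-a) = k := by
    rw [map_neg, map_neg, LinearMap.neg_apply]
    have h1 : L.bracketT A a x.1 = 0 := L.brC_eq_zero hJ' ha hx
    rw [h1, ← hak]
    simp
    rfl
  have e2 : L.bracketT A (-a) k = 0 := L.brC_eq_zero hJJ (neg_mem ha) hk1
  rw [gauge, e1, hk, finsum_eq_single _ 0]
  · simp
  · intro n hn
    obtain ⟨n, rfl⟩ := Nat.exists_eq_succ_of_ne_zero hn
    rw [pow_succ, Module.End.mul_apply, e2, map_zero, smul_zero]

variable [DirectSum.Decomposition 𝒱]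

theorem potential_eq_of_gaugeRel (hψ : ∀ z, ψ (L.codiffFull z) = 0) {x y : L.MC A}
    (h : L.GaugeRel A x y) : potential A.carrier ψ x.1 = potential A.carrier ψ y.1 := by
  obtain ⟨a, ha, h⟩ := h
  obtain ⟨N, hN⟩ := A.maximalIdeal_nilpotent
  rw [h, L.gauge_eq hN ha]
  exact (L.potential_gaugePath hψ hN ha x.2.1 x.2.2).symm

theorem potential_eq_of_reflTransGen (hψ : ∀ z, ψ (L.codiffFull z) = 0) {x y : L.MC A}
    (h : ReflTransGen (L.GaugeRel A) x y) :
    potential A.carrier ψ x.1 = potential A.carrier ψ y.1 := by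
  induction h with
  | refl => rfl
  | tail _ h ih => rw [ih, L.potential_eq_of_gaugeRel hψ h]

/-- If `ψ` is injective on `H^1`, then the potential separates gauge equivalence classes. -/
theorem reflTransGen_of_potential_eq (hψ : ∀ z, ψ (L.codiffFull z) = 0)
    (hinj : ∀ v ∈ L.cocycles 1, ψ (GSym.ι _ v) = 0 → v ∈ (𝒱 0).map L.d) {x y : L.MC A}
    (hp : potential A.carrier ψ x.1 = potential A.carrier ψ y.1) :
    ReflTransGen (L.GaugeRel A) x y := by
  obtain ⟨N, hN⟩ := A.maximalIdeal_nilpotent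
  -- Induction on the exponent that kills m_A. Exponent 0 would force 1 = 0, and exponent 1 means
  -- m_A = 0, where 0 is the only Maurer-Cartan element.
  induction N generalizing A with
  | zero =>
    exact absurd hN (by rw [pow_zero, Ideal.one_eq_top]; exact top_ne_bot)
  | succ N ih =>
    rcases N with _ | N
    · have h0 : tensorMax 𝒱 1 A = ⊥ := by
        rw [zero_add, pow_one] at hN
        have : A.maxIdeal = ⊥ := by rw [ArtAlg.maxIdeal, hN]; rfl
        change tensorSub _ A.maxIdeal = ⊥
        rw [this, tensorSub_bot]
      have hz : ∀ z : L.MC A, z.1 = 0 := fun z => (Submodule.mem_bot ℂ).1 (h0.le z.2.1)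
      rw [show x = y from Subtype.ext ((hz x).trans (hz y).symm)]
    · have hI : maximalIdeal A.carrier ^ (N + 1) ≠ ⊤ := fun h =>
        (maximalIdeal.isMaximal A.carrier).ne_top
          (top_le_iff.1 (h.symm.le.trans (Ideal.pow_le_self N.succ_ne_zero)))
      -- Dividing by the last nonzero candidate power of m_A gives a small extension whose base has
      -- a smaller exponent.
      let e : SmallExtension A (A.quot _ hI) :=
        { p := A.quotMap _ hI
          surjective := A.quotMap_surjective _ hI
          mul_eq_zero := fun x hx y hy => by
            rw [ArtAlg.quotMap_eq_zero] at hy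
            have : x * y ∈ maximalIdeal A.carrier ^ (N + 1 + 1) := by
              rw [pow_succ']
              exact Ideal.mul_mem_mul hx hy
            rwa [hN] at this }
      have hB : maximalIdeal (A.quot _ hI).carrier ^ (N + 1) = ⊥ := by
        rw [← ArtAlg.maximalIdeal_map e.surjective, ← Ideal.map_pow, eq_bot_iff,
          Ideal.map_le_iff_le_comap]
        intro z hz
        exact (ArtAlg.quotMap_eq_zero _ _ hI z).2 hz
      have hq : potential _ ψ (MC.map L e.p x).1 = potential _ ψ (MC.map L e.p y).1 := by
        rw [← lTensor_potential_map, ← lTensor_potential_map, hp]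
      -- The chain found over the quotient is lifted from x. Its endpoint x' agrees with y modulo
      -- the kernel and still has the potential of y, so one further gauge move joins x' to y.
      obtain ⟨x', hx', h⟩ := L.exists_lift_reflTransGen e.surjective x (ih hq hB)
      refine hx'.tail (L.gaugeRel_of_map_eq hinj e h ?_)
      rw [← L.potential_eq_of_reflTransGen hψ hx', hp]

/-- Lifting a Maurer-Cartan element with prescribed potential. -/
theorem exists_lift_of_potential_eq (hψ : ∀ z, ψ (L.codiffFull z) = 0)
    (hinj : ∀ v ∈ L.cocycles 1, ψ (GSym.ι _ v) = 0 → v ∈ (𝒱 0).map L.d)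
    {p : A.carrier →ₐ[ℂ] B.carrier} (hp : Function.Surjective p) (x : L.MC A) (y : L.MC B)
    (h : LinearMap.lTensor U p.toLinearMap (potential A.carrier ψ x.1) =
      potential B.carrier ψ y.1) :
    ∃ x' : L.MC A, potential A.carrier ψ x'.1 = potential A.carrier ψ x.1 ∧
      MC.map L p x' = y := by
  rw [lTensor_potential_map] at h
  obtain ⟨x', hx', h'⟩ := L.exists_lift_reflTransGen hp x
    (L.reflTransGen_of_potential_eq hψ hinj h)
  exact ⟨x', (L.potential_eq_of_reflTransGen hψ hx').symm, h'⟩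

end DGLA

/-! ### Finite-dimensional local algebras and their subalgebras. -/

namespace ArtAlg

open IsLocalRing

theorem isNilpotent_of_mem_maxIdeal {A : ArtAlg} {x : A.carrier} (hx : x ∈ A.maxIdeal) :
    IsNilpotent x := by
  obtain ⟨n, hn⟩ := A.maximalIdeal_nilpotent
  refine ⟨n, ?_⟩
  have := Ideal.pow_mem_pow (show x ∈ maximalIdeal A.carrier from hx) n
  rwa [hn] at this

instance finite_carrier (A : ArtAlg) : Module.Finite ℂ A.carrier := by
  have : Module.Finite ℂ (ResidueField A.carrier) :=
    Module.Finite.of_surjective (Algebra.linearMap ℂ (ResidueField A.carrier)) A.residue_bijective.2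
  have hk : RingHom.ker (IsScalarTower.toAlgHom ℂ A.carrier (ResidueField A.carrier)) =
      maximalIdeal A.carrier := ker_residue
  refine Module.finite_of_surjective_of_ker_le_nilradical
    (IsScalarTower.toAlgHom ℂ A.carrier (ResidueField A.carrier)) residue_surjective ?_ ?_
  · rw [hk]
    exact fun x hx => isNilpotent_of_mem_maxIdeal hx
  · exact IsNoetherian.noetherian _

theorem isLocalRing_of_isNilpotent {C : Type*} [CommRing C] [Algebra ℂ C] [Nontrivial C]
    (h : ∀ x : C, ∃ c : ℂ, IsNilpotent (x - algebraMap ℂ C c)) : IsLocalRing C := by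
  have key : ∀ (x : C) (c : ℂ), IsNilpotent (x - algebraMap ℂ C c) → c ≠ 0 → IsUnit x := by
    intro x c hx hc
    have := hx.isUnit_add_left_of_commute ((IsUnit.mk0 c hc).map (algebraMap ℂ C)) (Commute.all _ _)
    rwa [add_sub_cancel] at this
  refine IsLocalRing.of_isUnit_or_isUnit_one_sub_self fun x => ?_
  obtain ⟨c, hc⟩ := h x
  by_cases h0 : c = 0
  · right
    subst h0
    refine key (1 - x) 1 ?_ one_ne_zero
    have : 1 - x - algebraMap ℂ C 1 = -(x - algebraMap ℂ C 0) := by simp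
    rw [this]
    exact hc.neg
  · exact Or.inl (key x c hc h0)

/-- A finite-dimensional algebra in which every element is a scalar plus a nilpotent. -/
def ofFinite (C : Type) [CommRing C] [Algebra ℂ C] [Nontrivial C] [Module.Finite ℂ C]
    (h : ∀ x : C, ∃ c : ℂ, IsNilpotent (x - algebraMap ℂ C c)) : ArtAlg :=
  haveI := isLocalRing_of_isNilpotent h
  haveI := IsArtinianRing.of_finite ℂ C
  { carrier := C
    residue_bijective := residue_bijective_of_surjective fun x => by
      obtain ⟨c, hc⟩ := h x
      exact ⟨c, (mem_maximalIdeal _).2 fun hu => hc.not_isUnit hu⟩ }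

/-- A subalgebra of a local Artinian algebra. -/
def sub (A : ArtAlg) (S : Subalgebra ℂ A.carrier) : ArtAlg :=
  ofFinite S fun x => by
    obtain ⟨c, hc⟩ := A.exists_sub_mem x
    obtain ⟨n, hn⟩ := isNilpotent_of_mem_maxIdeal hc
    exact ⟨c, n, Subtype.ext hn⟩

theorem sub_mem_maxIdeal {A : ArtAlg} {S : Subalgebra ℂ A.carrier} {x : S} :
    (show (A.sub S).carrier from x) ∈ (A.sub S).maxIdeal ↔ (x : A.carrier) ∈ A.maxIdeal :=
  ⟨fun h => map_mem (A := A.sub S) S.val h, fun h => mem_maxIdeal_of_map (A := A.sub S) S.val h⟩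

end ArtAlg

/-! ### The image of the potential as a subfunctor. -/

namespace DGLA

open IsLocalRing

variable {V : Type*} [AddCommGroup V] [Module ℂ V] {𝒱 : ℤ → Submodule ℂ V} (L : DGLA 𝒱)
  {U : Type*} [AddCommGroup U] [Module ℂ U] (ψ : GSym (gradedShift 𝒱 1) →ₗ[ℂ] U)

/-- The elements of `U ⊗ A` which are potentials of Maurer-Cartan elements. -/
def IsPotential (A : ArtAlg) (u : U ⊗[ℂ] A.carrier) : Prop :=
  ∃ x : L.MC A, potential A.carrier ψ x.1 = u

variable {ψ} {A B C D : ArtAlg}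

theorem IsPotential.map {u : U ⊗[ℂ] A.carrier} (h : L.IsPotential ψ A u)
    (f : A.carrier →ₐ[ℂ] B.carrier) : L.IsPotential ψ B (LinearMap.lTensor U f.toLinearMap u) := by
  obtain ⟨x, rfl⟩ := h
  exact ⟨MC.map L f x, (L.lTensor_potential_map ψ f x).symm⟩

theorem potential_zero (h1 : ψ 1 = 0) (A : ArtAlg) :
    potential A.carrier ψ (0 : V ⊗[ℂ] A.carrier) = 0 := by
  rw [potential, map_zero, nilExp_eq_sum (N := 1) (by simp), Finset.sum_range_one,
    pow_zero, map_smul, Algebra.TensorProduct.one_def, TensorProduct.map_tmul, h1]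
  simp

theorem isPotential_zero (h1 : ψ 1 = 0) (A : ArtAlg) : L.IsPotential ψ A 0 :=
  ⟨⟨0, zero_mem _, by simp [curvature]⟩, potential_zero h1 A⟩

theorem eq_zero_of_lTensor_eq_zero {W E F G : Type*} [AddCommGroup W] [Module ℂ W] [AddCommGroup E]
    [Module ℂ E] [AddCommGroup F] [Module ℂ F] [AddCommGroup G] [Module ℂ G] {f : E →ₗ[ℂ] F}
    {g : E →ₗ[ℂ] G} (h : ∀ x, f x = 0 → g x = 0 → x = 0) {z : W ⊗[ℂ] E}
    (hf : LinearMap.lTensor W f z = 0) (hg : LinearMap.lTensor W g z = 0) : z = 0 := by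
  have hz : z ∈ tensorSub (⊤ : Submodule ℂ W) (⊤ : Submodule ℂ E) := by
    rw [tensorSub_top]; trivial
  have h2 := mem_tensorSub_inf_ker_right (mem_tensorSub_inf_ker_right hz hf) hg
  have h3 : (⊤ : Submodule ℂ E) ⊓ LinearMap.ker f ⊓ LinearMap.ker g = ⊥ :=
    eq_bot_iff.2 fun x hx => h x hx.1.2 hx.2
  rwa [h3, tensorSub_bot] at h2

variable [DirectSum.Decomposition 𝒱]

/-- Potentials are compatible with fibre products along surjections. -/
theorem isPotential_of_fibreProduct (hψ : ∀ z, ψ (L.codiffFull z) = 0)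
    (hinj : ∀ v ∈ L.cocycles 1, ψ (GSym.ι _ v) = 0 → v ∈ (𝒱 0).map L.d)
    {q : D.carrier →ₐ[ℂ] A.carrier} {r : D.carrier →ₐ[ℂ] B.carrier}
    {s : A.carrier →ₐ[ℂ] C.carrier} {t : B.carrier →ₐ[ℂ] C.carrier}
    (hq : Function.Surjective q) (hs : Function.Surjective s)
    (hc : s.comp q = t.comp r) (hz : ∀ z, q z = 0 → r z = 0 → z = 0)
    (ht : ∀ b, t b = 0 → ∃ z, q z = 0 ∧ r z = b) {u : U ⊗[ℂ] D.carrier}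
    (h1 : L.IsPotential ψ A (LinearMap.lTensor U q.toLinearMap u))
    (h2 : L.IsPotential ψ B (LinearMap.lTensor U r.toLinearMap u)) : L.IsPotential ψ D u := by
  have hcomp : ∀ (W : Type _) [AddCommGroup W] [Module ℂ W] (w : W ⊗[ℂ] D.carrier),
      LinearMap.lTensor W s.toLinearMap (LinearMap.lTensor W q.toLinearMap w) =
      LinearMap.lTensor W t.toLinearMap (LinearMap.lTensor W r.toLinearMap w) := by
    intro W _ _ w
    rw [← LinearMap.comp_apply, ← LinearMap.lTensor_comp, ← LinearMap.comp_apply,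
      ← LinearMap.lTensor_comp, ← AlgHom.comp_toLinearMap, hc, AlgHom.comp_toLinearMap]
  obtain ⟨x, hx⟩ := h1
  obtain ⟨y, hy⟩ := h2
  -- The images of x and y in C have the same potential but need not coincide. Moving x within its
  -- gauge class makes them equal without changing the potential.
  obtain ⟨x', hx', hxy⟩ := L.exists_lift_of_potential_eq hψ hinj hs x (MC.map L t y) (by
    rw [← lTensor_potential_map, hx, hy]
    rw [← LinearMap.comp_apply, ← LinearMap.lTensor_comp, ← LinearMap.comp_apply,
      ← LinearMap.lTensor_comp, ← AlgHom.comp_toLinearMap, hc, AlgHom.comp_toLinearMap])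
  obtain ⟨z₀, hz₀, hqz⟩ := exists_lift_tensorMax hq x'.2.1
  have hw : y.1 - baseChange V r z₀ ∈ tensorSub (𝒱 1) (B.maxIdeal ⊓ LinearMap.ker t.toLinearMap) := by
    refine mem_tensorSub_inf_ker_right (sub_mem y.2.1 (baseChange_mem r hz₀)) ?_
    rw [map_sub, sub_eq_zero]
    refine (congrArg Subtype.val hxy).symm.trans ?_
    change LinearMap.lTensor V s.toLinearMap x'.1 = _
    rw [← hqz]
    exact hcomp V z₀
  -- A lift z₀ of x' to D may miss y. The error has coefficients in ker t, which r hits from ker q,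
  -- so it can be corrected without disturbing the image in A.
  have hle : B.maxIdeal ⊓ LinearMap.ker t.toLinearMap ≤
      (D.maxIdeal ⊓ LinearMap.ker q.toLinearMap).map r.toLinearMap := by
    rintro b ⟨-, hb⟩
    obtain ⟨z, hz1, rfl⟩ := ht b hb
    exact ⟨z, ⟨ArtAlg.mem_maxIdeal_of_map q (by rw [hz1]; exact zero_mem _), hz1⟩, rfl⟩
  obtain ⟨w, hwm, hrw⟩ := exists_of_mem_tensorSub_map_right (tensorSub_mono le_rfl hle hw)
  have hqw : LinearMap.lTensor V q.toLinearMap w = 0 := by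
    have := lTensor_mem_tensorSub (N' := (⊥ : Submodule ℂ A.carrier)) (f := q.toLinearMap)
      (fun c hc => (Submodule.mem_inf.1 hc).2) hwm
    rwa [tensorSub_bot] at this
  have hqz' : LinearMap.lTensor V q.toLinearMap (z₀ + w) = x'.1 := by
    rw [map_add, hqw, add_zero]; exact hqz
  have hrz' : LinearMap.lTensor V r.toLinearMap (z₀ + w) = y.1 := by
    rw [map_add, hrw]; exact add_sub_cancel _ _
  have hzm : z₀ + w ∈ tensorMax 𝒱 1 D := add_mem hz₀ (tensorSub_mono le_rfl inf_le_left hwm)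
  have hcurv : L.curvature D (z₀ + w) = 0 := by
    refine eq_zero_of_lTensor_eq_zero (f := q.toLinearMap) (g := r.toLinearMap) hz ?_ ?_
    · refine (L.baseChange_curvature q _).trans ?_
      rw [show baseChange V q (z₀ + w) = x'.1 from hqz']
      exact x'.2.2
    · refine (L.baseChange_curvature r _).trans ?_
      rw [show baseChange V r (z₀ + w) = y.1 from hrz']
      exact y.2.2
  refine ⟨⟨z₀ + w, hzm, hcurv⟩, ?_⟩
  rw [← sub_eq_zero]
  refine eq_zero_of_lTensor_eq_zero (f := q.toLinearMap) (g := r.toLinearMap) hz ?_ ?_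
  · rw [map_sub, sub_eq_zero, lTensor_potential_map, ← hx, ← hx']
    exact congrArg (potential A.carrier ψ) hqz'
  · rw [map_sub, sub_eq_zero, lTensor_potential_map, ← hy]
    exact congrArg (potential B.carrier ψ) hrz'

/-- Descent of potentials to a subalgebra `ℂ + I`, where `I` is an ideal of `B`. -/
theorem isPotential_of_injective_of_ideal (hψ : ∀ z, ψ (L.codiffFull z) = 0)
    (hinj : ∀ v ∈ L.cocycles 1, ψ (GSym.ι _ v) = 0 → v ∈ (𝒱 0).map L.d) (h1 : ψ 1 = 0)
    {j : A.carrier →ₐ[ℂ] B.carrier} (hj : Function.Injective j) (I : Ideal B.carrier)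
    (hI : ∀ b, b ∈ I ↔ ∃ a ∈ A.maxIdeal, j a = b) {u : U ⊗[ℂ] A.carrier}
    (hu : u ∈ tensorSub ⊤ A.maxIdeal)
    (h : L.IsPotential ψ B (LinearMap.lTensor U j.toLinearMap u)) : L.IsPotential ψ A u := by
  have hI1 : I ≠ ⊤ := by
    intro hI1
    obtain ⟨a, ha, hja⟩ := (hI 1).1 (hI1 ▸ Submodule.mem_top)
    have : a = 1 := hj (by rw [hja, map_one])
    rw [this] at ha
    exact (mem_maximalIdeal _).1 ha isUnit_one
  obtain ⟨x, hx⟩ := h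
  -- Since u has coefficients in m_A, it dies over B/I, so x and 0 have the same potential there. A
  -- gauge move over B then makes x vanish modulo I, and its coefficients lie in I = j(m_A).
  have hy0 : LinearMap.lTensor U (B.quotMap I hI1).toLinearMap
      (LinearMap.lTensor U j.toLinearMap u) = 0 := by
    have := lTensor_mem_tensorSub (N' := (⊥ : Submodule ℂ (B.quot I hI1).carrier))
      (f := (B.quotMap I hI1).toLinearMap ∘ₗ j.toLinearMap)
      (fun c hc => (B.quotMap_eq_zero I hI1 _).2 ((hI _).2 ⟨c, hc, rfl⟩)) hu
    rwa [tensorSub_bot, LinearMap.lTensor_comp, Submodule.mem_bot] at this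
  let y₀ : L.MC (B.quot I hI1) := ⟨0, zero_mem _, by simp [curvature]⟩
  have hy₀ : potential _ ψ y₀.1 = 0 := potential_zero h1 _
  obtain ⟨x', hx', hxy⟩ := L.exists_lift_of_potential_eq hψ hinj (B.quotMap_surjective I hI1) x y₀
    (by rw [hx, hy0, hy₀])
  have hx1 := mem_tensorSub_inf_ker_right (f := (B.quotMap I hI1).toLinearMap) x'.2.1
    (congrArg Subtype.val hxy)
  have hle : B.maxIdeal ⊓ LinearMap.ker (B.quotMap I hI1).toLinearMap ≤
      A.maxIdeal.map j.toLinearMap := fun b hb =>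
    (hI b).1 ((B.quotMap_eq_zero I hI1 b).1 hb.2)
  obtain ⟨z, hzm, hz⟩ := exists_of_mem_tensorSub_map_right (tensorSub_mono le_rfl hle hx1)
  have hj' : ∀ z, j z = 0 → j z = 0 → z = 0 := fun z h _ => hj (h.trans (map_zero j).symm)
  have hcurv : L.curvature A z = 0 := by
    have : LinearMap.lTensor V j.toLinearMap (L.curvature A z) = 0 := by
      refine (L.baseChange_curvature j _).trans ?_
      rw [show baseChange V j z = x'.1 from hz]
      exact x'.2.2
    exact eq_zero_of_lTensor_eq_zero (f := j.toLinearMap) (g := j.toLinearMap) hj' this this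
  refine ⟨⟨z, hzm, hcurv⟩, ?_⟩
  rw [← sub_eq_zero]
  have : LinearMap.lTensor U j.toLinearMap
      (potential A.carrier ψ (⟨z, hzm, hcurv⟩ : L.MC A).1 - u) = 0 := by
    rw [map_sub, sub_eq_zero, lTensor_potential_map, ← hx, ← hx']
    exact congrArg (potential B.carrier ψ) hz
  exact eq_zero_of_lTensor_eq_zero (f := j.toLinearMap) (g := j.toLinearMap) hj' this this

end DGLA

/-! ### Descent along injections through the subalgebras j(A) + m_B^k. -/

namespace ArtAlg

open IsLocalRing

variable {A B : ArtAlg}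

/-- The subalgebra `j(A) + m_B^k` of `B`. -/
def rangeAddPow (j : A.carrier →ₐ[ℂ] B.carrier) (k : ℕ) : Subalgebra ℂ B.carrier where
  carrier := {b | ∃ a, b - j a ∈ maximalIdeal B.carrier ^ k}
  mul_mem' := by
    rintro b b' ⟨a, ha⟩ ⟨a', ha'⟩
    refine ⟨a * a', ?_⟩
    rw [map_mul, show b * b' - j a * j a' = (b - j a) * b' + j a * (b' - j a') by ring]
    exact add_mem (Ideal.mul_mem_right _ _ ha) (Ideal.mul_mem_left _ _ ha')
  add_mem' := by
    rintro b b' ⟨a, ha⟩ ⟨a', ha'⟩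
    refine ⟨a + a', ?_⟩
    rw [map_add, add_sub_add_comm]
    exact add_mem ha ha'
  algebraMap_mem' c := ⟨algebraMap ℂ _ c, by simp⟩

theorem rangeAddPow_succ_le (j : A.carrier →ₐ[ℂ] B.carrier) (k : ℕ) :
    rangeAddPow j (k + 1) ≤ rangeAddPow j k := by
  rintro b ⟨a, ha⟩
  exact ⟨a, Ideal.pow_le_pow_right k.le_succ ha⟩

/-- The maximal ideal of `j(A) + m_B^(k+1)` as an ideal of `j(A) + m_B^k`. -/
def rangeAddPowIdeal (j : A.carrier →ₐ[ℂ] B.carrier) (k : ℕ) :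
    Ideal (B.sub (rangeAddPow j k)).carrier where
  carrier := {s | (rangeAddPow j k).val s ∈ B.maxIdeal ∧
    (rangeAddPow j k).val s ∈ rangeAddPow j (k + 1)}
  zero_mem' := ⟨zero_mem B.maxIdeal, zero_mem (rangeAddPow j (k + 1))⟩
  add_mem' := by
    rintro s s' ⟨h1, h2⟩ ⟨h1', h2'⟩
    exact ⟨add_mem (S := Submodule ℂ B.carrier) h1 h1', add_mem (S := Subalgebra ℂ B.carrier) h2 h2'⟩
  smul_mem' := by
    rintro ⟨c, b, hb⟩ ⟨s, hs⟩ ⟨h1, b', hb'⟩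
    refine ⟨Ideal.mul_mem_left (maximalIdeal B.carrier) c h1, b * b', ?_⟩
    change c * s - j (b * b') ∈ _
    change s - j b' ∈ _ at hb'
    -- The first summand lies in m_B^k · m_B because s is in m_B. This gain of one power is what
    -- makes the set an ideal of the larger algebra.
    rw [map_mul, show c * s - j b * j b' = (c - j b) * s + j b * (s - j b') by ring]
    refine add_mem ?_ (Ideal.mul_mem_left _ _ hb')
    rw [pow_succ]
    exact Ideal.mul_mem_mul hb h1

end ArtAlg

namespace DGLA

open IsLocalRing ArtAlg

variable {V : Type*} [AddCommGroup V] [Module ℂ V] {𝒱 : ℤ → Submodule ℂ V} (L : DGLA 𝒱)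
  {U : Type*} [AddCommGroup U] [Module ℂ U] {ψ : GSym (gradedShift 𝒱 1) →ₗ[ℂ] U}
  [DirectSum.Decomposition 𝒱] {A B : ArtAlg}

/-- Descent of potentials to subalgebras. -/
theorem isPotential_of_injective (hψ : ∀ z, ψ (L.codiffFull z) = 0)
    (hinj : ∀ v ∈ L.cocycles 1, ψ (GSym.ι _ v) = 0 → v ∈ (𝒱 0).map L.d) (h1 : ψ 1 = 0)
    {j : A.carrier →ₐ[ℂ] B.carrier} (hj : Function.Injective j) {u : U ⊗[ℂ] A.carrier}
    (hu : u ∈ tensorSub ⊤ A.maxIdeal)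
    (h : L.IsPotential ψ B (LinearMap.lTensor U j.toLinearMap u)) : L.IsPotential ψ A u := by
  let jk : ∀ k, A.carrier →ₐ[ℂ] (B.sub (rangeAddPow j k)).carrier := fun k =>
    j.codRestrict (rangeAddPow j k) fun a => ⟨a, by simp⟩
  -- The descent starts from all of B at k = 0 and reaches j(A) once m_B^k = 0. Each step is of the
  -- form already treated, the smaller maximal ideal being an ideal of the larger algebra.
  have key : ∀ k, L.IsPotential ψ (B.sub (rangeAddPow j k))
      (LinearMap.lTensor U (jk k).toLinearMap u) := by
    intro k
    induction k with
    | zero =>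
      let g : B.carrier →ₐ[ℂ] (B.sub (rangeAddPow j 0)).carrier :=
        (AlgHom.id ℂ B.carrier).codRestrict (rangeAddPow j 0) fun b => ⟨0, by simp⟩
      have := IsPotential.map L h g
      rwa [← LinearMap.comp_apply, ← LinearMap.lTensor_comp] at this
    | succ k ih =>
      let i : (B.sub (rangeAddPow j (k + 1))).carrier →ₐ[ℂ] (B.sub (rangeAddPow j k)).carrier :=
        Subalgebra.inclusion (rangeAddPow_succ_le j k)
      refine L.isPotential_of_injective_of_ideal hψ hinj h1 (j := i)
        (Subalgebra.inclusion_injective _) (rangeAddPowIdeal j k) ?_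
        (lTensor_mem_tensorSub (fun c hc => map_mem (jk (k + 1)) hc) hu) ?_
      · intro b
        constructor
        · rintro ⟨hb1, hb2⟩
          exact ⟨⟨_, hb2⟩, sub_mem_maxIdeal.2 hb1, rfl⟩
        · rintro ⟨a, ha, rfl⟩
          exact ⟨sub_mem_maxIdeal.1 (map_mem i ha), a.2⟩
      · rw [← LinearMap.comp_apply, ← LinearMap.lTensor_comp]
        exact ih
  obtain ⟨N, hN⟩ := B.maximalIdeal_nilpotent
  have hb : Function.Bijective (jk N) := by
    constructor
    · intro a a' haa
      exact hj (congrArg Subtype.val haa)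
    · rintro ⟨b, a, ha⟩
      rw [hN, Ideal.mem_bot, sub_eq_zero] at ha
      exact ⟨a, Subtype.ext ha.symm⟩
  have h2 := IsPotential.map L (key N) (AlgEquiv.ofBijective (jk N) hb).symm.toAlgHom
  rw [← LinearMap.comp_apply, ← LinearMap.lTensor_comp] at h2
  have h3 : (AlgEquiv.ofBijective (jk N) hb).symm.toAlgHom.toLinearMap ∘ₗ (jk N).toLinearMap =
      LinearMap.id := LinearMap.ext fun a => (AlgEquiv.ofBijective (jk N) hb).symm_apply_apply a
  rwa [h3, LinearMap.lTensor_id] at h2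

end DGLA

/-! ### Subfunctors of prorepresentable functors -/

section Subfunctor

open IsLocalRing

/-- Quotients of complete local Noetherian rings are complete. -/
theorem isAdicComplete_quotient {P : Type*} [CommRing P] [IsLocalRing P] [IsNoetherianRing P]
    [IsPrecomplete (maximalIdeal P) P] (I : Ideal P)
    [IsLocalRing (P ⧸ I)] : IsAdicComplete (maximalIdeal (P ⧸ I)) (P ⧸ I) := by
  have hm : (maximalIdeal P).map (algebraMap P (P ⧸ I)) = maximalIdeal (P ⧸ I) := by
    have hl : IsLocalHom (Ideal.Quotient.mk I) :=
      IsLocalHom.of_surjective _ Ideal.Quotient.mk_surjective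
    refine le_antisymm (((local_hom_TFAE (Ideal.Quotient.mk I)).out 0 2).1 hl) fun y hy => ?_
    obtain ⟨x, rfl⟩ := Ideal.Quotient.mk_surjective y
    refine Ideal.mem_map_of_mem _ ((mem_maximalIdeal _).2 fun hu => ?_)
    exact (mem_maximalIdeal _).1 hy (hu.map _)
  have h1 : IsPrecomplete (maximalIdeal P) (P ⧸ I) := by
    rw [← AdicCompletion.of_surjective_iff]
    intro y
    obtain ⟨z, rfl⟩ := AdicCompletion.map_surjective (maximalIdeal P)
      (f := Submodule.mkQ I) (Submodule.mkQ_surjective I) y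
    obtain ⟨x, rfl⟩ := AdicCompletion.of_surjective (maximalIdeal P) P z
    exact ⟨Submodule.mkQ I x, (AdicCompletion.map_of _ _ _).symm⟩
  have h2 : IsPrecomplete (maximalIdeal (P ⧸ I)) (P ⧸ I) := by
    rw [← hm]
    exact IsPrecomplete.map_algebraMap_iff.2 h1
  exact { toIsHausdorff := inferInstance, toIsPrecomplete := h2 }

/-- A closed ideal cut out by a decreasing sequence of open ideals. -/
theorem le_iInf_sup_pow {P : Type*} [CommRing P] [IsLocalRing P]
    [IsPrecomplete (maximalIdeal P) P] {J : ℕ → Ideal P}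
    (hJ : ∀ k, maximalIdeal P ^ (k + 1) ≤ J k) (hanti : ∀ k, J (k + 1) ≤ J k)
    (hsup : ∀ k, J k ≤ J (k + 1) ⊔ maximalIdeal P ^ (k + 1)) (N : ℕ) :
    J N ≤ (⨅ k, J k) ⊔ maximalIdeal P ^ (N + 1) := by
  intro x hx
  have hA : Antitone J := antitone_nat_of_succ_le hanti
  -- Successive approximation: x in J N is moved into J (N+1), J (N+2), ... by ever smaller
  -- corrections. The limit lies in every J k because each J k contains a power of the maximal
  -- ideal.
  have step : ∀ (k : ℕ) (y : J k), ∃ z : J (k + 1), (y : P) - z ∈ maximalIdeal P ^ (k + 1) := by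
    intro k y
    obtain ⟨z, hz, w, hw, h⟩ := Submodule.mem_sup.1 (hsup k y.2)
    exact ⟨⟨z, hz⟩, by rw [← h]; simpa using hw⟩
  choose g hg using step
  let s : ∀ n, J (N + n) := fun n =>
    Nat.rec (motive := fun n => J (N + n)) ⟨x, hx⟩ (fun n y => g (N + n) y) n
  have hs : ∀ n, (s n).1 - (s (n + 1)).1 ∈ maximalIdeal P ^ (N + n + 1) := fun n => hg (N + n) (s n)
  have hs2 : ∀ m n, m ≤ n → (s m).1 - (s n).1 ∈ maximalIdeal P ^ (N + m + 1) := by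
    intro m n hmn
    induction n, hmn using Nat.le_induction with
    | base => simp
    | succ n hmn ih =>
      have := add_mem ih (Ideal.pow_le_pow_right (by lia) (hs n))
      rwa [sub_add_sub_cancel] at this
  obtain ⟨y, hy⟩ := IsPrecomplete.prec (I := maximalIdeal P) ‹_› (f := fun n => (s n).1) (by
    intro m n hmn
    rw [SModEq.sub_mem, smul_eq_mul, Ideal.mul_top]
    exact Ideal.pow_le_pow_right (by lia) (hs2 m n hmn))
  have hy' : ∀ n, (s n).1 - y ∈ maximalIdeal P ^ n := by
    intro n
    have := hy n
    rwa [SModEq.sub_mem, smul_eq_mul, Ideal.mul_top] at this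
  refine Submodule.mem_sup.2 ⟨y, ?_, x - y, ?_, by abel⟩
  · rw [Submodule.mem_iInf]
    intro k
    have h1 : (s (k + 1)).1 ∈ J k := hA (by lia) (s (k + 1)).2
    have := sub_mem h1 (hJ k (hy' (k + 1)))
    rwa [sub_sub_cancel] at this
  · have h1 : x - (s (N + 1)).1 ∈ maximalIdeal P ^ (N + 1) :=
      Ideal.pow_le_pow_right (by lia) (hs2 0 (N + 1) (by lia))
    have := add_mem h1 (hy' (N + 1))
    rwa [sub_add_sub_cancel] at this

variable {P : Type} [CommRing P] [Algebra ℂ P] [IsLocalRing P]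

theorem exists_sub_algebraMap_mem (hres : Function.Bijective (algebraMap ℂ (ResidueField P)))
    (x : P) : ∃ c : ℂ, x - algebraMap ℂ P c ∈ maximalIdeal P := by
  obtain ⟨c, hc⟩ := hres.2 (residue P x)
  refine ⟨c, ?_⟩
  rw [← residue_eq_zero_iff, map_sub, sub_eq_zero, ← hc]
  rfl

/-- If f(x) had nonzero residue c, then x - c would be a unit of P with image in the maximal ideal.
-/
theorem algHom_mem_maximalIdeal {A : ArtAlg} (f : P →ₐ[ℂ] A.carrier) {x : P} (hx : x ∈ maximalIdeal P) :
    f x ∈ maximalIdeal A.carrier := by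
  obtain ⟨c, hc⟩ := A.exists_sub_mem (f x)
  by_cases h0 : c = 0
  · simpa [h0] using hc
  · exfalso
    have hu : IsUnit (x - algebraMap ℂ P c) := by
      by_contra hu
      have h1 : algebraMap ℂ P c ∈ maximalIdeal P := by
        have := sub_mem hx ((mem_maximalIdeal _).2 hu)
        rwa [sub_sub_cancel] at this
      exact (mem_maximalIdeal _).1 h1 ((IsUnit.mk0 c h0).map _)
    refine (mem_maximalIdeal _).1 hc ?_
    have := hu.map f
    rwa [map_sub, AlgHom.commutes] at this

theorem exists_pow_le_ker {A : ArtAlg} (f : P →ₐ[ℂ] A.carrier) : ∃ k, maximalIdeal P ^ k ≤ RingHom.ker f := by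
  obtain ⟨k, hk⟩ := A.maximalIdeal_nilpotent
  refine ⟨k, ?_⟩
  have h : (maximalIdeal P).map f ≤ maximalIdeal A.carrier :=
    Ideal.map_le_iff_le_comap.2 fun x hx => algHom_mem_maximalIdeal f hx
  intro x hx
  have h1 := Ideal.mem_map_of_mem f hx
  rw [Ideal.map_pow] at h1
  have h2 := Ideal.pow_right_mono h k h1
  rw [hk] at h2
  exact h2

variable [IsNoetherianRing P]

theorem finite_quotient (hres : Function.Bijective (algebraMap ℂ (ResidueField P))) {I : Ideal P}
    (hI : I ≠ ⊤) (h : ∃ k, maximalIdeal P ^ k ≤ I) : Module.Finite ℂ (P ⧸ I) := by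
  have : Module.Finite ℂ (P ⧸ maximalIdeal P) :=
    Module.Finite.of_surjective (Algebra.linearMap ℂ (ResidueField P)) hres.2
  refine Module.finite_of_surjective_of_ker_le_nilradical
    (Ideal.Quotient.factorₐ ℂ (le_maximalIdeal hI))
    (Ideal.Quotient.factor_surjective (le_maximalIdeal hI)) ?_ (IsNoetherian.noetherian _)
  intro x hx
  obtain ⟨x, rfl⟩ := Ideal.Quotient.mk_surjective x
  obtain ⟨k, hk⟩ := h
  refine ⟨k, ?_⟩
  change Ideal.Quotient.mk I x ^ k = 0
  rw [← map_pow, Ideal.Quotient.eq_zero_iff_mem]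
  refine hk (Ideal.pow_mem_pow ?_ k)
  exact Ideal.Quotient.eq_zero_iff_mem.1 hx

/-- The quotient of a local Noetherian algebra by a proper open ideal. -/
def artQuot (hres : Function.Bijective (algebraMap ℂ (ResidueField P))) (I : Ideal P)
    (hI : I ≠ ⊤) (h : ∃ k, maximalIdeal P ^ k ≤ I) : ArtAlg :=
  haveI : Nontrivial (P ⧸ I) := Ideal.Quotient.nontrivial_iff.2 hI
  haveI := finite_quotient hres hI h
  ArtAlg.ofFinite (P ⧸ I) fun x => by
    obtain ⟨x, rfl⟩ := Ideal.Quotient.mk_surjective x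
    obtain ⟨c, hc⟩ := exists_sub_algebraMap_mem hres x
    obtain ⟨k, hk⟩ := h
    refine ⟨c, k, ?_⟩
    rw [show Ideal.Quotient.mk I x - algebraMap ℂ (P ⧸ I) c =
      Ideal.Quotient.mk I (x - algebraMap ℂ P c) from (map_sub _ _ _).symm, ← map_pow,
      Ideal.Quotient.eq_zero_iff_mem]
    exact hk (Ideal.pow_mem_pow hc k)

/-- The projection onto a quotient. -/
def artQuotMk (hres : Function.Bijective (algebraMap ℂ (ResidueField P))) (I : Ideal P)
    (hI : I ≠ ⊤) (h : ∃ k, maximalIdeal P ^ k ≤ I) : P →ₐ[ℂ] (artQuot hres I hI h).carrier :=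
  Ideal.Quotient.mkₐ ℂ I

/-- The map between quotients. -/
def artQuotFactor (hres : Function.Bijective (algebraMap ℂ (ResidueField P))) {I J : Ideal P}
    (hI : I ≠ ⊤) (h : ∃ k, maximalIdeal P ^ k ≤ I) (hJ : J ≠ ⊤) (h' : ∃ k, maximalIdeal P ^ k ≤ J)
    (hIJ : I ≤ J) : (artQuot hres I hI h).carrier →ₐ[ℂ] (artQuot hres J hJ h').carrier :=
  Ideal.Quotient.factorₐ ℂ hIJ

/-- A subfunctor of `Hom(P, -)` which is compatible with fibre products and with injective
homomorphisms is defined by an ideal. -/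
theorem exists_ideal_of_subfunctor [IsPrecomplete (maximalIdeal P) P]
    (hres : Function.Bijective (algebraMap ℂ (ResidueField P)))
    (F : ∀ A : ArtAlg, (P →ₐ[ℂ] A.carrier) → Prop)
    (hmap : ∀ (A B : ArtAlg) (f : P →ₐ[ℂ] A.carrier) (g : A.carrier →ₐ[ℂ] B.carrier),
      F A f → F B (g.comp f))
    (hinj : ∀ (A B : ArtAlg) (f : P →ₐ[ℂ] A.carrier) (g : A.carrier →ₐ[ℂ] B.carrier),
      Function.Injective g → F B (g.comp f) → F A f)
    (htriv : ∀ (A : ArtAlg) (f : P →ₐ[ℂ] A.carrier), maximalIdeal P ≤ RingHom.ker f → F A f)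
    (hfib : ∀ (A B C D : ArtAlg) (q : D.carrier →ₐ[ℂ] A.carrier) (r : D.carrier →ₐ[ℂ] B.carrier)
      (s : A.carrier →ₐ[ℂ] C.carrier) (t : B.carrier →ₐ[ℂ] C.carrier) (f : P →ₐ[ℂ] D.carrier),
      Function.Surjective q → Function.Surjective s → s.comp q = t.comp r →
      (∀ z, q z = 0 → r z = 0 → z = 0) → (∀ b, t b = 0 → ∃ z, q z = 0 ∧ r z = b) →
      F A (q.comp f) → F B (r.comp f) → F D f) :
    ∃ I : Ideal P, I ≠ ⊤ ∧ ∀ (A : ArtAlg) (f : P →ₐ[ℂ] A.carrier), F A f ↔ I ≤ RingHom.ker f := by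
  -- Whether f belongs to F depends only on its kernel, as f factors into a projection followed by
  -- an injection. The subfunctor is thereby encoded by a family of open ideals.
  let good : Ideal P → Prop := fun I => ∃ (hI : I ≠ ⊤) (h : ∃ k, maximalIdeal P ^ k ≤ I),
    F (artQuot hres I hI h) (artQuotMk hres I hI h)
  have good_ker : ∀ (A : ArtAlg) (f : P →ₐ[ℂ] A.carrier), F A f ↔ good (RingHom.ker f) := by
    intro A f
    have hcomp : ∀ (hI : RingHom.ker f ≠ ⊤) (h : ∃ k, maximalIdeal P ^ k ≤ RingHom.ker f),
        (show (artQuot hres (RingHom.ker f) hI h).carrier →ₐ[ℂ] A.carrier from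
          Ideal.kerLiftAlg f).comp (artQuotMk hres (RingHom.ker f) hI h) = f :=
      fun hI h => AlgHom.ext fun x => rfl
    constructor
    · intro hf
      refine ⟨RingHom.ker_ne_top f, exists_pow_le_ker f, ?_⟩
      exact hinj _ A _ (Ideal.kerLiftAlg f) (Ideal.kerLiftAlg_injective f)
        (by rw [hcomp]; exact hf)
    · rintro ⟨hI, h, hf⟩
      rw [← hcomp hI h]
      exact hmap _ _ _ _ hf
  have good_mono : ∀ I J : Ideal P, good I → I ≤ J → J ≠ ⊤ → good J := by
    rintro I J ⟨hI, ⟨k, hk⟩, hF⟩ hIJ hJ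
    exact ⟨hJ, ⟨k, hk.trans hIJ⟩,
      hmap _ _ _ (artQuotFactor hres hI ⟨k, hk⟩ hJ ⟨k, hk.trans hIJ⟩ hIJ) hF⟩
  have good_inf : ∀ I J : Ideal P, good I → good J → good (I ⊓ J) := by
    rintro I J ⟨hI, ⟨k, hk⟩, hF⟩ ⟨hJ, ⟨l, hl⟩, hF'⟩
    have hne : I ⊓ J ≠ ⊤ := fun h => hI (top_le_iff.1 (h.symm.le.trans inf_le_left))
    have hle : maximalIdeal P ^ (k + l) ≤ I ⊓ J :=
      le_inf ((Ideal.pow_le_pow_right (by lia)).trans hk)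
        ((Ideal.pow_le_pow_right (by lia)).trans hl)
    have hsup : I ⊔ J ≠ ⊤ := fun h => (maximalIdeal.isMaximal P).ne_top
      (top_le_iff.1 (h.symm.le.trans (sup_le (le_maximalIdeal hI) (le_maximalIdeal hJ))))
    have hs : ∃ k, maximalIdeal P ^ k ≤ I ⊔ J := ⟨k, hk.trans le_sup_left⟩
    -- P/(I ∩ J) is the fibre product of P/I and P/J over P/(I + J).
    refine ⟨hne, ⟨_, hle⟩, hfib _ _ _ _
      (artQuotFactor hres hne ⟨_, hle⟩ hI ⟨k, hk⟩ inf_le_left)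
      (artQuotFactor hres hne ⟨_, hle⟩ hJ ⟨l, hl⟩ inf_le_right)
      (artQuotFactor hres hI ⟨k, hk⟩ hsup hs le_sup_left)
      (artQuotFactor hres hJ ⟨l, hl⟩ hsup hs le_sup_right) _
      (Ideal.Quotient.factor_surjective inf_le_left)
      (Ideal.Quotient.factor_surjective le_sup_left) ?_ ?_ ?_ hF hF'⟩
    · refine AlgHom.ext fun x => ?_
      obtain ⟨x, rfl⟩ := Ideal.Quotient.mk_surjective x
      rfl
    · intro z h1 h2
      obtain ⟨x, rfl⟩ := Ideal.Quotient.mk_surjective z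
      exact Ideal.Quotient.eq_zero_iff_mem.2
        ⟨Ideal.Quotient.eq_zero_iff_mem.1 h1, Ideal.Quotient.eq_zero_iff_mem.1 h2⟩
    · intro b hb
      obtain ⟨x, rfl⟩ := Ideal.Quotient.mk_surjective b
      obtain ⟨y, hy, w, hw, rfl⟩ := Submodule.mem_sup.1 (Ideal.Quotient.eq_zero_iff_mem.1 hb)
      refine ⟨Ideal.Quotient.mk _ y, Ideal.Quotient.eq_zero_iff_mem.2 hy, ?_⟩
      refine Ideal.Quotient.eq.2 ?_
      rw [sub_add_cancel_left]
      exact neg_mem hw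
  have good_max : good (maximalIdeal P) := by
    refine ⟨(maximalIdeal.isMaximal P).ne_top, ⟨1, by rw [pow_one]⟩, htriv _ _ fun x hx => ?_⟩
    exact Ideal.Quotient.eq_zero_iff_mem.2 hx
  -- P/m^(k+1) is Artinian, so a minimal good ideal containing m^(k+1) exists, and closure under
  -- intersection makes it least.
  have least : ∀ k : ℕ, ∃ J : Ideal P, (good J ∧ maximalIdeal P ^ (k + 1) ≤ J) ∧
      ∀ I, good I → maximalIdeal P ^ (k + 1) ≤ I → J ≤ I := by
    intro k
    have hne : maximalIdeal P ^ (k + 1) ≠ ⊤ := fun h => (maximalIdeal.isMaximal P).ne_top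
      (top_le_iff.1 (h.symm.le.trans (Ideal.pow_le_self k.succ_ne_zero)))
    have := finite_quotient hres hne ⟨k + 1, le_rfl⟩
    have : IsArtinianRing (P ⧸ maximalIdeal P ^ (k + 1)) := IsArtinianRing.of_finite ℂ _
    let π := Ideal.Quotient.mk (maximalIdeal P ^ (k + 1))
    have hπ : ∀ I, maximalIdeal P ^ (k + 1) ≤ I → (I.map π).comap π = I := by
      intro I hI
      rw [Ideal.comap_map_of_surjective π Ideal.Quotient.mk_surjective, ← RingHom.ker_eq_comap_bot,
        Ideal.mk_ker, sup_eq_left]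
      exact hI
    let S : Set (Ideal (P ⧸ maximalIdeal P ^ (k + 1))) :=
      {K | ∃ I, good I ∧ maximalIdeal P ^ (k + 1) ≤ I ∧ I.map π = K}
    obtain ⟨K, ⟨J, hJ, hkJ, rfl⟩, hmin⟩ := WellFounded.has_min
      (wellFounded_lt (α := Ideal (P ⧸ maximalIdeal P ^ (k + 1)))) S
      ⟨_, maximalIdeal P, good_max, Ideal.pow_le_self k.succ_ne_zero, rfl⟩
    refine ⟨J, ⟨hJ, hkJ⟩, fun I hI hkI => ?_⟩
    have h1 := hmin ((J ⊓ I).map π) ⟨_, good_inf J I hJ hI, le_inf hkJ hkI, rfl⟩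
    have h2 : (J ⊓ I).map π = J.map π :=
      eq_of_le_of_not_lt (Ideal.map_mono inf_le_left) h1
    have h3 := congrArg (Ideal.comap π) h2
    rw [hπ _ (le_inf hkJ hkI), hπ _ hkJ] at h3
    exact inf_eq_left.1 h3
  choose J hJ hleast using least
  have hanti : ∀ k, J (k + 1) ≤ J k := fun k =>
    hleast _ _ (hJ k).1 ((Ideal.pow_le_pow_right (by lia)).trans (hJ k).2)
  have hsup : ∀ k, J k ≤ J (k + 1) ⊔ maximalIdeal P ^ (k + 1) := fun k =>
    hleast _ _ (good_mono _ _ (hJ (k + 1)).1 le_sup_left fun h => (hJ k).1.1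
      (top_le_iff.1 (h.symm.le.trans (sup_le (hanti k) (hJ k).2)))) le_sup_right
  refine ⟨⨅ k, J k, fun h => (hJ 0).1.1 (top_le_iff.1 (h.symm.le.trans (iInf_le _ 0))),
    fun A f => ?_⟩
  obtain ⟨N, hN⟩ := exists_pow_le_ker f
  have hN' : maximalIdeal P ^ (N + 1) ≤ RingHom.ker f := (Ideal.pow_le_pow_right (by lia)).trans hN
  rw [good_ker]
  constructor
  · exact fun h => (iInf_le _ N).trans (hleast N _ h hN')
  · intro h
    refine good_mono (J N) _ (hJ N).1 ?_ (RingHom.ker_ne_top f)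
    -- Completeness enters here: modulo m^(N+1), the intersection of all J k is as large as J N.
    exact (le_iInf_sup_pow (fun k => (hJ k).2) hanti hsup N).trans (sup_le h hN')

end Subfunctor

/-! ### Formal power series -/

namespace MvPowerSeries

open IsLocalRing

variable {n : ℕ}

theorem map_idealOfVars (R : Type*) [CommRing R] : (MvPolynomial.idealOfVars (Fin n) R).map
    (algebraMap (MvPolynomial (Fin n) R) (MvPowerSeries (Fin n) R)) =
      Ideal.span (Set.range X) := by
  rw [MvPolynomial.idealOfVars, Ideal.map_span, ← Set.range_comp]
  congr 2
  ext1 i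
  exact MvPolynomial.coe_X i

/-- The remainder has zero truncation. Under the identification of power series with the completion
of the polynomial ring, it lies in the kernel of evaluation at level N, which is the N-th power of
the ideal of variables times the completion. -/
theorem sub_truncTotal_mem (N : ℕ) (p : MvPowerSeries (Fin n) ℂ) :
    p - (truncTotal N p : MvPolynomial (Fin n) ℂ) ∈
      (Ideal.span (Set.range X) : Ideal (MvPowerSeries (Fin n) ℂ)) ^ N := by
  set q : MvPowerSeries (Fin n) ℂ := p - (truncTotal N p : MvPolynomial (Fin n) ℂ) with hq
  have h0 : truncTotal N q = 0 := by
    ext x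
    by_cases hx : Finsupp.degree x < N
    · rw [coeff_truncTotal _ hx, hq, map_sub, MvPolynomial.coeff_coe, coeff_truncTotal _ hx]
      simp
    · rw [coeff_truncTotal_eq_zero _ (not_lt.1 hx)]
      simp
  let e := toAdicCompletionAlgEquiv (Fin n) ℂ
  have h1 : e q ∈ (MvPolynomial.idealOfVars (Fin n) ℂ ^ N • ⊤ :
      Submodule (MvPolynomial (Fin n) ℂ) (AdicCompletion (MvPolynomial.idealOfVars (Fin n) ℂ)
        (MvPolynomial (Fin n) ℂ))) := by
    rw [AdicCompletion.pow_smul_top_eq_ker_eval (MvPolynomial.idealOfVars_fg (Fin n) ℂ),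
      LinearMap.mem_ker, AdicCompletion.eval_apply]
    have h2 : (toAdicCompletion (Fin n) ℂ q).val N = truncTotal N q :=
      toAdicCompletion_apply_eq_mk_truncTotal
    rw [h0] at h2
    exact h2.trans (map_zero _)
  have h2 := Submodule.mem_map_of_mem (f := e.symm.toLinearMap) h1
  rw [Submodule.map_smul''] at h2
  have h3 : q ∈ (MvPolynomial.idealOfVars (Fin n) ℂ ^ N • ⊤ :
      Submodule (MvPolynomial (Fin n) ℂ) (MvPowerSeries (Fin n) ℂ)) := by
    rw [AlgEquiv.toLinearMap_apply, e.symm_apply_apply] at h2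
    exact Submodule.smul_mono le_rfl le_top h2
  rw [Ideal.smul_top_eq_map, Ideal.map_pow, map_idealOfVars] at h3
  exact h3

theorem maximalIdeal_eq_span :
    maximalIdeal (MvPowerSeries (Fin n) ℂ) = Ideal.span (Set.range X) := by
  refine le_antisymm (fun x hx => ?_) (Ideal.span_le.2 ?_)
  · have h0 : constantCoeff x = 0 := by
      by_contra h
      exact (mem_maximalIdeal _).1 hx (isUnit_iff_constantCoeff.2 (IsUnit.mk0 _ h))
    have h1 := sub_truncTotal_mem 1 x
    have h2 : truncTotal 1 x = 0 := by
      ext y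
      by_cases hy : Finsupp.degree y < 1
      · rw [coeff_truncTotal _ hy]
        have : y = 0 := (Finsupp.degree_eq_zero_iff y).1 (by lia)
        rw [this, coeff_zero_eq_constantCoeff_apply, h0]
        simp
      · rw [coeff_truncTotal_eq_zero _ (not_lt.1 hy)]
        simp
    rw [pow_one, h2] at h1
    simpa using h1
  · rintro _ ⟨i, rfl⟩
    refine (mem_maximalIdeal _).2 fun hu => ?_
    have := isUnit_iff_constantCoeff.1 hu
    simp at this

theorem residue_bijective :
    Function.Bijective (algebraMap ℂ (ResidueField (MvPowerSeries (Fin n) ℂ))) := by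
  refine ArtAlg.residue_bijective_of_surjective fun x => ⟨constantCoeff x, ?_⟩
  refine (mem_maximalIdeal _).2 fun hu => ?_
  have := isUnit_iff_constantCoeff.1 hu
  rw [map_sub, algebraMap_apply] at this
  simp at this

instance isPrecomplete_maximalIdeal :
    IsPrecomplete (maximalIdeal (MvPowerSeries (Fin n) ℂ)) (MvPowerSeries (Fin n) ℂ) := by
  rw [maximalIdeal_eq_span]
  infer_instance

/-- Both homomorphisms kill a power of the maximal ideal, so they are determined by their values on
polynomials. -/
theorem algHom_ext_of_X {A : ArtAlg} {f g : MvPowerSeries (Fin n) ℂ →ₐ[ℂ] A.carrier}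
    (h : ∀ i, f (X i) = g (X i)) : f = g := by
  obtain ⟨k, hk⟩ := exists_pow_le_ker f
  obtain ⟨l, hl⟩ := exists_pow_le_ker g
  have hp : ∀ p : MvPolynomial (Fin n) ℂ, f p = g p := by
    intro p
    have : f.comp (MvPolynomial.coeToMvPowerSeries.algHom ℂ) =
        g.comp (MvPolynomial.coeToMvPowerSeries.algHom ℂ) := by
      refine MvPolynomial.algHom_ext fun i => ?_
      simpa using h i
    simpa using AlgHom.congr_fun this p
  refine AlgHom.ext fun p => ?_
  have h1 := sub_truncTotal_mem (k + l) p
  rw [← maximalIdeal_eq_span] at h1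
  have h2 : f (p - (truncTotal (k + l) p : MvPolynomial (Fin n) ℂ)) = 0 :=
    hk (Ideal.pow_le_pow_right (by lia) h1)
  have h3 : g (p - (truncTotal (k + l) p : MvPolynomial (Fin n) ℂ)) = 0 :=
    hl (Ideal.pow_le_pow_right (by lia) h1)
  rw [map_sub, sub_eq_zero] at h2 h3
  rw [h2, h3, hp]

/-- Evaluation of polynomials at u kills the N-th power of the ideal of variables once m_A^N = 0, so
it factors through truncation of power series. -/
theorem exists_algHom_X {A : ArtAlg} (u : Fin n → A.carrier) (hu : ∀ i, u i ∈ A.maxIdeal) :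
    ∃ f : MvPowerSeries (Fin n) ℂ →ₐ[ℂ] A.carrier, ∀ i, f (X i) = u i := by
  obtain ⟨N, hN⟩ := A.maximalIdeal_nilpotent
  let φ : MvPolynomial (Fin n) ℂ →ₐ[ℂ] A.carrier := MvPolynomial.aeval u
  have h1 : (MvPolynomial.idealOfVars (Fin n) ℂ).map φ ≤ maximalIdeal A.carrier := by
    rw [MvPolynomial.idealOfVars, Ideal.map_span, Ideal.span_le]
    rintro _ ⟨_, ⟨i, rfl⟩, rfl⟩
    rw [show φ (MvPolynomial.X i) = u i from MvPolynomial.aeval_X u i]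
    exact hu i
  have h2 : ∀ p ∈ MvPolynomial.idealOfVars (Fin n) ℂ ^ N, φ p = 0 := by
    intro p hp
    have h3 := Ideal.mem_map_of_mem φ hp
    rw [Ideal.map_pow] at h3
    have h4 := Ideal.pow_right_mono h1 N h3
    rwa [hN] at h4
  let g : MvPowerSeries (Fin n) ℂ →ₐ[ℂ] A.carrier :=
    (Ideal.Quotient.liftₐ _ φ h2).comp ((truncTotalAlgHom (Fin n) ℂ N).restrictScalars ℂ)
  refine ⟨g, fun i => ?_⟩
  have h3 : truncTotalAlgHom (Fin n) ℂ N (X i) =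
      algebraMap (MvPolynomial (Fin n) ℂ) _ (MvPolynomial.X i) := by
    rw [← AlgHom.commutes (truncTotalAlgHom (Fin n) ℂ N) (MvPolynomial.X i)]
    congr 1
    exact (MvPolynomial.coe_X i).symm
  have h4 : g (X i) = Ideal.Quotient.liftₐ _ φ h2 (truncTotalAlgHom (Fin n) ℂ N (X i)) := rfl
  rw [h4, h3]
  exact MvPolynomial.aeval_X u i

end MvPowerSeries

/-! ### Prorepresentability -/

section Coordinates

open MvPowerSeries

variable {U : Type*} [AddCommGroup U] [Module ℂ U] {n : ℕ} (b : Module.Basis (Fin n) ℂ U)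

/-- The element of `U ⊗ A` with coordinates `f(X_i)`. -/
def homElement {A : ArtAlg} (f : MvPowerSeries (Fin n) ℂ →ₐ[ℂ] A.carrier) : U ⊗[ℂ] A.carrier :=
  ∑ i, b i ⊗ₜ f (X i)

theorem lTensor_homElement {A B : ArtAlg} (f : MvPowerSeries (Fin n) ℂ →ₐ[ℂ] A.carrier)
    (g : A.carrier →ₐ[ℂ] B.carrier) :
    LinearMap.lTensor U g.toLinearMap (homElement b f) = homElement b (g.comp f) := by
  simp [homElement]

theorem homElement_injective {A : ArtAlg} :
    Function.Injective (homElement b (A := A)) := by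
  intro f g h
  refine algHom_ext_of_X fun i => ?_
  have := congrArg (fun z => TensorProduct.lid ℂ _ (LinearMap.rTensor A.carrier (b.coord i) z)) h
  simpa [homElement, Finsupp.single_apply] using this

theorem homElement_mem {A : ArtAlg} (f : MvPowerSeries (Fin n) ℂ →ₐ[ℂ] A.carrier) :
    homElement b f ∈ tensorSub ⊤ A.maxIdeal :=
  sum_mem fun i _ => tmul_mem_tensorSub Submodule.mem_top (algHom_mem_maximalIdeal f (by
    rw [maximalIdeal_eq_span]; exact Ideal.subset_span ⟨i, rfl⟩))

theorem exists_homElement_eq {A : ArtAlg} {u : U ⊗[ℂ] A.carrier}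
    (hu : u ∈ tensorSub ⊤ A.maxIdeal) :
    ∃ f : MvPowerSeries (Fin n) ℂ →ₐ[ℂ] A.carrier, homElement b f = u := by
  have h : ∃ v : Fin n → A.carrier, (∀ i, v i ∈ A.maxIdeal) ∧ ∑ i, b i ⊗ₜ[ℂ] v i = u := by
    induction hu using tensorSub_induction with
    | zero => exact ⟨0, fun _ => zero_mem _, by simp⟩
    | tmul w hw c hc =>
      refine ⟨fun i => b.repr w i • c, fun i => Submodule.smul_mem _ _ hc, ?_⟩
      simp only [TensorProduct.tmul_smul]
      conv_rhs => rw [← b.sum_repr w]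
      rw [TensorProduct.sum_tmul]
      rfl
    | add x y _ _ hx hy =>
      obtain ⟨v, hv, rfl⟩ := hx
      obtain ⟨w, hw, rfl⟩ := hy
      exact ⟨v + w, fun i => add_mem (hv i) (hw i), by
        simp [TensorProduct.tmul_add, Finset.sum_add_distrib]⟩
  obtain ⟨v, hv, rfl⟩ := h
  obtain ⟨f, hf⟩ := exists_algHom_X v hv
  exact ⟨f, by simp [homElement, hf]⟩

end Coordinates

namespace DGLA

open IsLocalRing MvPowerSeries

/-- If a functional annihilating the image of the codifferential is injective on `H^1` and has
values in a finite-dimensional space, then the deformation functor is prorepresentable. -/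
theorem isProrepresentable_def {V : Type*} [AddCommGroup V] [Module ℂ V]
    {𝒱 : ℤ → Submodule ℂ V} [DirectSum.Decomposition 𝒱] (L : DGLA 𝒱) {U : Type*} [AddCommGroup U]
    [Module ℂ U] [FiniteDimensional ℂ U] {ψ : GSym (gradedShift 𝒱 1) →ₗ[ℂ] U} (h1 : ψ 1 = 0)
    (hψ : ∀ z, ψ (L.codiffFull z) = 0)
    (hinj : ∀ v ∈ L.cocycles 1, ψ (GSym.ι _ v) = 0 → v ∈ (𝒱 0).map L.d) :
    IsProrepresentable L.Def := by
  let b := Module.finBasis ℂ U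
  obtain ⟨I, hI, hF⟩ := exists_ideal_of_subfunctor
    (P := MvPowerSeries (Fin (Module.finrank ℂ U)) ℂ) residue_bijective
    (fun A f => L.IsPotential ψ A (homElement b f))
    (fun A B f g h => by
      rw [← lTensor_homElement]
      exact IsPotential.map L h g)
    (fun A B f g hg h => by
      rw [← lTensor_homElement] at h
      exact L.isPotential_of_injective hψ hinj h1 hg (homElement_mem b f) h)
    (fun A f hf => by
      have : homElement b f = 0 := Finset.sum_eq_zero fun i _ => by
        rw [show f (X i) = 0 from hf (by
          rw [maximalIdeal_eq_span]; exact Ideal.subset_span ⟨i, rfl⟩), TensorProduct.tmul_zero]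
      rw [this]
      exact L.isPotential_zero h1 A)
    (fun A B C D q r s t f hq hs hc hz ht h h' => by
      rw [← lTensor_homElement] at h h'
      exact L.isPotential_of_fibreProduct hψ hinj hq hs hc hz ht h h')
  have : Nontrivial (MvPowerSeries (Fin (Module.finrank ℂ U)) ℂ ⧸ I) :=
    Ideal.Quotient.nontrivial_iff.2 hI
  have hloc : IsLocalRing (MvPowerSeries (Fin (Module.finrank ℂ U)) ℂ ⧸ I) :=
    IsLocalRing.of_surjective' (Ideal.Quotient.mk I) Ideal.Quotient.mk_surjective
  let pot : ∀ A : ArtAlg, Quot (L.GaugeRel A) → U ⊗[ℂ] A.carrier := fun A =>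
    Quot.lift (fun x => potential A.carrier ψ x.1) fun x y h => L.potential_eq_of_gaugeRel hψ h
  have pot_inj : ∀ A, Function.Injective (pot A) := by
    intro A x y hxy
    induction x using Quot.inductionOn with
    | h x =>
    induction y using Quot.inductionOn with
    | h y =>
    have := L.reflTransGen_of_potential_eq hψ hinj hxy
    clear hxy
    induction this with
    | refl => rfl
    | tail _ h ih => exact ih.trans (Quot.sound h)
  have pot_map : ∀ (A B : ArtAlg) (f : A ⟶ B) (x : L.Def.obj A),
      pot B (L.Def.map f x) =
        LinearMap.lTensor U (ArtAlg.toAlgHom f).toLinearMap (pot A x) := by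
    intro A B f x
    induction x using Quot.inductionOn with
    | h x => exact (L.lTensor_potential_map ψ (ArtAlg.toAlgHom f) x).symm
  have exists_hom : ∀ (A : ArtAlg) (x : Quot (L.GaugeRel A)),
      ∃ g : (MvPowerSeries (Fin (Module.finrank ℂ U)) ℂ ⧸ I) →ₐ[ℂ] A.carrier,
        homElement b (g.comp (Ideal.Quotient.mkₐ ℂ I)) = pot A x := by
    intro A x
    induction x using Quot.inductionOn with
    | h x =>
    obtain ⟨f, hf⟩ := exists_homElement_eq b (L.potential_mem h1 x)
    have hk := (hF A f).1 ⟨x, hf.symm⟩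
    refine ⟨Ideal.Quotient.liftₐ I f fun a ha => hk ha, ?_⟩
    exact (congrArg (homElement b) (AlgHom.ext fun _ => rfl)).trans hf
  choose e he using exists_hom
  have comp_inj : ∀ (A : ArtAlg)
      (g g' : (MvPowerSeries (Fin (Module.finrank ℂ U)) ℂ ⧸ I) →ₐ[ℂ] A.carrier),
      homElement b (g.comp (Ideal.Quotient.mkₐ ℂ I)) =
        homElement b (g'.comp (Ideal.Quotient.mkₐ ℂ I)) → g = g' := fun A g g' h =>
    Ideal.Quotient.algHom_ext ℂ (homElement_injective b h)
  have e_inj : ∀ A, Function.Injective (e A) := fun A x y hxy => pot_inj A (by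
    rw [← he A x, ← he A y, hxy])
  have e_surj : ∀ A, Function.Surjective (e A) := fun A g => by
    obtain ⟨x, hx⟩ := (hF A (g.comp (Ideal.Quotient.mkₐ ℂ I))).2 fun a ha => by
      rw [RingHom.mem_ker, AlgHom.comp_apply, Ideal.Quotient.mkₐ_eq_mk,
        Ideal.Quotient.eq_zero_iff_mem.2 ha, map_zero]
    exact ⟨Quot.mk _ x, comp_inj A _ _ ((he A _).trans hx)⟩
  -- Although `e` is chosen separately for each algebra, its values are determined by the potential,
  -- and naturality follows from that of the potential.
  have e_map : ∀ (A B : ArtAlg) (f : A ⟶ B) (x : L.Def.obj A),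
      e B (L.Def.map f x) = (ArtAlg.toAlgHom f).comp (e A x) := fun A B f x => by
    refine comp_inj B _ _ ?_
    refine (he B _).trans ((pot_map A B f x).trans ?_)
    refine (congrArg _ (he A x).symm).trans ?_
    exact lTensor_homElement b _ _
  refine ⟨_, inferInstance, inferInstance, hloc, inferInstance, isAdicComplete_quotient I, ?_,
    fun A => Equiv.ofBijective (e A) ⟨e_inj A, e_surj A⟩, e_map⟩
  refine ArtAlg.residue_bijective_of_surjective fun x => ?_
  obtain ⟨x, rfl⟩ := Ideal.Quotient.mk_surjective x
  obtain ⟨c, hc⟩ := exists_sub_algebraMap_mem residue_bijective x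
  refine ⟨c, (mem_maximalIdeal _).2 fun hu => ?_⟩
  have := IsLocalHom.of_surjective (Ideal.Quotient.mk I) Ideal.Quotient.mk_surjective
  exact (mem_maximalIdeal _).1 hc (isUnit_of_map_unit (Ideal.Quotient.mk I) _
    (by rw [map_sub]; exact hu))

end DGLA

theorem proposition3p3 {K : Type*} [AddCommGroup K] [Module ℂ K] {𝒦 : ℤ → Submodule ℂ K}
    [DirectSum.Decomposition 𝒦] (L : DGLA 𝒦) {M : Type*} [AddCommGroup M] [Module ℂ M]
    {ℳ : ℤ → Submodule ℂ M} [DirectSum.Decomposition ℳ]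
    (μ : LInftyHom L (DGLA.trivial ℳ)) :
    (FiniteDimensional ℂ (ℳ 1) → Function.Injective (μ.cohomologyMap 1) →
      IsProrepresentable L.Def) ∧
    L.obstructionSpace ≤ LinearMap.ker (μ.cohomologyMap 2) := by
  refine ⟨fun _ hinj => ?_, μ.obstructionSpace_le_ker⟩
  -- The corestriction takes values in all of M. The retraction onto M^1 makes the target
  -- finite-dimensional and is the identity on the image of degree one cocycles.
  obtain ⟨π, hπ⟩ := (ℳ 1).subtype.exists_leftInverse_of_injective (ℳ 1).ker_subtype
  refine L.isProrepresentable_def (ψ := π ∘ₗ μ.corestriction) ?_ (fun z => ?_) fun v hv h => ?_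
  · rw [LinearMap.comp_apply, μ.corestriction_one, map_zero]
  · rw [LinearMap.comp_apply, μ.corestriction_codiffFull, map_zero]
  · rw [LinearMap.comp_apply, μ.corestriction_ι] at h
    have h1 : (⟨μ.linearPart v, μ.linearPart_mem hv.1⟩ : ℳ 1) = 0 := by
      rw [← h]
      exact (LinearMap.congr_fun hπ ⟨μ.linearPart v, μ.linearPart_mem hv.1⟩).symm
    have h2 : (Submodule.Quotient.mk ⟨v, hv⟩ : L.Cohomology 1) = 0 := by
      apply hinj
      rw [map_zero]
      exact h1
    have h3 : v ∈ L.coboundaries 1 :=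
      (Submodule.Quotient.mk_eq_zero ((L.coboundaries 1).submoduleOf (L.cocycles 1))).1 h2
    -- Coboundaries of degree 1 are the image of the component of index 1 - 1, which reduces to 0.
    exact h3
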